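/- Let $\Bbbk$ be an algebraically closed field and let $A$ be the path algebra over $\Bbbk$ of the quiver with vertices $1,2$ and arrows $\alpha:1\to2$, $\beta:2\to1$, $x:1\to1$, $y:2\to2$, modulo the relations $\alpha\beta=x^2=y^2=x\beta=\alpha x=0$ (paths are composed from right to left, modules are left modules). Let $e_1,e_2$ be the trivial paths, let $P(i)=Ae_i$, let $L(i)$ be the simple top of $P(i)$ and let $I(i)$ be the injective envelope of $L(i)$, for $i\in\Lambda=\{1<2\}$. For $\lambda\in\Lambda$ let $\Delta(\lambda)$ be the quotient of $P(\lambda)$ by the trace of $\bigoplus_{\mu>\lambda}P(\mu)$ in it, let $\overline\Delta(\lambda)$ be the quotient of $\Delta(\lambda)$ by the trace of $P(\lambda)$ in $\operatorname{rad}\Delta(\lambda)$, and let $\nabla(\lambda)$, $\overline\nabla(\lambda)\subseteq I(\lambda)$ be defined dually. Write $\mathcal F(\mathcal M)$ for the modules having a finite filtration with subquotients in $\mathcal M$. For a finitely generated module $M$ let $\dim_\Delta(M)$ be the length of a shortest resolution of $M$ by modules from $\mathcal F(\Delta)$ ($\infty$ if there is none), let $\operatorname{fdim}_\Delta(A)$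 be the supremum of the finite values of $\dim_\Delta$, and let $\operatorname{fdim}(A)$ be the supremum of the finite projective dimensions of finitely generated $A$-modules. Then $A$ is finite-dimensional, $L(1),L(2)$ are its simple modules up to isomorphism, without repetition, $P(i)$ is the projective cover of $L(i)$, and: 1. $A$ is properly stratified: ${}_AA\in\mathcal F(\Delta)\cap\mathcal F(\overline\Delta)$; 2. the category of finitely generated $A$-modules has a simple preserving duality, that is, a contravariant exact self-equivalence fixing each simple module up to isomorphism; 3. the characteristic tilting module $T$ of $A$ exists and $\operatorname{pd}(T)=1$. Here $T=T(1)\oplus T(2)$ with $T(1),T(2)$ indecomposable and not isomorphic; $T$ is a generalized tilting module, which means that $T$ is finitely generated, has finite projective dimension, satisfies $\operatorname{Ext}_A^i(T,T)=0$ for all $i>0$, and that ${}_AA$ has a finite coresolution by modules from $\operatorname{Add}(T)$ (the direct summands of finite direct sums of copies of $T$); and $\operatorname{Add}(T)=\mathcal F(\Delta)\cap\mathcal F(\overline\nabla)$; 4. $\operatorname{fdim}_\Delta(A)=0$ and $\operatorname{fdim}(A)=1$. Hence $2\cdot\operatorname{fdim}_\Delta(A)<\operatorname{fdim}(A)<2\cdot\operatorname{pd}(T)$.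 In particular the following conjecture is false over every algebraically closed field $\Bbbk$: for every finite-dimensional properly stratified $\Bbbk$-algebra with a simple preserving duality, the projectively defined finitistic dimension equals twice the projective dimension of the characteristic tilting module. -/

import Mathlib

open CategoryTheory Module
open scoped DirectSum

universe u

noncomputable section

namespace Stratified

/-! ### Traces, rejects, socle, covers and envelopes -/

section Modules

variable (A : Type u) [Ring A]

/-- The trace of `N` in `M`: the sum of the images of all homomorphisms `N → M`. -/
def trace (N M : Type u) [AddCommGroup N] [Module A N] [AddCommGroup M] [Module A M] :
    Submodule A M :=
  ⨆ f : N →ₗ[A] M, LinearMap.range f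

/-- The reject of `N` in `M` (the notion dual to the trace): the intersection of the kernels of
all homomorphisms `M → N`. -/
def reject (N M : Type u) [AddCommGroup N] [Module A N] [AddCommGroup M] [Module A M] :
    Submodule A M :=
  ⨅ f : M →ₗ[A] N, LinearMap.ker f

/-- The socle: the sum of all simple submodules. -/
def socle (M : Type u) [AddCommGroup M] [Module A M] : Submodule A M :=
  sSup {S : Submodule A M | IsSimpleModule A S}

variable {A}

/-- `P` is a projective cover of `L`: it is projective and has an epimorphism onto `L` with
superfluous kernel. -/
def IsProjectiveCover (P L : ModuleCat.{u} A) : Prop :=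
  Module.Projective A P ∧ ∃ f : P →ₗ[A] L, Function.Surjective f ∧
    ∀ N : Submodule A P, N ⊔ LinearMap.ker f = ⊤ → N = ⊤

/-- `I` is an injective envelope of `L`: it is injective and has a monomorphism from `L` with
essential image. -/
def IsInjectiveEnvelope (I L : ModuleCat.{u} A) : Prop :=
  Module.Injective A I ∧ ∃ f : L →ₗ[A] I, Function.Injective f ∧
    ∀ N : Submodule A I, N ⊓ LinearMap.range f = ⊥ → N = ⊥

/-- A nonzero module which is not the direct sum of two nonzero submodules. -/
def IsIndecomposable (M : ModuleCat.{u} A) : Prop :=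
  Nontrivial M ∧ ∀ N N' : Submodule A M, IsCompl N N' → N = ⊥ ∨ N' = ⊥

/-- `L` lists the simple modules, without repetition up to isomorphism, and `P l`, `I l` are the
projective cover and the injective envelope of `L l`. -/
structure IsLabelling {Λ : Type} (L P I : Λ → ModuleCat.{u} A) : Prop where
  simple : ∀ l, IsSimpleModule A (L l)
  distinct : ∀ l m, Nonempty (L l ≃ₗ[A] L m) → l = m
  exhaustive : ∀ S : ModuleCat.{u} A, IsSimpleModule A S → ∃ l, Nonempty (S ≃ₗ[A] L l)
  projectiveCover : ∀ l, IsProjectiveCover (P l) (L l)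
  injectiveEnvelope : ∀ l, IsInjectiveEnvelope (I l) (L l)

end Modules

/-! ### Standard and costandard modules -/

section Standard

variable {A : Type u} [Ring A] {Λ : Type} [LinearOrder Λ]

/-- `Δ(l) = P(l) / Trace_{P^{>l}}(P(l))`, where `P^{>l} = ⨁_{m > l} P(m)`. -/
def standard (P : Λ → ModuleCat.{u} A) (l : Λ) : ModuleCat.{u} A :=
  ModuleCat.of A (P l ⧸ trace A (⨁ m : {m : Λ // l < m}, P m.1) (P l))

/-- `Δ̄(l) = Δ(l) / Trace_{P(l)}(rad Δ(l))`. -/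
def properStandard (P : Λ → ModuleCat.{u} A) (l : Λ) : ModuleCat.{u} A :=
  ModuleCat.of A (standard P l ⧸
    (trace A (P l) (Module.jacobson A (standard P l))).map
      (Module.jacobson A (standard P l)).subtype)

/-- `∇(l)`, dual to `Δ(l)`: the common kernel in `I(l)` of all homomorphisms to
`⨁_{m > l} I(m)`. -/
def costandard (I : Λ → ModuleCat.{u} A) (l : Λ) : ModuleCat.{u} A :=
  ModuleCat.of A (reject A (⨁ m : {m : Λ // l < m}, I m.1) (I l))

/-- `∇̄(l)`, dual to `Δ̄(l)`: the preimage in `∇(l)` of the common kernel of all homomorphisms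
`∇(l) / soc ∇(l) → I(l)`. -/
def properCostandard (I : Λ → ModuleCat.{u} A) (l : Λ) : ModuleCat.{u} A :=
  ModuleCat.of A ((reject A (I l) (costandard I l ⧸ socle A (costandard I l))).comap
    (socle A (costandard I l)).mkQ)

end Standard

/-! ### Filtrations, resolutions, additive closure, dimensions -/

section Dimensions

variable {A : Type u} [Ring A]

/-- `M` has a finite filtration whose subquotients are isomorphic to members of the family `S`. -/
def IsFiltered {Λ : Type} (S : Λ → ModuleCat.{u} A) (M : ModuleCat.{u} A) : Prop :=
  ∃ (n : ℕ) (F : ℕ → Submodule A M), Monotone F ∧ F 0 = ⊥ ∧ F n = ⊤ ∧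
    ∀ i < n, ∃ l, Nonempty ((F (i + 1) ⧸ (F i).submoduleOf (F (i + 1))) ≃ₗ[A] S l)

/-- `HasResolution S n M`: there is an exact sequence `0 → X n → ⋯ → X 0 → M → 0` with all
`X i` in the class `S` (spliced from short exact sequences). -/
inductive HasResolution (S : ModuleCat.{u} A → Prop) : ℕ → ModuleCat.{u} A → Prop
  | zero (M X : ModuleCat.{u} A) (hX : S X) (e : X ≃ₗ[A] M) : HasResolution S 0 M
  | succ (n : ℕ) (K X M : ModuleCat.{u} A) (hX : S X) (f : K →ₗ[A] X) (g : X →ₗ[A] M)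
      (hf : Function.Injective f) (hfg : Function.Exact f g) (hg : Function.Surjective g)
      (hK : HasResolution S n K) : HasResolution S (n + 1) M

/-- `HasCoresolution S n M`: there is an exact sequence `0 → M → X 0 → ⋯ → X n → 0` with all
`X i` in the class `S` (spliced from short exact sequences). -/
inductive HasCoresolution (S : ModuleCat.{u} A → Prop) : ℕ → ModuleCat.{u} A → Prop
  | zero (M X : ModuleCat.{u} A) (hX : S X) (e : M ≃ₗ[A] X) : HasCoresolution S 0 M
  | succ (n : ℕ) (M X K : ModuleCat.{u} A) (hX : S X) (f : M →ₗ[A] X) (g : X →ₗ[A] K)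
      (hf : Function.Injective f) (hfg : Function.Exact f g) (hg : Function.Surjective g)
      (hK : HasCoresolution S n K) : HasCoresolution S (n + 1) M

/-- The filtration dimension of `M` with respect to the family `S`: the length of the shortest
resolution of `M` by `S`-filtered modules, and `⊤` if there is none. -/
def filtrationDim {Λ : Type} (S : Λ → ModuleCat.{u} A) (M : ModuleCat.{u} A) : ℕ∞ :=
  ⨅ n : {n : ℕ // HasResolution (IsFiltered S) n M}, (n.1 : ℕ∞)

/-- The supremum of the finite `S`-filtration dimensions of finitely generated modules. -/
def finitisticFiltrationDim {Λ : Type} (S : Λ → ModuleCat.{u} A) : ℕ∞ :=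
  ⨆ M : {M : ModuleCat.{u} A // Module.Finite A M ∧ filtrationDim S M < ⊤},
    filtrationDim S M.1

variable (A) in
/-- The projectively defined finitistic dimension: the supremum of the finite projective
dimensions of finitely generated modules (the zero module has projective dimension `⊥`). -/
def finitisticDim : WithBot ℕ∞ :=
  ⨆ M : {M : ModuleCat.{u} A // Module.Finite A M ∧ projectiveDimension M < ⊤},
    projectiveDimension M.1

/-- The additive closure of `T`: direct summands of finite direct sums of copies of `T`. -/
def IsInAdd (T M : ModuleCat.{u} A) : Prop :=
  ∃ (n : ℕ) (i : M →ₗ[A] (Fin n → T)) (p : (Fin n → T) →ₗ[A] M), p ∘ₗ i = LinearMap.id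

/-- Generalized tilting modules. -/
structure IsGeneralizedTilting (T : ModuleCat.{u} A) : Prop where
  finite : Module.Finite A T
  projectiveDimension_lt : projectiveDimension T < ⊤
  ext_self : ∀ i : ℕ, 0 < i → Subsingleton (Abelian.Ext.{u} T T i)
  coresolution : ∃ n, HasCoresolution (IsInAdd T) n (ModuleCat.of A A)

/-- The direct sum of a family of modules. -/
def total {Λ : Type} (T : Λ → ModuleCat.{u} A) : ModuleCat.{u} A :=
  ModuleCat.of A (⨁ l, T l)

variable (A) in
/-- `A`-mod has a simple preserving duality: a contravariant self-equivalence (which is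
automatically exact) that fixes every simple module up to isomorphism. -/
def HasSimplePreservingDuality : Prop :=
  ∃ D : (FGModuleCat.{u} A)ᵒᵖ ≌ FGModuleCat.{u} A,
    ∀ S : FGModuleCat.{u} A, IsSimpleModule A S → Nonempty (D.functor.obj (Opposite.op S) ≅ S)

end Dimensions

/-! ### Properly stratified algebras -/

section Algebras

variable {A : Type u} [Ring A] {Λ : Type} [LinearOrder Λ]

/-- The regular module has a filtration by standard modules, and one by proper standard modules. -/
def IsProperlyStratified (P : Λ → ModuleCat.{u} A) : Prop :=
  IsFiltered (standard P) (ModuleCat.of A A) ∧ IsFiltered (properStandard P) (ModuleCat.of A A)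

/-- The modules `T l` are the indecomposable summands, up to isomorphism and without repetition,
of the characteristic tilting module `⨁ l, T l`: the generalized tilting module whose additive
closure consists of the modules that have both a standard and a proper costandard filtration. -/
structure IsCharacteristicTilting (P I T : Λ → ModuleCat.{u} A) : Prop where
  indecomposable : ∀ l, IsIndecomposable (T l)
  distinct : ∀ l m, Nonempty (T l ≃ₗ[A] T m) → l = m
  generalizedTilting : IsGeneralizedTilting (total T)
  add_iff : ∀ M : ModuleCat.{u} A, Module.Finite A M →
    (IsInAdd (total T) M ↔ IsFiltered (standard P) M ∧ IsFiltered (properCostandard I) M)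

end Algebras

/-- The conjecture that every finite-dimensional properly stratified `k`-algebra with a simple
preserving duality has finitistic dimension equal to twice the projective dimension of its
characteristic tilting module. -/
def DoublingConjecture (k : Type u) [Field k] : Prop :=
  ∀ (A : Type u) [Ring A] [Algebra k A], FiniteDimensional k A →
    ∀ (n : ℕ) (L P I : Fin n → ModuleCat.{u} A), IsLabelling L P I →
      IsProperlyStratified P → HasSimplePreservingDuality A →
        ∀ T : Fin n → ModuleCat.{u} A, IsCharacteristicTilting P I T →
          finitisticDim A = 2 * projectiveDimension (total T)

/-! ### The algebra -/

/-- The trivial paths `e 0`, `e 1` (at the vertices 1, 2) and the arrows `α : 1 → 2`,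
`β : 2 → 1`, `x : 1 → 1`, `y : 2 → 2`. -/
inductive Gen : Type
  | e (i : Fin 2)
  | α
  | β
  | x
  | y

/-- The defining relations. Paths are composed from right to left: `p * q` is `q` followed by
`p`. The relations up to `y_path` present the path algebra of the quiver. -/
inductive Rel (k : Type u) [Field k] : FreeAlgebra k Gen → FreeAlgebra k Gen → Prop
  | idem (i : Fin 2) : Rel k (.ι k (.e i) * .ι k (.e i)) (.ι k (.e i))
  | orth (i j : Fin 2) (h : i ≠ j) : Rel k (.ι k (.e i) * .ι k (.e j)) 0
  | one : Rel k (.ι k (.e 0) + .ι k (.e 1)) 1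
  | α_path : Rel k (.ι k (.e 1) * .ι k .α * .ι k (.e 0)) (.ι k .α)
  | β_path : Rel k (.ι k (.e 0) * .ι k .β * .ι k (.e 1)) (.ι k .β)
  | x_path : Rel k (.ι k (.e 0) * .ι k .x * .ι k (.e 0)) (.ι k .x)
  | y_path : Rel k (.ι k (.e 1) * .ι k .y * .ι k (.e 1)) (.ι k .y)
  | αβ : Rel k (.ι k .α * .ι k .β) 0
  | xx : Rel k (.ι k .x * .ι k .x) 0
  | yy : Rel k (.ι k .y * .ι k .y) 0
  | xβ : Rel k (.ι k .x * .ι k .β) 0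
  | αx : Rel k (.ι k .α * .ι k .x) 0

/-- The path algebra of the quiver modulo `αβ = x² = y² = xβ = αx = 0`. -/
abbrev QuiverAlgebra (k : Type u) [Field k] : Type u := RingQuot (Rel k)

/-- The class of a generator. -/
def gen (k : Type u) [Field k] (g : Gen) : QuiverAlgebra k :=
  RingQuot.mkAlgHom k (Rel k) (FreeAlgebra.ι k g)

/-- The left module `A e_i`. -/
def proj (k : Type u) [Field k] (i : Fin 2) : ModuleCat.{u} (QuiverAlgebra k) :=
  ModuleCat.of _ (Ideal.span {gen k (.e i)} : Ideal (QuiverAlgebra k))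

end Stratified

end

/-!
The vertices `1, 2` of the quiver are the indices `0, 1`. The algebra has a basis of ten paths,
`e₀, x, α, yα, βα, βyα` starting at the first vertex and `e₁, y, β, βy` at the second one, because
they act independently on a ten-dimensional representation (`equivRegular`). Every module which is
needed explicitly is such a representation by partial permutations of a basis (`MonomialRep`), and
all isomorphisms are obtained by comparing annihilators of generators (`nonempty_span_equiv`).

The idea of the proof is that the relevant classes of finitely generated modules have elementary
descriptions in terms of the action of the arrows:

* `M` has a standard filtration if and only if it is Δ-exact (`IsDeltaExact`): on `e₁ M`, the
  kernel of `y` is its image and `β` is injective; and `x v = β u` implies `v ∈ x M + β M`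
  for `v ∈ e₀ M` (`IsFiltered.isDeltaExact`, `IsDeltaExact.isFiltered`).
* If `β` is injective on `e₁ M`, then `M` has a proper standard filtration
  (`IsBetaInjective.isFiltered`).
* `M` has a proper costandard filtration if and only if `α` is surjective onto `e₁ M`
  (`IsFiltered.isAlphaSurjective`, `IsAlphaSurjective.isFiltered`).

The first description shows that the modules with a standard filtration are closed under cokernels
of monomorphisms (`IsDeltaExact.of_cokernel`). So a module with a finite resolution by such modules
is itself one, and the finitistic Δ-filtration dimension is zero; moreover every finitely generated
module of finite projective dimension has a standard filtration, since projective modules do. As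
`Δ(1) = A e_1` is projective and `0 → A e_1 → A e_0 → Δ(0) → 0` is exact, modules with a standard
filtration have projective dimension at most one. In a projective module `x` annihilates the
vectors of `e₀ M` annihilated by `α`, which fails for `Δ(0)`. Hence the finitistic dimension is one.

The characteristic tilting module is the sum of `tilt₁ = Δ(0)`, with basis `t, xt`, and of the
eight-dimensional module `tilt₂`. The resolution of `Δ(0)` shows that `Ext¹(M, N)` vanishes if `M`
has a standard and `N` a proper costandard filtration. If `M` has both, there is an epimorphism onto
`M` from a power of the tilting module, the kernel of which has a proper costandard filtration
(`exists_total_approximation`); it splits, which identifies the additive closure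
(`isInAdd_total_iff`). The algebra embeds into `tilt₂ ⊕ tilt₂` and the cokernel lies in the
additive closure.

The duality is the `k`-dual, made into a left module by the anti-involution which exchanges `α` and
`β` and fixes `x`, `y`. It also provides the injective modules `inj k i`, the duals of `A e_i`.
-/

noncomputable section

namespace Stratified

variable {k : Type u} [Field k]

/-! ### The algebra and its monomial representations -/

/-- The vertex at which a generator starts. -/
@[simp] def Gen.src : Gen → Fin 2
  | .e i => i
  | .α => 0
  | .β => 1
  | .x => 0
  | .y => 1

/-- The vertex at which a generator ends. -/
@[simp] def Gen.tgt : Gen → Fin 2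
  | .e i => i
  | .α => 1
  | .β => 0
  | .x => 0
  | .y => 1

lemma e_add : gen k (.e 0) + gen k (.e 1) = 1 := by
  simpa [gen] using RingQuot.mkAlgHom_rel k (Rel.one (k := k))

lemma e_mul_e (i j : Fin 2) :
    gen k (.e i) * gen k (.e j) = if i = j then gen k (.e j) else 0 := by
  split_ifs with h
  · subst h
    simpa [gen] using RingQuot.mkAlgHom_rel k (Rel.idem (k := k) i)
  · simpa [gen] using RingQuot.mkAlgHom_rel k (Rel.orth (k := k) i j h)

lemma path_rel (g : Gen) : gen k (.e g.tgt) * gen k g * gen k (.e g.src) = gen k g := by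
  cases g with
  | e i => simp [e_mul_e]
  | α => simpa [gen] using RingQuot.mkAlgHom_rel k (Rel.α_path (k := k))
  | β => simpa [gen] using RingQuot.mkAlgHom_rel k (Rel.β_path (k := k))
  | x => simpa [gen] using RingQuot.mkAlgHom_rel k (Rel.x_path (k := k))
  | y => simpa [gen] using RingQuot.mkAlgHom_rel k (Rel.y_path (k := k))

lemma e_mul_gen (i : Fin 2) (g : Gen) :
    gen k (.e i) * gen k g = if i = g.tgt then gen k g else 0 := by
  conv_lhs => rw [← path_rel g, mul_assoc, ← mul_assoc, e_mul_e]
  split_ifs with h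
  · rw [← mul_assoc, path_rel]
  · rw [zero_mul]

lemma gen_mul_e (i : Fin 2) (g : Gen) :
    gen k g * gen k (.e i) = if g.src = i then gen k g else 0 := by
  conv_lhs => rw [← path_rel g, mul_assoc, e_mul_e]
  split_ifs with h
  · rw [← h, path_rel]
  · rw [mul_zero]

lemma gen_mul_gen_of_ne {g h : Gen} (hgh : g.src ≠ h.tgt) : gen k g * gen k h = 0 := by
  conv_lhs => rw [← path_rel g, mul_assoc, e_mul_gen g.src, if_neg hgh, mul_zero]

lemma α_mul_β : gen k .α * gen k .β = 0 := by
  simpa [gen] using RingQuot.mkAlgHom_rel k (Rel.αβ (k := k))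

lemma x_mul_x : gen k .x * gen k .x = 0 := by
  simpa [gen] using RingQuot.mkAlgHom_rel k (Rel.xx (k := k))

lemma y_mul_y : gen k .y * gen k .y = 0 := by
  simpa [gen] using RingQuot.mkAlgHom_rel k (Rel.yy (k := k))

lemma x_mul_β : gen k .x * gen k .β = 0 := by
  simpa [gen] using RingQuot.mkAlgHom_rel k (Rel.xβ (k := k))

lemma α_mul_x : gen k .α * gen k .x = 0 := by
  simpa [gen] using RingQuot.mkAlgHom_rel k (Rel.αx (k := k))

section Action

variable {M : Type*} [AddCommGroup M] [Module (QuiverAlgebra k) M]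

@[simp] lemma e_smul_gen_smul (i : Fin 2) (g : Gen) (m : M) :
    gen k (.e i) • gen k g • m = if i = g.tgt then gen k g • m else 0 := by
  rw [smul_smul, e_mul_gen]; split_ifs <;> simp

@[simp] lemma gen_smul_e_smul (i : Fin 2) (g : Gen) (m : M) :
    gen k g • gen k (.e i) • m = if g.src = i then gen k g • m else 0 := by
  rw [smul_smul, gen_mul_e]; split_ifs <;> simp

lemma gen_smul_gen_smul_of_ne {g h : Gen} (hgh : g.src ≠ h.tgt) (m : M) :
    gen k g • gen k h • m = 0 := by
  rw [smul_smul, gen_mul_gen_of_ne hgh, zero_smul]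

@[simp] lemma α_smul_α_smul (m : M) : gen k .α • gen k .α • m = 0 :=
  gen_smul_gen_smul_of_ne (by simp) m

@[simp] lemma β_smul_β_smul (m : M) : gen k .β • gen k .β • m = 0 :=
  gen_smul_gen_smul_of_ne (by simp) m

@[simp] lemma x_smul_y_smul (m : M) : gen k .x • gen k .y • m = 0 :=
  gen_smul_gen_smul_of_ne (by simp) m

@[simp] lemma y_smul_x_smul (m : M) : gen k .y • gen k .x • m = 0 :=
  gen_smul_gen_smul_of_ne (by simp) m

@[simp] lemma α_smul_y_smul (m : M) : gen k .α • gen k .y • m = 0 :=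
  gen_smul_gen_smul_of_ne (by simp) m

@[simp] lemma x_smul_α_smul (m : M) : gen k .x • gen k .α • m = 0 :=
  gen_smul_gen_smul_of_ne (by simp) m

@[simp] lemma β_smul_x_smul (m : M) : gen k .β • gen k .x • m = 0 :=
  gen_smul_gen_smul_of_ne (by simp) m

@[simp] lemma y_smul_β_smul (m : M) : gen k .y • gen k .β • m = 0 :=
  gen_smul_gen_smul_of_ne (by simp) m

@[simp] lemma α_smul_β_smul (m : M) : gen k .α • gen k .β • m = 0 := by
  rw [smul_smul, α_mul_β, zero_smul]

@[simp] lemma x_smul_x_smul (m : M) : gen k .x • gen k .x • m = 0 := by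
  rw [smul_smul, x_mul_x, zero_smul]

@[simp] lemma y_smul_y_smul (m : M) : gen k .y • gen k .y • m = 0 := by
  rw [smul_smul, y_mul_y, zero_smul]

@[simp] lemma x_smul_β_smul (m : M) : gen k .x • gen k .β • m = 0 := by
  rw [smul_smul, x_mul_β, zero_smul]

@[simp] lemma α_smul_x_smul (m : M) : gen k .α • gen k .x • m = 0 := by
  rw [smul_smul, α_mul_x, zero_smul]

variable (k) in
lemma e_smul_add (m : M) : gen k (.e 0) • m + gen k (.e 1) • m = m := by
  rw [← add_smul, e_add, one_smul]

/-- A generator annihilates the vectors which live at a vertex other than its source. -/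
lemma gen_smul_eq_zero {g : Gen} {i : Fin 2} {m : M} (hm : gen k (.e i) • m = m)
    (h : g.src ≠ i) : gen k g • m = 0 := by
  rw [← hm, gen_smul_e_smul, if_neg h]

end Action

/-- A property of elements of the algebra which holds for scalars and generators, and is stable
under sums and products, holds throughout. -/
@[elab_as_elim]
lemma QuiverAlgebra.induction {C : QuiverAlgebra k → Prop}
    (scalar : ∀ c : k, C (algebraMap k _ c)) (gen : ∀ g, C (gen k g))
    (mul : ∀ a b, C a → C b → C (a * b)) (add : ∀ a b, C a → C b → C (a + b))
    (a : QuiverAlgebra k) : C a := by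
  obtain ⟨a, rfl⟩ := RingQuot.mkAlgHom_surjective k (Rel k) a
  induction a using FreeAlgebra.induction with
  | grade0 c => simpa using scalar c
  | grade1 g => exact gen g
  | mul a b ha hb => simpa using mul _ _ ha hb
  | add a b ha hb => simpa using add _ _ ha hb

/-- A `k`-linear map which commutes with the generators is linear over the algebra. -/
def linearMapOfGen {M N : Type*} [AddCommGroup M] [Module k M] [Module (QuiverAlgebra k) M]
    [IsScalarTower k (QuiverAlgebra k) M] [AddCommGroup N] [Module k N]
    [Module (QuiverAlgebra k) N] [IsScalarTower k (QuiverAlgebra k) N] (f : M →ₗ[k] N)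
    (hf : ∀ g m, f (gen k g • m) = gen k g • f m) : M →ₗ[QuiverAlgebra k] N where
  toFun := f
  map_add' := map_add f
  map_smul' a := by
    induction a using QuiverAlgebra.induction with
    | scalar c => intro m; simp
    | gen g => exact hf g
    | mul a b ha hb => intro m; rw [mul_smul, ha, hb]; simp [mul_smul]
    | add a b ha hb => intro m; rw [add_smul, map_add, ha, hb]; simp [add_smul]

/-- A representation of the quiver with relations having a basis which each arrow permutes
partially: `pre g i = some j` means that `g` maps the `j`-th basis vector to the `i`-th one, and
`vert i` is the vertex of the `i`-th basis vector. -/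
structure MonomialRep where
  /-- The dimension. -/
  n : ℕ
  /-- The vertices of the basis vectors. -/
  vert : Fin n → Fin 2
  /-- The partial preimages under `α`. -/
  α : Fin n → Option (Fin n) := fun _ => none
  /-- The partial preimages under `β`. -/
  β : Fin n → Option (Fin n) := fun _ => none
  /-- The partial preimages under `x`. -/
  x : Fin n → Option (Fin n) := fun _ => none
  /-- The partial preimages under `y`. -/
  y : Fin n → Option (Fin n) := fun _ => none
  α_path : ∀ i j, α i = some j → vert i = 1 ∧ vert j = 0 := by decide
  β_path : ∀ i j, β i = some j → vert i = 0 ∧ vert j = 1 := by decide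
  x_path : ∀ i j, x i = some j → vert i = 0 ∧ vert j = 0 := by decide
  y_path : ∀ i j, y i = some j → vert i = 1 ∧ vert j = 1 := by decide
  αβ : ∀ i j, α i = some j → β j = none := by decide
  xx : ∀ i j, x i = some j → x j = none := by decide
  yy : ∀ i j, y i = some j → y j = none := by decide
  xβ : ∀ i j, x i = some j → β j = none := by decide
  αx : ∀ i j, α i = some j → x j = none := by decide

namespace MonomialRep

/-- The partial preimages under all generators. -/
def pre (V : MonomialRep) : Gen → Fin V.n → Option (Fin V.n)
  | .e j => fun i => if V.vert i = j then some i else none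
  | .α => V.α
  | .β => V.β
  | .x => V.x
  | .y => V.y

/-- The action of a generator. -/
def act (k : Type u) [Field k] (V : MonomialRep) (g : Gen) : Module.End k (Fin V.n → k) where
  toFun v i := (V.pre g i).elim 0 v
  map_add' v w := by
    ext i; rcases h : V.pre g i with _ | j <;> simp [h]
  map_smul' c v := by
    ext i; rcases h : V.pre g i with _ | j <;> simp [h]

lemma act_apply (V : MonomialRep) (g : Gen) (v : Fin V.n → k) (i : Fin V.n) :
    act k V g v i = (V.pre g i).elim 0 v := rfl

lemma act_mul_act (V : MonomialRep) (g h : Gen) (v : Fin V.n → k) (i : Fin V.n) :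
    (act k V g * act k V h) v i = ((V.pre g i).bind (V.pre h)).elim 0 v := by
  rw [Module.End.mul_apply, act_apply]
  rcases V.pre g i with _ | j <;> rfl

/-- The action of the algebra. -/
def toEnd (k : Type u) [Field k] (V : MonomialRep) :
    QuiverAlgebra k →ₐ[k] Module.End k (Fin V.n → k) :=
  RingQuot.liftAlgHom k ⟨FreeAlgebra.lift k (act k V), by
    have path : ∀ g s t, (∀ i j, V.pre g i = some j → V.vert i = t ∧ V.vert j = s) →
        act k V (.e t) * act k V g * act k V (.e s) = act k V g := by
      intro g s t hg
      refine LinearMap.ext fun v => funext fun i => ?_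
      simp only [Module.End.mul_apply, act_apply]
      rcases h : V.pre g i with _ | j
      · simp only [pre]; split_ifs <;> simp [act_apply, h]
      · have hp : ∀ l, V.pre (.e l) = fun i => if V.vert i = l then some i else none := fun _ => rfl
        simp [hp, hg i j h, act_apply, h]
    have zero : ∀ g h, (∀ i j, V.pre g i = some j → V.pre h j = none) →
        act k V g * act k V h = 0 := by
      intro g h hgh
      refine LinearMap.ext fun v => funext fun i => ?_
      rw [act_mul_act]
      rcases h' : V.pre g i with _ | j
      · simp
      · simp [hgh i j h']
    intro a b h
    induction h with
    | idem i =>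
      have h0 : act k V (.e i) * act k V (.e i) = act k V (.e i) :=
        LinearMap.ext fun v => funext fun j => by
          simp only [Module.End.mul_apply, act_apply, pre]
          split_ifs with h <;> simp [act_apply, pre, h]
      simpa using h0
    | orth i j h => simpa using zero (.e i) (.e j) (by
        simp only [pre, Option.ite_none_right_eq_some, Option.some.injEq]
        rintro i' j' ⟨h1, rfl⟩
        simp [h1, h])
    | one =>
      refine LinearMap.ext fun v => funext fun i => ?_
      have : V.vert i = 0 ∨ V.vert i = 1 := by omega
      rcases this with h | h <;> simp [act_apply, pre, h]
    | α_path => simpa using path .α 0 1 V.α_path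
    | β_path => simpa using path .β 1 0 V.β_path
    | x_path => simpa using path .x 0 0 V.x_path
    | y_path => simpa using path .y 1 1 V.y_path
    | αβ => simpa using zero .α .β V.αβ
    | xx => simpa using zero .x .x V.xx
    | yy => simpa using zero .y .y V.yy
    | xβ => simpa using zero .x .β V.xβ
    | αx => simpa using zero .α .x V.αx⟩

lemma toEnd_gen (V : MonomialRep) (g : Gen) : toEnd k V (gen k g) = act k V g := by
  simp [toEnd, gen]

/-- The underlying module of a monomial representation. -/
def Carrier (k : Type u) (V : MonomialRep) : Type u := Fin V.n → k

instance (V : MonomialRep) : AddCommGroup (V.Carrier k) :=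
  inferInstanceAs (AddCommGroup (Fin V.n → k))

instance (V : MonomialRep) : Module k (V.Carrier k) := inferInstanceAs (Module k (Fin V.n → k))

instance (V : MonomialRep) : Module (QuiverAlgebra k) (V.Carrier k) :=
  Module.compHom (Fin V.n → k) (toEnd k V).toRingHom

lemma smul_def (V : MonomialRep) (a : QuiverAlgebra k) (v : V.Carrier k) :
    a • v = toEnd k V a v := rfl

instance (V : MonomialRep) : IsScalarTower k (QuiverAlgebra k) (V.Carrier k) where
  smul_assoc c a v := by simp only [smul_def, map_smul]; rfl

/-- The vector with given coordinates. -/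
def ofFun (V : MonomialRep) (f : Fin V.n → k) : V.Carrier k := f

omit [Field k] in
@[simp] lemma ofFun_apply (V : MonomialRep) (f : Fin V.n → k) (i : Fin V.n) :
    V.ofFun f i = f i := rfl

lemma gen_smul_apply (V : MonomialRep) (g : Gen) (v : V.Carrier k) (i : Fin V.n) :
    (gen k g • v) i = (V.pre g i).elim 0 (fun j => v j) := by
  rw [smul_def, toEnd_gen]; rfl

lemma coord_eq {V : MonomialRep} {g : Gen} {v w : V.Carrier k} (h : gen k g • v = w)
    (i : Fin V.n) : (V.pre g i).elim 0 (fun j => v j) = w i := by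
  rw [← h, gen_smul_apply]

lemma coord_eq_zero {V : MonomialRep} {g : Gen} {v : V.Carrier k} (h : gen k g • v = 0)
    (i : Fin V.n) : (V.pre g i).elim 0 (fun j => v j) = 0 :=
  coord_eq h i

lemma add_apply (V : MonomialRep) (v w : V.Carrier k) (i : Fin V.n) : (v + w) i = v i + w i := rfl

lemma smul_apply (V : MonomialRep) (c : k) (v : V.Carrier k) (i : Fin V.n) :
    (c • v) i = c * v i := rfl

@[simp] lemma zero_apply (V : MonomialRep) (i : Fin V.n) : (0 : V.Carrier k) i = 0 := rfl

/-- The simple module at a vertex. -/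
abbrev simple (i : Fin 2) : MonomialRep where
  n := 1
  vert _ := i
  α_path := by simp
  β_path := by simp
  x_path := by simp
  y_path := by simp
  αβ := by simp
  xx := by simp
  yy := by simp
  xβ := by simp
  αx := by simp

/-- The standard module at the first vertex, with basis `t, x t`. -/
abbrev tilt₁ : MonomialRep where
  n := 2
  vert := ![0, 0]
  x := ![none, some 0]

/-- The proper standard module at the second vertex, with basis `w, β w`. -/
abbrev rep₂ : MonomialRep where
  n := 2
  vert := ![1, 0]
  β := ![none, some 0]

/-- The module with basis `u, x u, v, x v, w, y w, β w, β y w`, where `α v = w` and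
`α u = y w`. -/
abbrev tilt₂ : MonomialRep where
  n := 8
  vert := ![0, 0, 0, 0, 1, 1, 0, 0]
  α := ![none, none, none, none, some 2, some 0, none, none]
  β := ![none, none, none, none, none, none, some 4, some 5]
  x := ![none, some 0, none, some 2, none, none, none, none]
  y := ![none, none, none, none, none, some 4, none, none]

/-- The regular representation, with basis
`e₀, x, α, y α, β α, β y α, e₁, y, β, β y`. -/
abbrev regular : MonomialRep where
  n := 10
  vert := ![0, 0, 1, 1, 0, 0, 1, 1, 0, 0]
  α := ![none, none, some 0, none, none, none, none, none, none, none]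
  β := ![none, none, none, none, some 2, some 3, none, none, some 6, some 7]
  x := ![none, some 0, none, none, none, none, none, none, none, none]
  y := ![none, none, none, some 2, none, none, none, some 6, none, none]

end MonomialRep

@[simp] lemma gen_smul_smul {M : Type*} [AddCommGroup M] [Module k M] [Module (QuiverAlgebra k) M]
    [IsScalarTower k (QuiverAlgebra k) M] (g : Gen) (c : k) (m : M) :
    gen k g • c • m = c • gen k g • m := smul_comm _ _ _

namespace MonomialRep

section Coefficients

variable {M : Type*} [AddCommGroup M] [Module k M] [Module (QuiverAlgebra k) M]
    [IsScalarTower k (QuiverAlgebra k) M]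

/-- The action on `m` of the linear combination of paths with given coefficients. -/
def ofCoeff (m : M) : regular.Carrier k →ₗ[QuiverAlgebra k] M :=
  linearMapOfGen (k := k)
    { toFun := fun v => v 0 • gen k (.e 0) • m + v 1 • gen k .x • m + v 2 • gen k .α • m +
        v 3 • gen k .y • gen k .α • m + v 4 • gen k .β • gen k .α • m +
        v 5 • gen k .β • gen k .y • gen k .α • m + v 6 • gen k (.e 1) • m +
        v 7 • gen k .y • m + v 8 • gen k .β • m + v 9 • gen k .β • gen k .y • m
      map_add' := fun v w => by
        simp only [MonomialRep.add_apply, add_smul]; abel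
      map_smul' := fun c v => by
        simp [MonomialRep.smul_apply, mul_smul] } (by
    intro g v
    rcases g with i | _ | _ | _ | _
    · fin_cases i <;> simp [pre, gen_smul_apply]
    all_goals simp [pre, gen_smul_apply])

lemma ofCoeff_apply (m : M) (v : regular.Carrier k) :
    ofCoeff m v = v 0 • gen k (.e 0) • m + v 1 • gen k .x • m + v 2 • gen k .α • m +
      v 3 • gen k .y • gen k .α • m + v 4 • gen k .β • gen k .α • m +
      v 5 • gen k .β • gen k .y • gen k .α • m + v 6 • gen k (.e 1) • m +
      v 7 • gen k .y • m + v 8 • gen k .β • m + v 9 • gen k .β • gen k .y • m := rfl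

/-- The coefficients of the unit. -/
def unit (k : Type u) [Field k] : regular.Carrier k := regular.ofFun ![1, 0, 0, 0, 0, 0, 1, 0, 0, 0]

lemma ofCoeff_unit (m : M) : ofCoeff m (unit k) = m := by
  rw [ofCoeff_apply]
  simp [unit, e_smul_add]

end Coefficients

/-- The paths are a basis of the algebra. -/
def equivRegular (k : Type u) [Field k] : QuiverAlgebra k ≃ₗ[QuiverAlgebra k] regular.Carrier k :=
  LinearEquiv.ofLinearMap (LinearMap.toSpanSingleton _ _ (unit k)) (ofCoeff (1 : QuiverAlgebra k))
    (by
      refine LinearMap.ext fun v => ?_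
      have h : ∀ v, ofCoeff (unit k) v = v := by
        intro v
        funext i
        rw [ofCoeff_apply]
        simp only [MonomialRep.add_apply, MonomialRep.smul_apply, gen_smul_apply]
        fin_cases i <;> simp [pre, unit]
      conv_rhs => rw [LinearMap.id_apply, ← h v]
      simp only [LinearMap.comp_apply, ofCoeff_apply, LinearMap.toSpanSingleton_apply, add_smul,
        smul_assoc, one_smul])
    (by ext; simp [ofCoeff_unit])

end MonomialRep

open MonomialRep

/-- The coefficients of an element of the algebra in the basis of paths. -/
def coeff (a : QuiverAlgebra k) : regular.Carrier k := equivRegular k a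

/-- The normal form of an element of the algebra, in terms of its action. -/
lemma smul_eq_coeff {M : Type*} [AddCommGroup M] [Module k M] [Module (QuiverAlgebra k) M]
    [IsScalarTower k (QuiverAlgebra k) M] (a : QuiverAlgebra k) (m : M) :
    a • m = coeff a 0 • gen k (.e 0) • m + coeff a 1 • gen k .x • m + coeff a 2 • gen k .α • m +
      coeff a 3 • gen k .y • gen k .α • m + coeff a 4 • gen k .β • gen k .α • m +
      coeff a 5 • gen k .β • gen k .y • gen k .α • m + coeff a 6 • gen k (.e 1) • m +
      coeff a 7 • gen k .y • m + coeff a 8 • gen k .β • m +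
      coeff a 9 • gen k .β • gen k .y • m := by
  rw [← ofCoeff_apply]
  conv_lhs => rw [← ofCoeff_unit (k := k) m, ← map_smul]
  rfl

instance : Module.Finite k (QuiverAlgebra k) := by
  have : Module.Finite k (regular.Carrier k) := inferInstanceAs (Module.Finite k (Fin 10 → k))
  exact Module.Finite.equiv ((equivRegular k).restrictScalars k).symm

instance : IsNoetherianRing (QuiverAlgebra k) := IsNoetherianRing.of_finite k _

/-- The normal form of the action on a vector at the first vertex. -/
lemma smul_eq_coeff₀ {M : Type*} [AddCommGroup M] [Module k M] [Module (QuiverAlgebra k) M]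
    [IsScalarTower k (QuiverAlgebra k) M] (a : QuiverAlgebra k) {m : M}
    (hm : gen k (.e 0) • m = m) :
    a • m = coeff a 0 • m + coeff a 1 • gen k .x • m + coeff a 2 • gen k .α • m +
      coeff a 3 • gen k .y • gen k .α • m + coeff a 4 • gen k .β • gen k .α • m +
      coeff a 5 • gen k .β • gen k .y • gen k .α • m := by
  have h (g : Gen) (hg : g.src ≠ 0) : gen k g • m = 0 := gen_smul_eq_zero hm hg
  rw [smul_eq_coeff, hm, h (.e 1) (by simp), h .y (by simp), h .β (by simp)]
  simp

/-- The normal form of the action on a vector at the second vertex. -/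
lemma smul_eq_coeff₁ {M : Type*} [AddCommGroup M] [Module k M] [Module (QuiverAlgebra k) M]
    [IsScalarTower k (QuiverAlgebra k) M] (a : QuiverAlgebra k) {m : M}
    (hm : gen k (.e 1) • m = m) :
    a • m = coeff a 6 • m + coeff a 7 • gen k .y • m + coeff a 8 • gen k .β • m +
      coeff a 9 • gen k .β • gen k .y • m := by
  have h (g : Gen) (hg : g.src ≠ 1) : gen k g • m = 0 := gen_smul_eq_zero hm hg
  rw [smul_eq_coeff, hm, h (.e 0) (by simp), h .x (by simp), h .α (by simp)]
  simp

/-! ### Filtrations -/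

section Filtrations

variable {A : Type u} [Ring A] {Λ : Type}

/-- Cyclic modules whose generators have the same annihilator are isomorphic. -/
lemma nonempty_span_equiv {M N : Type*} [AddCommGroup M] [Module A M] [AddCommGroup N]
    [Module A N] (m : M) {n : N} (hn : Submodule.span A {n} = ⊤)
    (h : ∀ a : A, a • m = 0 ↔ a • n = 0) : Nonempty (Submodule.span A {m} ≃ₗ[A] N) := by
  have hker : LinearMap.ker (LinearMap.toSpanSingleton A M m) =
      LinearMap.ker (LinearMap.toSpanSingleton A N n) := by
    ext a; simpa using h a
  have hsurj : Function.Surjective (LinearMap.toSpanSingleton A N n) := by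
    rw [← LinearMap.range_eq_top, LinearMap.range_toSpanSingleton, hn]
  exact ⟨(LinearEquiv.ofEq _ _ (LinearMap.range_toSpanSingleton (M := M) m).symm).trans
    ((LinearMap.quotKerEquivRange _).symm.trans ((Submodule.quotEquivOfEq _ _ hker).trans
      (LinearMap.quotKerEquivOfSurjective _ hsurj)))⟩

lemma isSimpleModule_of_span_eq_top {M : Type*} [AddCommGroup M] [Module A M] {m : M}
    (hm : Submodule.span A {m} = ⊤) (h : IsSimpleModule A (Submodule.span A {m})) :
    IsSimpleModule A M := by
  rw [hm] at h
  exact IsSimpleModule.congr Submodule.topEquiv.symm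

/-- A property of modules which is invariant under isomorphism and inherited from a submodule
whenever the quotient is in `S`, holds for all `S`-filtered modules. -/
lemma IsFiltered.induction {S : Λ → ModuleCat.{u} A} {C : ModuleCat.{u} A → Prop}
    (iso : ∀ M N : ModuleCat.{u} A, (M ≃ₗ[A] N) → C M → C N)
    (zero : ∀ M : ModuleCat.{u} A, Subsingleton M → C M)
    (ext : ∀ (M : ModuleCat.{u} A) (N : Submodule A M) (l : Λ), ((M ⧸ N) ≃ₗ[A] S l) →
      C (ModuleCat.of A N) → C M)
    {M : ModuleCat.{u} A} (h : IsFiltered S M) : C M := by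
  obtain ⟨n, F, hF, h0, hn, hq⟩ := h
  have key : ∀ i ≤ n, C (ModuleCat.of A (F i)) := by
    intro i
    induction i with
    | zero => exact fun _ => zero _ (by rw [h0]; infer_instance)
    | succ i ih =>
      intro hi
      obtain ⟨l, ⟨e⟩⟩ := hq i hi
      exact ext _ ((F i).submoduleOf (F (i + 1))) l e
        (iso _ _ (Submodule.submoduleOfEquivOfLe (hF (Nat.le_succ i))).symm (ih (by omega)))
  exact iso _ M ((LinearEquiv.ofEq _ _ hn).trans Submodule.topEquiv) (key n le_rfl)

/-- Peeling off submodules in `S` one after the other gives an `S`-filtration. -/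
lemma isFiltered_of_step {S : Λ → ModuleCat.{u} A} {C : ModuleCat.{u} A → Prop}
    (iso : ∀ M N : ModuleCat.{u} A, (M ≃ₗ[A] N) → C M → C N)
    (step : ∀ M : ModuleCat.{u} A, Nontrivial M → C M → ∃ (N : Submodule A M) (l : Λ),
      N ≠ ⊥ ∧ Nonempty (N ≃ₗ[A] S l) ∧ C (ModuleCat.of A (M ⧸ N)))
    {M : ModuleCat.{u} A} [IsNoetherian A M] (hM : C M) : IsFiltered S M := by
  let P : Set (Submodule A M) := {N | (∃ (n : ℕ) (F : ℕ → Submodule A M), Monotone F ∧ F 0 = ⊥ ∧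
    F n = N ∧ ∀ i < n, ∃ l, Nonempty ((F (i + 1) ⧸ (F i).submoduleOf (F (i + 1))) ≃ₗ[A] S l)) ∧
    C (ModuleCat.of A (M ⧸ N))}
  have hP : P.Nonempty := ⟨⊥, ⟨0, fun _ => ⊥, monotone_const, rfl, rfl, by simp⟩,
    iso _ _ (Submodule.quotEquivOfEqBot _ rfl).symm hM⟩
  obtain ⟨N, ⟨⟨n, F, hF, h0, hn, hq⟩, hC⟩, hmax⟩ :=
    (wellFounded_gt (α := Submodule A M)).has_min P hP
  rcases eq_or_ne N ⊤ with hN | hN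
  · exact ⟨n, F, hF, h0, hn.trans hN, hq⟩
  exfalso
  obtain ⟨N', l, hN', ⟨e⟩, hC'⟩ :=
    step (ModuleCat.of A (M ⧸ N)) (Submodule.Quotient.nontrivial_iff.2 hN) hC
  let N' : Submodule A (M ⧸ N) := N'
  let N₁ : Submodule A M := N'.comap N.mkQ
  have hle : N ≤ N₁ := fun m hm => by
    change N.mkQ m ∈ N'
    rw [(Submodule.Quotient.mk_eq_zero N (x := m)).2 hm |> (show N.mkQ m = 0 from ·)]
    exact N'.zero_mem
  have hlt : N < N₁ := by
    refine lt_of_le_of_ne hle fun h => hN' ?_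
    have : N₁.map N.mkQ = N' := Submodule.map_comap_eq_of_surjective N.mkQ_surjective _
    rw [← h, Submodule.mkQ_map_self] at this
    exact this.symm
  obtain ⟨G, hG, hG'⟩ : ∃ G : ℕ → Submodule A M, (∀ i ≤ n, G i = F i) ∧ ∀ i, n < i → G i = N₁ :=
    ⟨fun i => if i ≤ n then F i else N₁, fun i hi => if_pos hi, fun i hi => if_neg (by omega)⟩
  refine hmax N₁ ⟨⟨n + 1, G, ?_, ?_, hG' _ (Nat.lt_succ_self n), ?_⟩, ?_⟩ hlt
  · intro i j hij
    rcases le_or_gt j n with h | h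
    · rw [hG i (hij.trans h), hG j h]
      exact hF hij
    · rw [hG' j h]
      rcases le_or_gt i n with h' | h'
      · rw [hG i h']
        exact (hF h').trans (hn.le.trans hle)
      · rw [hG' i h']
  · rw [hG 0 (Nat.zero_le n), h0]
  · intro i hi
    rcases Nat.lt_succ_iff_lt_or_eq.1 hi with hi | rfl
    · rw [hG i hi.le, hG (i + 1) hi]
      exact hq i hi
    · refine ⟨l, ⟨?_⟩⟩
      rw [hG i le_rfl, hG' _ (Nat.lt_succ_self i), hn]
      let f : N₁ →ₗ[A] N' := (N.mkQ.comp N₁.subtype).codRestrict N' fun m => m.2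
      have hf : Function.Surjective f := by
        rintro ⟨m, hm⟩
        obtain ⟨m, rfl⟩ := N.mkQ_surjective m
        exact ⟨⟨m, hm⟩, rfl⟩
      have hk : LinearMap.ker f = N.submoduleOf N₁ := by
        refine (LinearMap.ker_codRestrict _ _ _).trans ?_
        rw [LinearMap.ker_comp, Submodule.ker_mkQ]
        rfl
      exact (Submodule.quotEquivOfEq _ _ hk.symm).trans
        ((LinearMap.quotKerEquivOfSurjective f hf).trans e)
  · have hk : LinearMap.ker (N'.mkQ.comp N.mkQ) = N₁ := by
      rw [LinearMap.ker_comp, Submodule.ker_mkQ]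
    exact iso _ _ ((LinearMap.quotKerEquivOfSurjective (N'.mkQ.comp N.mkQ)
      (N'.mkQ_surjective.comp N.mkQ_surjective)).symm.trans (Submodule.quotEquivOfEq _ _ hk)) hC'

end Filtrations

/-! ### Exactness conditions which detect filtrations -/

section Exactness

variable (k)

/-- The conditions on a representation which characterize the filtrations by standard modules:
`y` is exact at the second vertex, `β` is injective there, and `x` is exact on the cokernel
of `β`. -/
structure IsDeltaExact (M : Type*) [AddCommGroup M] [Module (QuiverAlgebra k) M] : Prop where
  y_exact : ∀ v : M, gen k (.e 1) • v = v → gen k .y • v = 0 → ∃ w : M, v = gen k .y • w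
  β_injective : ∀ v : M, gen k (.e 1) • v = v → gen k .β • v = 0 → v = 0
  x_exact : ∀ v u : M, gen k (.e 0) • v = v → gen k .x • v = gen k .β • u →
    ∃ w t : M, v = gen k .x • w + gen k .β • t

/-- Injectivity of `β` on the space at the second vertex, which characterizes the filtrations by
proper standard modules. -/
def IsBetaInjective (M : Type*) [AddCommGroup M] [Module (QuiverAlgebra k) M] : Prop :=
  ∀ v : M, gen k (.e 1) • v = v → gen k .β • v = 0 → v = 0

/-- Surjectivity of `α` onto the space at the second vertex, which characterizes the filtrations
by proper costandard modules. -/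
def IsAlphaSurjective (M : Type*) [AddCommGroup M] [Module (QuiverAlgebra k) M] : Prop :=
  ∀ v : M, gen k (.e 1) • v = v → ∃ u : M, v = gen k .α • u

variable {k}
variable {K X M : Type*} [AddCommGroup K] [Module (QuiverAlgebra k) K] [AddCommGroup X]
  [Module (QuiverAlgebra k) X] [AddCommGroup M] [Module (QuiverAlgebra k) M]

/-- A vector of a submodule which lives at a vertex does so already in the submodule. -/
lemma e_smul_of_injective {f : K →ₗ[QuiverAlgebra k] X} (hf : Function.Injective f) {i : Fin 2}
    {c : K} {v : X} (h : f c = v) (hv : gen k (.e i) • v = v) : gen k (.e i) • c = c :=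
  hf (by rw [map_smul, h, hv])

/-- A vector of a quotient which lives at a vertex lifts to one which lives there. -/
lemma exists_lift_e_smul {g : X →ₗ[QuiverAlgebra k] M} (hg : Function.Surjective g) {i : Fin 2}
    {m : M} (hm : gen k (.e i) • m = m) : ∃ v, gen k (.e i) • v = v ∧ g v = m := by
  obtain ⟨v, rfl⟩ := hg m
  exact ⟨gen k (.e i) • v, by simp, by rw [map_smul, hm]⟩

lemma IsAlphaSurjective.of_surjective {g : X →ₗ[QuiverAlgebra k] M} (hg : Function.Surjective g)
    (hX : IsAlphaSurjective k X) : IsAlphaSurjective k M := by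
  intro m hm
  obtain ⟨v, hv, rfl⟩ := exists_lift_e_smul hg hm
  obtain ⟨u, rfl⟩ := hX v hv
  exact ⟨g u, by rw [map_smul]⟩

lemma IsAlphaSurjective.pi {ι : Type*} {X : ι → Type*} [∀ i, AddCommGroup (X i)]
    [∀ i, Module (QuiverAlgebra k) (X i)] (hX : ∀ i, IsAlphaSurjective k (X i)) :
    IsAlphaSurjective k (∀ i, X i) := by
  intro v hv
  choose u hu using fun i => hX i (v i) (congrFun hv i)
  exact ⟨u, funext hu⟩

lemma IsDeltaExact.of_retract (i : M →ₗ[QuiverAlgebra k] X) (p : X →ₗ[QuiverAlgebra k] M)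
    (hpi : ∀ m, p (i m) = m) (hX : IsDeltaExact k X) : IsDeltaExact k M where
  y_exact v hv h := by
    obtain ⟨w, hw⟩ := hX.y_exact (i v) (by rw [← map_smul, hv]) (by rw [← map_smul, h, map_zero])
    exact ⟨p w, by rw [← map_smul, ← hw, hpi]⟩
  β_injective v hv h := by
    have := hX.β_injective (i v) (by rw [← map_smul, hv]) (by rw [← map_smul, h, map_zero])
    rw [← hpi v, this, map_zero]
  x_exact v u hv h := by
    obtain ⟨w, t, hw⟩ := hX.x_exact (i v) (i u) (by rw [← map_smul, hv])
      (by rw [← map_smul, h, map_smul])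
    exact ⟨p w, p t, by rw [← map_smul, ← map_smul, ← map_add, ← hw, hpi]⟩

lemma IsDeltaExact.congr (e : X ≃ₗ[QuiverAlgebra k] M) (hX : IsDeltaExact k X) :
    IsDeltaExact k M :=
  hX.of_retract e.symm.toLinearMap e.toLinearMap e.apply_symm_apply

lemma IsDeltaExact.pi {ι : Type*} {X : ι → Type*} [∀ i, AddCommGroup (X i)]
    [∀ i, Module (QuiverAlgebra k) (X i)] (hX : ∀ i, IsDeltaExact k (X i)) :
    IsDeltaExact k (∀ i, X i) where
  y_exact v hv h := by
    choose u hu using fun i => (hX i).y_exact (v i) (congrFun hv i) (congrFun h i)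
    exact ⟨u, funext hu⟩
  β_injective v hv h := funext fun i => (hX i).β_injective (v i) (congrFun hv i) (congrFun h i)
  x_exact v u hv h := by
    choose w t hw using fun i => (hX i).x_exact (v i) (u i) (congrFun hv i) (congrFun h i)
    exact ⟨w, t, funext hw⟩

/-- The image of `x` meets the image of `β` trivially. -/
lemma IsDeltaExact.x_smul_eq_zero (hX : IsDeltaExact k X) {w u : X}
    (h : gen k .x • w = gen k .β • u) : gen k .x • w = 0 := by
  obtain ⟨w', t, hw⟩ := hX.x_exact (gen k (.e 0) • w) u (by simp) (by simpa using h)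
  have : gen k .x • gen k (.e 0) • w = 0 := by rw [hw]; simp
  simpa using this

section ShortExact

variable {f : K →ₗ[QuiverAlgebra k] X} {g : X →ₗ[QuiverAlgebra k] M}
  (hf : Function.Injective f) (hfg : Function.Exact f g) (hg : Function.Surjective g)

include hf hfg

lemma IsAlphaSurjective.of_exact (hg : Function.Surjective g) (hK : IsAlphaSurjective k K)
    (hM : IsAlphaSurjective k M) : IsAlphaSurjective k X := by
  intro v hv
  obtain ⟨w, hw⟩ := hM (g v) (by rw [← map_smul, hv])
  obtain ⟨w, rfl⟩ := hg w
  obtain ⟨c, hc⟩ := (hfg (v - gen k .α • w)).1 (by rw [map_sub, map_smul, hw, sub_self])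
  obtain ⟨d, rfl⟩ := hK c (e_smul_of_injective hf hc (by simp [smul_sub, hv]))
  exact ⟨w + f d, by rw [smul_add, ← map_smul, hc]; abel⟩

lemma IsBetaInjective.of_exact (hK : IsBetaInjective k K) (hM : IsBetaInjective k M) :
    IsBetaInjective k X := by
  intro v hv h
  obtain ⟨c, rfl⟩ := (hfg v).1 (hM _ (by rw [← map_smul, hv]) (by rw [← map_smul, h, map_zero]))
  rw [hK c (e_smul_of_injective hf rfl hv) (hf (by rw [map_smul, h, map_zero])), map_zero]

include hg

lemma IsDeltaExact.of_exact (hK : IsDeltaExact k K) (hM : IsDeltaExact k M) :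
    IsDeltaExact k X where
  y_exact v hv h := by
    obtain ⟨w, hw⟩ := hM.y_exact (g v) (by rw [← map_smul, hv]) (by rw [← map_smul, h, map_zero])
    obtain ⟨w, rfl⟩ := hg w
    obtain ⟨c, hc⟩ := (hfg (v - gen k .y • w)).1 (by rw [map_sub, map_smul, hw, sub_self])
    obtain ⟨d, rfl⟩ := hK.y_exact c (e_smul_of_injective hf hc (by simp [smul_sub, hv]))
      (hf (by rw [map_smul, hc, map_zero, smul_sub, h]; simp))
    exact ⟨w + f d, by rw [smul_add, ← map_smul, hc]; abel⟩
  β_injective := IsBetaInjective.of_exact hf hfg hK.β_injective hM.β_injective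
  x_exact v u hv h := by
    obtain ⟨w, t, hw⟩ := hM.x_exact (g v) (g u) (by rw [← map_smul, hv])
      (by rw [← map_smul, h, map_smul])
    obtain ⟨w, rfl⟩ := hg w
    obtain ⟨t, rfl⟩ := hg t
    obtain ⟨c, hc⟩ := (hfg (v - (gen k .x • w + gen k .β • t))).1
      (by rw [map_sub, map_add, map_smul, map_smul, hw, sub_self])
    have hxc : f (gen k .x • c) = gen k .β • u := by
      rw [map_smul, hc, smul_sub, h]; simp
    -- `β u` vanishes in the quotient, hence `u` comes from the submodule
    obtain ⟨d, hd⟩ := (hfg (gen k (.e 1) • u)).1 (hM.β_injective _ (by simp) (by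
      have : g (f (gen k .x • c)) = 0 := (hfg _).2 ⟨_, rfl⟩
      rw [hxc, map_smul] at this
      simpa using this))
    obtain ⟨w', t', hc'⟩ := hK.x_exact c d (e_smul_of_injective hf hc (by simp [smul_sub, hv]))
      (hf (by rw [hxc, map_smul, hd]; simp))
    refine ⟨w + f w', t + f t', ?_⟩
    rw [smul_add, smul_add, ← map_smul, ← map_smul f, sub_eq_iff_eq_add.1 hc.symm, hc', map_add]
    abel

/-- Δ-exact modules are closed under cokernels of monomorphisms. This is why every module with a
finite resolution by modules with a standard filtration has itself such a filtration. -/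
lemma IsDeltaExact.of_cokernel (hK : IsDeltaExact k K) (hX : IsDeltaExact k X) :
    IsDeltaExact k M where
  y_exact m hm h := by
    obtain ⟨v, hv, rfl⟩ := exists_lift_e_smul hg hm
    obtain ⟨c, hc⟩ := (hfg (gen k .y • v)).1 (by rw [map_smul, h])
    obtain ⟨d, rfl⟩ := hK.y_exact c (e_smul_of_injective hf hc (by simp))
      (hf (by rw [map_smul, hc, map_zero]; simp))
    obtain ⟨w, hw⟩ := hX.y_exact (v - f (gen k (.e 1) • d)) (by simp [smul_sub, hv])
      (by rw [smul_sub, ← hc]; simp)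
    refine ⟨g w, ?_⟩
    rw [← map_smul, ← hw, map_sub, (hfg _).2 ⟨_, rfl⟩, sub_zero]
  β_injective m hm h := by
    obtain ⟨v, hv, rfl⟩ := exists_lift_e_smul hg hm
    obtain ⟨c, hc⟩ := (hfg (gen k .β • v)).1 (by rw [map_smul, h])
    obtain ⟨w, t, rfl⟩ := hK.x_exact c 0 (e_smul_of_injective hf hc (by simp))
      (hf (by rw [map_smul, hc]; simp))
    -- the `x`-part of `β v` vanishes because the images of `x` and `β` are independent
    have h0 := hX.x_smul_eq_zero (w := f w) (u := v - f t)
      (by rw [smul_sub, ← hc, map_add, map_smul, map_smul]; abel)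
    have h1 := hX.β_injective (v - f (gen k (.e 1) • t)) (by simp [smul_sub, hv]) (by
      rw [smul_sub, ← hc, map_add, map_smul f (gen k .x), h0]; simp)
    rw [sub_eq_zero.1 h1]
    exact (hfg _).2 ⟨_, rfl⟩
  x_exact m u hm h := by
    obtain ⟨v, hv, rfl⟩ := exists_lift_e_smul hg hm
    obtain ⟨u, rfl⟩ := hg u
    obtain ⟨c, hc⟩ := (hfg (gen k .x • v - gen k .β • u)).1
      (by rw [map_sub, map_smul, map_smul, h, sub_self])
    obtain ⟨w, t, rfl⟩ := hK.x_exact c 0 (e_smul_of_injective hf hc (by simp [smul_sub]))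
      (hf (by rw [map_smul, hc]; simp [smul_sub]))
    obtain ⟨w', t', hw⟩ := hX.x_exact (v - f (gen k (.e 0) • w)) (u + f t)
      (by simp [smul_sub, hv]) (by
        have hx : gen k .x • v = f (gen k .x • w + gen k .β • t) + gen k .β • u :=
          sub_eq_iff_eq_add.1 hc.symm
        rw [smul_sub, hx]; simp; abel)
    refine ⟨g w', g t', ?_⟩
    rw [← map_smul, ← map_smul, ← map_add, ← hw, map_sub, (hfg _).2 ⟨_, rfl⟩, sub_zero]

end ShortExact

end Exactness

/-! ### Annihilators of generators -/

section Annihilators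

variable {M : Type*} [AddCommGroup M] [Module (QuiverAlgebra k) M]

lemma smul_eq_zero_iff_standard₀ {m : M} (hm : gen k (.e 0) • m = m) (hα : gen k .α • m = 0)
    (hx : gen k .x • m ≠ 0) (a : QuiverAlgebra k) : a • m = 0 ↔ coeff a 0 = 0 ∧ coeff a 1 = 0 := by
  let _ : Module k M := Module.restrictScalars k (QuiverAlgebra k) M
  have : IsScalarTower k (QuiverAlgebra k) M := IsScalarTower.restrictScalars k _ M
  rw [smul_eq_coeff₀ a hm]
  simp only [hα, smul_zero, add_zero]
  refine ⟨fun h => ?_, fun h => by simp [h.1, h.2]⟩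
  have h0 : coeff a 0 = 0 := by simpa [hx] using congrArg (gen k .x • ·) h
  simpa [h0, hx] using h

lemma smul_eq_zero_iff_standard₁ {m : M} (hm : gen k (.e 1) • m = m)
    (hβ : IsBetaInjective k M) (hy : gen k .y • m ≠ 0) (a : QuiverAlgebra k) :
    a • m = 0 ↔ (coeff a 6 = 0 ∧ coeff a 7 = 0) ∧ coeff a 8 = 0 ∧ coeff a 9 = 0 := by
  let _ : Module k M := Module.restrictScalars k (QuiverAlgebra k) M
  have : IsScalarTower k (QuiverAlgebra k) M := IsScalarTower.restrictScalars k _ M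
  have key (c d : k) (h : c • m + d • gen k .y • m = 0) : c = 0 ∧ d = 0 := by
    have h0 : c = 0 := by simpa [hy] using congrArg (gen k .y • ·) h
    exact ⟨h0, by simpa [h0, hy] using h⟩
  rw [smul_eq_coeff₁ a hm]
  refine ⟨fun h => ⟨key _ _ ?_, key _ _ (hβ _ (by simp [hm]) ?_)⟩,
    fun h => by simp [h.1.1, h.1.2, h.2.1, h.2.2]⟩
  · simpa [hm] using congrArg (gen k (.e 1) • ·) h
  · have h0 : gen k (.e 0) • m = 0 := gen_smul_eq_zero hm (by simp)
    simpa [h0] using congrArg (gen k (.e 0) • ·) h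

lemma smul_eq_zero_iff_properStandard₁ {m : M} (hm : gen k (.e 1) • m = m)
    (hy : gen k .y • m = 0) (hβ : gen k .β • m ≠ 0) (a : QuiverAlgebra k) :
    a • m = 0 ↔ coeff a 6 = 0 ∧ coeff a 8 = 0 := by
  let _ : Module k M := Module.restrictScalars k (QuiverAlgebra k) M
  have : IsScalarTower k (QuiverAlgebra k) M := IsScalarTower.restrictScalars k _ M
  rw [smul_eq_coeff₁ a hm]
  simp only [hy, smul_zero, add_zero]
  refine ⟨fun h => ?_, fun h => by simp [h.1, h.2]⟩
  have h0 : coeff a 6 = 0 := by simpa [hβ] using congrArg (gen k .β • ·) h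
  simpa [h0, hβ] using h

lemma smul_eq_zero_iff_properCostandard₁ {m : M} (hm : gen k (.e 0) • m = m)
    (hx : gen k .x • m = 0) (hα : gen k .α • m ≠ 0) (hy : gen k .y • gen k .α • m = 0)
    (hβ : gen k .β • gen k .α • m = 0) (a : QuiverAlgebra k) :
    a • m = 0 ↔ coeff a 0 = 0 ∧ coeff a 2 = 0 := by
  let _ : Module k M := Module.restrictScalars k (QuiverAlgebra k) M
  have : IsScalarTower k (QuiverAlgebra k) M := IsScalarTower.restrictScalars k _ M
  rw [smul_eq_coeff₀ a hm]
  simp only [hy, hx, hβ, smul_zero, add_zero]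
  refine ⟨fun h => ?_, fun h => by simp [h.1, h.2]⟩
  have h0 : coeff a 0 = 0 := by simpa [hα] using congrArg (gen k .α • ·) h
  simpa [h0, hα] using h

variable (k) in
/-- A nonzero vector at a vertex which is annihilated by all arrows. -/
structure IsSocleVector (i : Fin 2) (m : M) : Prop where
  ne_zero : m ≠ 0
  e_smul : gen k (.e i) • m = m
  α_smul : gen k .α • m = 0
  β_smul : gen k .β • m = 0
  x_smul : gen k .x • m = 0
  y_smul : gen k .y • m = 0

/-- The coefficient of the trivial path at a vertex. -/
def idemCoeff (i : Fin 2) (a : QuiverAlgebra k) : k := coeff a (![0, 6] i)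

lemma IsSocleVector.smul_eq {i : Fin 2} {m : M} (h : IsSocleVector k i m) (a : QuiverAlgebra k) :
    a • m = algebraMap k (QuiverAlgebra k) (idemCoeff i a) • m := by
  let _ : Module k M := Module.restrictScalars k (QuiverAlgebra k) M
  have : IsScalarTower k (QuiverAlgebra k) M := IsScalarTower.restrictScalars k _ M
  rw [algebraMap_smul]
  fin_cases i
  · rw [smul_eq_coeff₀ a h.e_smul]; simp [h.α_smul, h.x_smul, idemCoeff]
  · rw [smul_eq_coeff₁ a h.e_smul]; simp [h.β_smul, h.y_smul, idemCoeff]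

lemma IsSocleVector.smul_eq_zero_iff {i : Fin 2} {m : M} (h : IsSocleVector k i m)
    (a : QuiverAlgebra k) : a • m = 0 ↔ idemCoeff i a = 0 := by
  let _ : Module k M := Module.restrictScalars k (QuiverAlgebra k) M
  have : IsScalarTower k (QuiverAlgebra k) M := IsScalarTower.restrictScalars k _ M
  rw [h.smul_eq, algebraMap_smul, smul_eq_zero]
  simp [h.ne_zero]

lemma IsSocleVector.gen_smul {i : Fin 2} {m : M} (h : IsSocleVector k i m) {g : Gen}
    (hg : ∀ j, g ≠ .e j) : gen k g • m = 0 := by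
  cases g with
  | e j => exact absurd rfl (hg j)
  | α => exact h.α_smul
  | β => exact h.β_smul
  | x => exact h.x_smul
  | y => exact h.y_smul

/-- A socle vector spans a simple submodule. -/
lemma IsSocleVector.isSimpleModule {i : Fin 2} {m : M} (h : IsSocleVector k i m) :
    IsSimpleModule (QuiverAlgebra k) (Submodule.span (QuiverAlgebra k) {m}) := by
  have hm : (⟨m, Submodule.mem_span_singleton_self m⟩ :
    Submodule.span (QuiverAlgebra k) {m}) ≠ 0 := fun h0 => h.ne_zero (congrArg Subtype.val h0)
  rw [isSimpleModule_iff_toSpanSingleton_surjective]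
  refine ⟨⟨_, _, hm⟩, ?_⟩
  rintro ⟨n, hn⟩ hn0 ⟨n', hn'⟩
  obtain ⟨a, rfl⟩ := Submodule.mem_span_singleton.1 hn
  obtain ⟨b, rfl⟩ := Submodule.mem_span_singleton.1 hn'
  have ha : idemCoeff i a ≠ 0 := fun h' => hn0 (Subtype.ext ((h.smul_eq_zero_iff a).2 h'))
  refine ⟨algebraMap k _ (idemCoeff i b * (idemCoeff i a)⁻¹), Subtype.ext ?_⟩
  simp only [LinearMap.toSpanSingleton_apply, Submodule.coe_smul]
  rw [h.smul_eq a, h.smul_eq b, smul_smul, ← map_mul, inv_mul_cancel_right₀ ha]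

/-- Every nonzero module contains a socle vector. -/
lemma exists_isSocleVector (k : Type u) [Field k] (M : Type*) [AddCommGroup M]
    [Module (QuiverAlgebra k) M] [Nontrivial M] : ∃ (i : Fin 2) (m : M), IsSocleVector k i m := by
  have h₁ (v : M) (hv : gen k (.e 1) • v = v) (h0 : v ≠ 0) : ∃ i m, IsSocleVector k i (m : M) := by
    obtain ⟨v, hv, h0, hy⟩ : ∃ v : M, gen k (.e 1) • v = v ∧ v ≠ 0 ∧ gen k .y • v = 0 := by
      by_cases hy : gen k .y • v = 0
      · exact ⟨v, hv, h0, hy⟩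
      · exact ⟨gen k .y • v, by simp, hy, by simp⟩
    by_cases hβ : gen k .β • v = 0
    · exact ⟨1, v, h0, hv, gen_smul_eq_zero hv (by simp), hβ, gen_smul_eq_zero hv (by simp), hy⟩
    · exact ⟨0, _, hβ, by simp, by simp, by simp, by simp, by simp⟩
  obtain ⟨m, hm⟩ := exists_ne (0 : M)
  by_cases h1 : gen k (.e 1) • m = 0
  · have h0 : gen k (.e 0) • m = m := by simpa [h1] using e_smul_add k m
    by_cases hα : gen k .α • m = 0
    · by_cases hx : gen k .x • m = 0
      · exact ⟨0, m, hm, h0, hα, gen_smul_eq_zero h0 (by simp), hx,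
          gen_smul_eq_zero h0 (by simp)⟩
      · exact ⟨0, _, hx, by simp, by simp, by simp, by simp, by simp⟩
    · exact h₁ _ (by simp) hα
  · exact h₁ _ (by simp) h1

lemma exists_isSocleVector_of_isSimpleModule [IsSimpleModule (QuiverAlgebra k) M] :
    ∃ (i : Fin 2) (m : M), IsSocleVector k i m ∧ Submodule.span (QuiverAlgebra k) {m} = ⊤ := by
  have := IsSimpleModule.nontrivial (QuiverAlgebra k) M
  obtain ⟨i, m, h⟩ := exists_isSocleVector k M
  exact ⟨i, m, h, IsSimpleModule.span_singleton_eq_top _ h.ne_zero⟩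

/-- The arrows annihilate the simple modules. -/
lemma gen_smul_eq_zero_of_isSimpleModule [IsSimpleModule (QuiverAlgebra k) M] {g : Gen}
    (hg : ∀ j, g ≠ .e j) (n : M) : gen k g • n = 0 := by
  obtain ⟨i, m, h, hs⟩ := exists_isSocleVector_of_isSimpleModule (k := k) (M := M)
  obtain ⟨a, rfl⟩ := Submodule.mem_span_singleton.1 (hs.ge (Submodule.mem_top (x := n)))
  rw [h.smul_eq, smul_smul, ← Algebra.commutes, mul_smul, h.gen_smul hg, smul_zero]

/-- The arrows map every module into its radical. -/
lemma gen_smul_mem_jacobson {g : Gen} (hg : ∀ j, g ≠ .e j) (m : M) :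
    gen k g • m ∈ Module.jacobson (QuiverAlgebra k) M := by
  rw [Module.jacobson, Submodule.mem_sInf]
  intro N hN
  have : IsSimpleModule (QuiverAlgebra k) (M ⧸ N) := isSimpleModule_iff_isCoatom.2 hN
  rw [← Submodule.Quotient.mk_eq_zero, Submodule.Quotient.mk_smul]
  exact gen_smul_eq_zero_of_isSimpleModule hg _

end Annihilators

/-! ### The monomial representations -/

section Reps

lemma eq_zero_of_simple (i : Fin 2) (m : (simple i).Carrier k) (h : m 0 = 0) : m = 0 := by
  funext j
  fin_cases j
  exact h

lemma isSocleVector_simple (i : Fin 2) :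
    IsSocleVector k i ((simple i).ofFun fun _ => (1 : k)) where
  ne_zero h := one_ne_zero (congrFun h 0)
  e_smul := by funext j; rw [gen_smul_apply]; simp [pre]
  α_smul := by funext j; rw [gen_smul_apply]; rfl
  β_smul := by funext j; rw [gen_smul_apply]; rfl
  x_smul := by funext j; rw [gen_smul_apply]; rfl
  y_smul := by funext j; rw [gen_smul_apply]; rfl

lemma span_simple (i : Fin 2) :
    Submodule.span (QuiverAlgebra k) {((simple i).ofFun fun _ => (1 : k))} = ⊤ := by
  refine eq_top_iff.2 fun m _ => Submodule.mem_span_singleton.2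
    ⟨algebraMap k _ (m 0), ?_⟩
  funext j
  rw [algebraMap_smul, MonomialRep.smul_apply]
  fin_cases j
  exact mul_one _

instance (i : Fin 2) : IsSimpleModule (QuiverAlgebra k) ((simple i).Carrier k) :=
  isSimpleModule_of_span_eq_top (span_simple i) (isSocleVector_simple i).isSimpleModule

lemma isDeltaExact_regular : IsDeltaExact k (regular.Carrier k) where
  y_exact v hv h := by
    have h := coord_eq_zero h
    have hv := coord_eq hv
    refine ⟨regular.ofFun ![0, 0, v 3, 0, 0, 0, v 7, 0, 0, 0], funext fun i => ?_⟩
    have := hv i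
    have := h 3
    have := h 7
    rw [gen_smul_apply]
    fin_cases i <;> simp_all [pre]
  β_injective v hv h := by
    have h := coord_eq_zero h
    have hv := coord_eq hv
    funext i
    have := hv i
    have := h 4
    have := h 5
    have := h 8
    have := h 9
    fin_cases i <;> simp_all [pre]
  x_exact v u hv h := by
    have h := coord_eq h
    simp only [gen_smul_apply] at h
    have hv := coord_eq hv
    refine ⟨regular.ofFun ![v 1, 0, 0, 0, 0, 0, 0, 0, 0, 0],
      regular.ofFun ![0, 0, v 4, v 5, 0, 0, v 8, v 9, 0, 0],
      funext fun i => ?_⟩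
    have := hv i
    have := h 1
    rw [MonomialRep.add_apply, gen_smul_apply, gen_smul_apply]
    fin_cases i <;> simp_all [pre]

lemma isDeltaExact_tilt₁ : IsDeltaExact k (tilt₁.Carrier k) where
  y_exact v hv h := by
    have hv := coord_eq hv
    refine ⟨0, funext fun i => ?_⟩
    have := hv i
    rw [gen_smul_apply]
    fin_cases i <;> simp_all [pre]
  β_injective v hv h := by
    have hv := coord_eq hv
    funext i
    have := hv i
    fin_cases i <;> simp_all [pre]
  x_exact v u hv h := by
    have h := coord_eq h
    simp only [gen_smul_apply] at h
    refine ⟨tilt₁.ofFun ![v 1, 0], 0, funext fun i => ?_⟩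
    have := h 1
    rw [MonomialRep.add_apply, gen_smul_apply, gen_smul_apply]
    fin_cases i <;> simp_all [pre]

lemma isDeltaExact_tilt₂ : IsDeltaExact k (tilt₂.Carrier k) where
  y_exact v hv h := by
    have h := coord_eq_zero h
    have hv := coord_eq hv
    refine ⟨tilt₂.ofFun ![0, 0, 0, 0, v 5, 0, 0, 0], funext fun i => ?_⟩
    have := hv i
    have := h 5
    rw [gen_smul_apply]
    fin_cases i <;> simp_all [pre]
  β_injective v hv h := by
    have h := coord_eq_zero h
    have hv := coord_eq hv
    funext i
    have := hv i
    have := h 6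
    have := h 7
    fin_cases i <;> simp_all [pre]
  x_exact v u hv h := by
    have h := coord_eq h
    simp only [gen_smul_apply] at h
    have hv := coord_eq hv
    refine ⟨tilt₂.ofFun ![v 1, 0, v 3, 0, 0, 0, 0, 0],
      tilt₂.ofFun ![0, 0, 0, 0, v 6, v 7, 0, 0], funext fun i => ?_⟩
    have := hv i
    have := h 1
    have := h 3
    rw [MonomialRep.add_apply, gen_smul_apply, gen_smul_apply]
    fin_cases i <;> simp_all [pre]

lemma isAlphaSurjective_tilt₁ : IsAlphaSurjective k (tilt₁.Carrier k) := by
  intro v hv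
  have hv := coord_eq hv
  refine ⟨0, funext fun i => ?_⟩
  have := hv i
  rw [gen_smul_apply]
  fin_cases i <;> simp_all [pre]

lemma isAlphaSurjective_tilt₂ : IsAlphaSurjective k (tilt₂.Carrier k) := by
  intro v hv
  have hv := coord_eq hv
  refine ⟨tilt₂.ofFun ![v 5, 0, v 4, 0, 0, 0, 0, 0], funext fun i => ?_⟩
  have := hv i
  rw [gen_smul_apply]
  fin_cases i <;> simp_all [pre]

lemma isDeltaExact_self : IsDeltaExact k (QuiverAlgebra k) :=
  isDeltaExact_regular.of_retract (equivRegular k).toLinearMap (equivRegular k).symm.toLinearMap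
    (equivRegular k).symm_apply_apply

end Reps

/-! ### Indecomposable projective modules and traces -/

section Projectives

/-- The generator `e_i` of `A e_i`. -/
def projGen (k : Type u) [Field k] (i : Fin 2) : proj k i :=
  (⟨gen k (.e i), Submodule.mem_span_singleton_self _⟩ : Ideal.span {gen k (.e i)})

/-- The inclusion of `A e_i` into the algebra. -/
def projIncl (k : Type u) [Field k] (i : Fin 2) : proj k i →ₗ[QuiverAlgebra k] QuiverAlgebra k :=
  Submodule.subtype (Ideal.span {gen k (.e i)})

lemma projIncl_injective (i : Fin 2) : Function.Injective (projIncl k i) :=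
  Subtype.val_injective

lemma projIncl_projGen (i : Fin 2) : projIncl k i (projGen k i) = gen k (.e i) := rfl

@[simp] lemma e_smul_projGen (i : Fin 2) : gen k (.e i) • projGen k i = projGen k i :=
  projIncl_injective i (by rw [map_smul, projIncl_projGen, smul_eq_mul, e_mul_e, if_pos rfl])

lemma projIncl_smul_projGen {i : Fin 2} (p : proj k i) : projIncl k i p • projGen k i = p := by
  apply projIncl_injective i
  obtain ⟨a, ha⟩ := Submodule.mem_span_singleton.1 (show projIncl k i p ∈ _ from p.2)
  rw [map_smul, projIncl_projGen, ← ha, smul_eq_mul, smul_eq_mul, mul_assoc, e_mul_e, if_pos rfl]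

lemma y_smul_projGen : gen k .y • projGen k 1 ≠ 0 := by
  intro h
  have h := congrArg (projIncl k 1) h
  rw [map_smul, projIncl_projGen, map_zero, smul_eq_mul, gen_mul_e] at h
  replace h : gen k .y = 0 := by simpa using h
  have h' : gen k .y • unit k = 0 := by rw [h, zero_smul]
  simpa [pre, unit] using coord_eq_zero h' 7

lemma span_projGen (i : Fin 2) : Submodule.span (QuiverAlgebra k) {projGen k i} = ⊤ :=
  eq_top_iff.2 fun p _ => Submodule.mem_span_singleton.2 ⟨_, projIncl_smul_projGen p⟩

lemma projIncl_retract {i : Fin 2} (p : proj k i) :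
    LinearMap.toSpanSingleton (QuiverAlgebra k) _ (projGen k i) (projIncl k i p) = p :=
  projIncl_smul_projGen p

instance projective_proj (i : Fin 2) : Module.Projective (QuiverAlgebra k) (proj k i) :=
  Module.Projective.of_split (projIncl k i)
    (LinearMap.toSpanSingleton (QuiverAlgebra k) _ (projGen k i)) (LinearMap.ext projIncl_retract)

instance finite_proj (i : Fin 2) : Module.Finite (QuiverAlgebra k) (proj k i) :=
  Module.Finite.of_surjective (LinearMap.toSpanSingleton (QuiverAlgebra k) _ (projGen k i))
    fun p => ⟨_, projIncl_retract p⟩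

lemma isDeltaExact_proj (i : Fin 2) : IsDeltaExact k (proj k i) :=
  isDeltaExact_self.of_retract _ _ projIncl_retract

variable {M N : Type u} [AddCommGroup M] [Module (QuiverAlgebra k) M] [AddCommGroup N]
  [Module (QuiverAlgebra k) N]

/-- The homomorphism from `A e_i` which maps the generator to `e_i m`. -/
def projLift (i : Fin 2) (m : M) : proj k i →ₗ[QuiverAlgebra k] M :=
  (LinearMap.toSpanSingleton (QuiverAlgebra k) M m).comp (projIncl k i)

lemma projLift_smul_projGen {i : Fin 2} {m : M} (hm : gen k (.e i) • m = m)
    (a : QuiverAlgebra k) : projLift i m (a • projGen k i) = a • m := by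
  rw [map_smul]
  simp [projLift, projIncl_projGen, hm]

lemma projLift_projGen {i : Fin 2} {m : M} (hm : gen k (.e i) • m = m) :
    projLift i m (projGen k i) = m := by
  simpa using projLift_smul_projGen hm 1

lemma mem_trace_proj {i : Fin 2} {m : M} (hm : gen k (.e i) • m = m) :
    m ∈ trace (QuiverAlgebra k) (proj k i) M :=
  Submodule.mem_iSup_of_mem (projLift i m) ⟨_, projLift_projGen hm⟩

/-- The trace of `A e_i` is annihilated by every homomorphism which annihilates the vectors at the
vertex `i`. -/
lemma trace_proj_le_ker {i : Fin 2} (φ : M →ₗ[QuiverAlgebra k] N)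
    (hφ : ∀ m, gen k (.e i) • m = m → φ m = 0) :
    trace (QuiverAlgebra k) (proj k i) M ≤ LinearMap.ker φ := by
  refine iSup_le fun f => ?_
  rintro _ ⟨p, rfl⟩
  rw [LinearMap.mem_ker, ← projIncl_smul_projGen p, map_smul, map_smul,
    hφ (f (projGen k i)) (by rw [← map_smul, e_smul_projGen]), smul_zero]

lemma mem_trace_directSum {l j : Fin 2} (hlj : l < j) {m : M} (hm : gen k (.e j) • m = m) :
    m ∈ trace (QuiverAlgebra k) (⨁ j : {j : Fin 2 // l < j}, proj k j.1) M := by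
  classical
  refine Submodule.mem_iSup_of_mem ((projLift j m).comp
    (DirectSum.component (QuiverAlgebra k) {j : Fin 2 // l < j} (fun j => proj k j.1) ⟨j, hlj⟩))
    ⟨DirectSum.lof (QuiverAlgebra k) _ (fun j : {j : Fin 2 // l < j} => proj k j.1) ⟨j, hlj⟩
      (projGen k j), ?_⟩
  rw [LinearMap.comp_apply, DirectSum.component.lof_self, projLift_projGen hm]

lemma trace_directSum_le_ker {l : Fin 2} (φ : M →ₗ[QuiverAlgebra k] N)
    (hφ : ∀ j, l < j → ∀ m, gen k (.e j) • m = m → φ m = 0) :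
    trace (QuiverAlgebra k) (⨁ j : {j : Fin 2 // l < j}, proj k j.1) M ≤ LinearMap.ker φ := by
  classical
  refine iSup_le fun f => ?_
  have h : φ.comp f = 0 := by
    refine DirectSum.linearMap_ext _ fun j => LinearMap.ext fun p => ?_
    exact (trace_proj_le_ker φ (hφ j.1 j.2)) (Submodule.mem_iSup_of_mem
      (f.comp (DirectSum.lof (QuiverAlgebra k) _ (fun j : {j : Fin 2 // l < j} => proj k j.1) j))
      ⟨p, rfl⟩)
  rintro _ ⟨p, rfl⟩
  exact LinearMap.congr_fun h p

end Projectives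

/-! ### Standard and proper standard modules -/

section Standard

/-- The generator of `Δ(l)`. -/
def standardGen (k : Type u) [Field k] (l : Fin 2) : standard (proj k) l :=
  Submodule.Quotient.mk (projGen k l)

lemma e_smul_standardGen (l : Fin 2) : gen k (.e l) • standardGen k l = standardGen k l := by
  conv_rhs => rw [standardGen, ← e_smul_projGen]
  rfl

lemma span_map_eq_top {M N : Type*} [AddCommGroup M] [Module (QuiverAlgebra k) M] [AddCommGroup N]
    [Module (QuiverAlgebra k) N] {f : M →ₗ[QuiverAlgebra k] N} (hf : Function.Surjective f) {m : M}
    (hm : Submodule.span (QuiverAlgebra k) {m} = ⊤) :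
    Submodule.span (QuiverAlgebra k) {f m} = ⊤ := by
  rw [← Set.image_singleton, Submodule.span_image, hm, Submodule.map_top,
    LinearMap.range_eq_top.2 hf]

lemma span_standardGen (l : Fin 2) : Submodule.span (QuiverAlgebra k) {standardGen k l} = ⊤ :=
  span_map_eq_top (Submodule.mkQ_surjective _) (span_projGen l)

/-- Homomorphisms out of `Δ(l)`: the generator may be mapped to every vector at the vertex `l` of a
module which vanishes at the greater vertices. -/
lemma exists_standard_lift {N : Type u} [AddCommGroup N] [Module (QuiverAlgebra k) N] {l : Fin 2}
    {n : N} (hn : gen k (.e l) • n = n) (h : ∀ j, l < j → ∀ n : N, gen k (.e j) • n = n → n = 0) :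
    ∃ φ : standard (proj k) l →ₗ[QuiverAlgebra k] N, φ (standardGen k l) = n :=
  ⟨Submodule.liftQ _ (projLift l n) (trace_directSum_le_ker _ fun j hj m hm =>
    h j hj _ (by rw [← map_smul, hm])), projLift_projGen hn⟩

lemma α_smul_standardGen : gen k .α • standardGen k 0 = 0 :=
  (Submodule.Quotient.mk_eq_zero _).2 (mem_trace_directSum (show (0 : Fin 2) < 1 by decide)
    (m := gen k .α • projGen k 0) (by simp))

lemma eq_zero_of_tilt₁ (n : tilt₁.Carrier k) (hn : gen k (.e 1) • n = n) : n = 0 := by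
  have hn := coord_eq hn
  funext i
  have := hn i
  fin_cases i <;> simp_all [pre]

/-- The generator of `tilt₁`. -/
def tilt₁Gen (k : Type u) [Field k] : tilt₁.Carrier k := tilt₁.ofFun ![1, 0]

lemma e_smul_tilt₁Gen : gen k (.e 0) • tilt₁Gen k = tilt₁Gen k := by
  funext i
  rw [gen_smul_apply]
  fin_cases i <;> simp [pre, tilt₁Gen]

lemma α_smul_tilt₁Gen : gen k .α • tilt₁Gen k = 0 := by
  funext i
  rw [gen_smul_apply]
  fin_cases i <;> rfl

lemma x_smul_tilt₁Gen : gen k .x • tilt₁Gen k ≠ 0 := by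
  intro h
  have := coord_eq_zero h 1
  simp [pre, tilt₁Gen] at this

lemma span_tilt₁Gen : Submodule.span (QuiverAlgebra k) {tilt₁Gen k} = ⊤ := by
  refine eq_top_iff.2 fun m _ => Submodule.mem_span_singleton.2
    ⟨algebraMap k _ (m 0) + algebraMap k _ (m 1) * gen k .x, ?_⟩
  rw [add_smul, mul_smul, algebraMap_smul, algebraMap_smul]
  funext i
  rw [MonomialRep.add_apply, MonomialRep.smul_apply, MonomialRep.smul_apply, gen_smul_apply]
  fin_cases i <;> simp [pre, tilt₁Gen]

lemma forall_lt_fin_two {C : Fin 2 → Prop} (h : C 1) (j : Fin 2) (hj : 0 < j) : C j := by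
  obtain rfl : j = 1 := by omega
  exact h

lemma not_one_lt {j : Fin 2} (hj : 1 < j) : False := by omega

lemma x_smul_standardGen : gen k .x • standardGen k 0 ≠ 0 := by
  obtain ⟨φ, hφ⟩ := exists_standard_lift e_smul_tilt₁Gen
    (forall_lt_fin_two (eq_zero_of_tilt₁ (k := k)))
  intro h
  apply x_smul_tilt₁Gen (k := k)
  rw [← hφ, ← map_smul, h, map_zero]

lemma nonempty_standard₀ : Nonempty (tilt₁.Carrier k ≃ₗ[QuiverAlgebra k] standard (proj k) 0) := by
  obtain ⟨e⟩ := nonempty_span_equiv (A := QuiverAlgebra k) (tilt₁Gen k) (span_standardGen 0)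
    fun a => (smul_eq_zero_iff_standard₀ e_smul_tilt₁Gen α_smul_tilt₁Gen x_smul_tilt₁Gen a).trans
      (smul_eq_zero_iff_standard₀ (e_smul_standardGen 0) α_smul_standardGen
        x_smul_standardGen a).symm
  exact ⟨(Submodule.topEquiv.symm.trans (LinearEquiv.ofEq _ _ span_tilt₁Gen.symm)).trans e⟩

lemma nonempty_standard₁ : Nonempty (proj k 1 ≃ₗ[QuiverAlgebra k] standard (proj k) 1) :=
  ⟨(Submodule.quotEquivOfEqBot _ (le_bot_iff.1 (by
    rw [← LinearMap.ker_id]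
    exact trace_directSum_le_ker _ fun j hj => (not_one_lt hj).elim))).symm⟩

lemma isDeltaExact_standard (l : Fin 2) : IsDeltaExact k (standard (proj k) l) := by
  fin_cases l
  · obtain ⟨e⟩ := nonempty_standard₀ (k := k)
    exact isDeltaExact_tilt₁.congr e
  · obtain ⟨e⟩ := nonempty_standard₁ (k := k)
    exact (isDeltaExact_proj 1).congr e

instance finite_standard (l : Fin 2) : Module.Finite (QuiverAlgebra k) (standard (proj k) l) :=
  ⟨⟨{standardGen k l}, by simpa using span_standardGen l⟩⟩

/-- The radical of a module is annihilated by the homomorphisms into simple modules. -/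
lemma map_eq_zero_of_mem_jacobson {M N : Type*} [AddCommGroup M] [Module (QuiverAlgebra k) M]
    [AddCommGroup N] [Module (QuiverAlgebra k) N] [IsSimpleModule (QuiverAlgebra k) N]
    (φ : M →ₗ[QuiverAlgebra k] N) {m : M} (hm : m ∈ Module.jacobson (QuiverAlgebra k) M) :
    φ m = 0 := by
  have := Module.le_comap_jacobson φ hm
  rwa [IsSemisimpleModule.jacobson_eq_bot, Submodule.mem_comap, Submodule.mem_bot] at this

/-- The generator of `Δ̄(l)`. -/
def properStandardGen (k : Type u) [Field k] (l : Fin 2) : properStandard (proj k) l :=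
  Submodule.Quotient.mk (standardGen k l)

lemma e_smul_properStandardGen (l : Fin 2) :
    gen k (.e l) • properStandardGen k l = properStandardGen k l := by
  conv_rhs => rw [properStandardGen, ← e_smul_standardGen]
  rfl

lemma span_properStandardGen (l : Fin 2) :
    Submodule.span (QuiverAlgebra k) {properStandardGen k l} = ⊤ :=
  span_map_eq_top (Submodule.mkQ_surjective _) (span_standardGen l)

/-- The arrows which end at the vertex `l` annihilate the generator of `Δ̄(l)`. -/
lemma gen_smul_properStandardGen {l : Fin 2} {g : Gen} (hg : ∀ j, g ≠ .e j) (hl : l = g.tgt) :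
    gen k g • properStandardGen k l = 0 := by
  refine (Submodule.Quotient.mk_eq_zero _).2 (Submodule.mem_map.2
    ⟨⟨gen k g • standardGen k l, gen_smul_mem_jacobson hg _⟩, mem_trace_proj ?_, rfl⟩)
  refine Subtype.ext ?_
  change gen k (.e l) • gen k g • standardGen k l = gen k g • standardGen k l
  rw [e_smul_gen_smul, if_pos hl]

/-- A homomorphism factors over `Δ̄(l)` if it annihilates the radical vectors at the vertex `l`. -/
lemma exists_properStandard_lift {N : Type u} [AddCommGroup N] [Module (QuiverAlgebra k) N]
    {l : Fin 2} (φ : standard (proj k) l →ₗ[QuiverAlgebra k] N)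
    (hφ : ∀ m ∈ Module.jacobson (QuiverAlgebra k) (standard (proj k) l),
      gen k (.e l) • m = m → φ m = 0) :
    ∃ ψ : properStandard (proj k) l →ₗ[QuiverAlgebra k] N,
      ψ (properStandardGen k l) = φ (standardGen k l) := by
  refine ⟨Submodule.liftQ _ φ ?_, rfl⟩
  rw [Submodule.map_le_iff_le_comap, ← LinearMap.ker_comp]
  exact trace_proj_le_ker _ fun m hm => hφ m m.2 (congrArg Subtype.val hm)

lemma properStandardGen₀_ne_zero : properStandardGen k 0 ≠ 0 := by
  have hs := isSocleVector_simple (k := k) 0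
  obtain ⟨φ, hφ⟩ := exists_standard_lift hs.e_smul (forall_lt_fin_two (fun n hn => by
    refine eq_zero_of_simple 0 n ?_
    have := coord_eq hn 0
    simpa [pre] using this.symm))
  obtain ⟨ψ, hψ⟩ := exists_properStandard_lift φ fun m hm _ => map_eq_zero_of_mem_jacobson φ hm
  intro h
  apply hs.ne_zero
  rw [← hφ, ← hψ, h, map_zero]

lemma isSocleVector_properStandardGen : IsSocleVector k 0 (properStandardGen k 0) where
  ne_zero := properStandardGen₀_ne_zero
  e_smul := e_smul_properStandardGen 0
  α_smul := by
    refine (congrArg (Submodule.Quotient.mk) (α_smul_standardGen (k := k))).trans ?_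
    rfl
  β_smul := gen_smul_eq_zero (e_smul_properStandardGen 0) (by simp)
  x_smul := gen_smul_properStandardGen (by simp) rfl
  y_smul := gen_smul_eq_zero (e_smul_properStandardGen 0) (by simp)

/-- The generator of `rep₂`. -/
def rep₂Gen (k : Type u) [Field k] : rep₂.Carrier k := rep₂.ofFun ![1, 0]

lemma e_smul_rep₂Gen : gen k (.e 1) • rep₂Gen k = rep₂Gen k := by
  funext i
  rw [gen_smul_apply]
  fin_cases i <;> simp [pre, rep₂Gen]

lemma β_smul_rep₂Gen : gen k .β • rep₂Gen k ≠ 0 := by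
  intro h
  have := coord_eq_zero h 1
  simp [pre, rep₂Gen] at this

/-- The projection of `rep₂` onto its top. -/
def rep₂Top (k : Type u) [Field k] :
    rep₂.Carrier k →ₗ[QuiverAlgebra k] (simple 1).Carrier k :=
  linearMapOfGen (k := k)
    { toFun := fun v => (simple 1).ofFun fun _ => v 0
      map_add' := fun _ _ => rfl
      map_smul' := fun _ _ => rfl } (by
    intro g v
    funext i
    change (gen k g • v) 0 = (gen k g • (simple 1).ofFun fun _ => v 0) i
    rw [gen_smul_apply, gen_smul_apply]
    rcases g with j | _ | _ | _ | _
    · fin_cases j <;> simp [pre]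
    all_goals simp [pre])

lemma β_smul_properStandardGen : gen k .β • properStandardGen k 1 ≠ 0 := by
  obtain ⟨φ, hφ⟩ := exists_standard_lift (e_smul_rep₂Gen (k := k))
    (fun j hj => (not_one_lt hj).elim)
  obtain ⟨ψ, hψ⟩ := exists_properStandard_lift φ fun m hm he => by
    have h0 : φ m 0 = 0 := congrFun (map_eq_zero_of_mem_jacobson ((rep₂Top k).comp φ) hm) 0
    have h1 := coord_eq (show gen k (.e 1) • φ m = φ m by rw [← map_smul, he]) 1
    funext i
    fin_cases i
    · exact h0
    · simpa [pre] using h1.symm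
  intro h
  apply β_smul_rep₂Gen (k := k)
  rw [← hφ, ← hψ, ← map_smul, h, map_zero]

lemma y_smul_properStandardGen : gen k .y • properStandardGen k 1 = 0 :=
  gen_smul_properStandardGen (by simp) rfl

end Standard

/-! ### Standard and proper standard filtrations -/

section Filtered

lemma span_singleton_ne_bot {M : Type*} [AddCommGroup M] [Module (QuiverAlgebra k) M] {m : M}
    (hm : m ≠ 0) : Submodule.span (QuiverAlgebra k) {m} ≠ ⊥ := by
  rwa [Ne, Submodule.span_singleton_eq_bot]

lemma IsDeltaExact.of_subsingleton {M : Type*} [AddCommGroup M] [Module (QuiverAlgebra k) M]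
    [Subsingleton M] : IsDeltaExact k M :=
  ⟨fun _ _ _ => ⟨0, Subsingleton.elim _ _⟩, fun _ _ _ => Subsingleton.elim _ _,
    fun _ _ _ _ => ⟨0, 0, Subsingleton.elim _ _⟩⟩

theorem IsFiltered.isDeltaExact {M : ModuleCat.{u} (QuiverAlgebra k)}
    (h : IsFiltered (standard (proj k)) M) : IsDeltaExact k M :=
  h.induction (C := fun M => IsDeltaExact k M) (fun _ _ e h => h.congr e)
    (fun _ _ => .of_subsingleton)
    fun _ N l e h => IsDeltaExact.of_exact N.injective_subtype (LinearMap.exact_subtype_mkQ N)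
      N.mkQ_surjective h ((isDeltaExact_standard l).congr e.symm)

theorem IsFiltered.finite {A : Type u} [Ring A] {Λ : Type} {S : Λ → ModuleCat.{u} A}
    {M : ModuleCat.{u} A} (h : IsFiltered S M) (hS : ∀ l, Module.Finite A (S l)) :
    Module.Finite A M :=
  h.induction (C := fun M => Module.Finite A M) (fun _ _ e _ => Module.Finite.equiv e)
    (fun _ _ => inferInstance)
    fun M N l e h => by
      have := hS l
      have : Module.Finite A (M ⧸ N) := Module.Finite.equiv e.symm
      have : Module.Finite A N := h
      exact Module.Finite.of_submodule_quotient N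

theorem IsDeltaExact.isFiltered {M : ModuleCat.{u} (QuiverAlgebra k)}
    [Module.Finite (QuiverAlgebra k) M] (hM : IsDeltaExact k M) :
    IsFiltered (standard (proj k)) M := by
  refine isFiltered_of_step (C := fun M => IsDeltaExact k M) (fun _ _ e h => h.congr e) ?_ hM
  intro M _ hM
  -- it suffices to find a submodule isomorphic to a standard module
  have key (m : M) (l : Fin 2) (hm : m ≠ 0) (e : Nonempty (Submodule.span (QuiverAlgebra k) {m}
      ≃ₗ[QuiverAlgebra k] standard (proj k) l)) : ∃ (N : Submodule (QuiverAlgebra k) M)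
      (l : Fin 2), N ≠ ⊥ ∧ Nonempty (N ≃ₗ[QuiverAlgebra k] standard (proj k) l) ∧
        IsDeltaExact k (ModuleCat.of (QuiverAlgebra k) (M ⧸ N)) := by
    refine ⟨_, l, span_singleton_ne_bot hm, e, ?_⟩
    obtain ⟨e⟩ := e
    exact IsDeltaExact.of_cokernel (Submodule.injective_subtype _)
      (LinearMap.exact_subtype_mkQ _) (Submodule.mkQ_surjective _)
      ((isDeltaExact_standard l).congr e.symm) hM
  by_cases h1 : ∃ v : M, gen k (.e 1) • v = v ∧ v ≠ 0
  -- if `e₁ M` is nonzero, exactness of `y` yields `v` with `y v ≠ 0`, which generates `Δ(1)`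
  · obtain ⟨v, hv, hy⟩ : ∃ v : M, gen k (.e 1) • v = v ∧ gen k .y • v ≠ 0 := by
      obtain ⟨v, hv, h0⟩ := h1
      by_cases hy : gen k .y • v = 0
      · obtain ⟨w, rfl⟩ := hM.y_exact v hv hy
        exact ⟨gen k (.e 1) • w, by simp, by simpa using h0⟩
      · exact ⟨v, hv, hy⟩
    have hy' : gen k .y • standardGen k 1 ≠ 0 := by
      obtain ⟨φ, hφ⟩ := exists_standard_lift (e_smul_projGen (k := k) 1)
        (fun j hj => (not_one_lt hj).elim)
      intro h
      apply y_smul_projGen (k := k)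
      rw [← hφ, ← map_smul, h, map_zero]
    refine key v 1 (fun h => hy (by rw [h, smul_zero])) (nonempty_span_equiv _
      (span_standardGen 1) fun a => (smul_eq_zero_iff_standard₁ hv hM.β_injective hy a).trans
        (smul_eq_zero_iff_standard₁ (e_smul_standardGen 1) (isDeltaExact_standard 1).β_injective
          hy' a).symm)
  · push Not at h1
    have h0 (v : M) : gen k (.e 0) • v = v := by
      simpa [h1 (gen k (.e 1) • v) (by simp)] using e_smul_add k v
    -- otherwise exactness of `x` yields `v` with `x v ≠ 0`, which generates `Δ(0)`
    obtain ⟨v, hx⟩ : ∃ v : M, gen k .x • v ≠ 0 := by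
      by_contra! hx
      obtain ⟨v, hv⟩ := exists_ne (0 : M)
      obtain ⟨w, t, h⟩ := hM.x_exact v 0 (h0 v) (by rw [hx, smul_zero])
      rw [hx, gen_smul_eq_zero (h0 t) (by simp), add_zero] at h
      exact hv h
    refine key v 0 (fun h => hx (by rw [h, smul_zero])) (nonempty_span_equiv _
      (span_standardGen 0) fun a => (smul_eq_zero_iff_standard₀ (h0 v) (h1 _ (by simp)) hx a).trans
        (smul_eq_zero_iff_standard₀ (e_smul_standardGen 0) α_smul_standardGen
          x_smul_standardGen a).symm)

theorem IsBetaInjective.isFiltered {M : ModuleCat.{u} (QuiverAlgebra k)}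
    [Module.Finite (QuiverAlgebra k) M] (hM : IsBetaInjective k M) :
    IsFiltered (properStandard (proj k)) M := by
  refine isFiltered_of_step (C := fun M => IsBetaInjective k M) ?_ ?_ hM
  · intro M N e hM v hv h
    have := hM (e.symm v) (by rw [← map_smul, hv]) (by rw [← map_smul, h, map_zero])
    simpa using this
  intro M _ hM
  by_cases h1 : ∃ v : M, gen k (.e 1) • v = v ∧ v ≠ 0
  · obtain ⟨v, hv, hv0, hy⟩ : ∃ v : M, gen k (.e 1) • v = v ∧ v ≠ 0 ∧ gen k .y • v = 0 := by
      obtain ⟨v, hv, h0⟩ := h1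
      by_cases hy : gen k .y • v = 0
      · exact ⟨v, hv, h0, hy⟩
      · exact ⟨gen k .y • v, by simp, hy, by simp⟩
    have hβ : gen k .β • v ≠ 0 := fun h => hv0 (hM v hv h)
    refine ⟨Submodule.span (QuiverAlgebra k) {v}, 1, span_singleton_ne_bot hv0,
      nonempty_span_equiv _ (span_properStandardGen 1) fun a =>
        (smul_eq_zero_iff_properStandard₁ hv hy hβ a).trans
          (smul_eq_zero_iff_properStandard₁ (e_smul_properStandardGen 1) y_smul_properStandardGen
            β_smul_properStandardGen a).symm, ?_⟩
    intro w hw h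
    obtain ⟨w, hw', rfl⟩ := exists_lift_e_smul (Submodule.mkQ_surjective _) hw
    obtain ⟨a, ha⟩ := Submodule.mem_span_singleton.1 ((Submodule.Quotient.mk_eq_zero _).1 h)
    let _ : Module k M := Module.restrictScalars k (QuiverAlgebra k) M
    have : IsScalarTower k (QuiverAlgebra k) M := IsScalarTower.restrictScalars k _ M
    have h0 : coeff a 8 • gen k .β • v = gen k .β • w := by
      have h0 : gen k (.e 0) • v = 0 := gen_smul_eq_zero hv (by simp)
      rw [smul_eq_coeff₁ a hv] at ha
      simpa [hy, h0] using congrArg (gen k (.e 0) • ·) ha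
    have h1 := hM (w - coeff a 8 • v) (by simp [smul_sub, hw', hv]) (by simp [smul_sub, h0])
    refine (Submodule.Quotient.mk_eq_zero _).2 ?_
    rw [sub_eq_zero.1 h1, ← algebraMap_smul (QuiverAlgebra k)]
    exact Submodule.smul_mem _ _ (Submodule.mem_span_singleton_self _)
  · push Not at h1
    have h0 (v : M) : gen k (.e 0) • v = v := by
      simpa [h1 (gen k (.e 1) • v) (by simp)] using e_smul_add k v
    obtain ⟨v, hv, hx⟩ : ∃ v : M, v ≠ 0 ∧ gen k .x • v = 0 := by
      obtain ⟨v, hv⟩ := exists_ne (0 : M)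
      by_cases hx : gen k .x • v = 0
      · exact ⟨v, hv, hx⟩
      · exact ⟨_, hx, by simp⟩
    have hs : IsSocleVector k 0 v := ⟨hv, h0 v, h1 _ (by simp), gen_smul_eq_zero (h0 v) (by simp),
      hx, gen_smul_eq_zero (h0 v) (by simp)⟩
    refine ⟨Submodule.span (QuiverAlgebra k) {v}, 0, span_singleton_ne_bot hv,
      nonempty_span_equiv _ (span_properStandardGen 0) fun a =>
        (hs.smul_eq_zero_iff a).trans (isSocleVector_properStandardGen.smul_eq_zero_iff a).symm, ?_⟩
    intro w hw _
    obtain ⟨w, hw', rfl⟩ := exists_lift_e_smul (Submodule.mkQ_surjective _) hw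
    rw [h1 w hw', map_zero]

theorem isProperlyStratified_proj : IsProperlyStratified (proj k) :=
  ⟨IsDeltaExact.isFiltered (M := ModuleCat.of _ (QuiverAlgebra k)) isDeltaExact_self,
    IsBetaInjective.isFiltered (M := ModuleCat.of _ (QuiverAlgebra k))
      isDeltaExact_self.β_injective⟩

end Filtered

open scoped ModuleCat

/-! ### The duality -/

section Duality

/-- The anti-involution of the quiver, which exchanges `α` and `β`. -/
def Gen.swap : Gen → Gen
  | .e i => .e i
  | .α => .β
  | .β => .α
  | .x => .x
  | .y => .y

/-- The anti-involution of the algebra which exchanges `α` and `β`, as a homomorphism to the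
opposite algebra. -/
def antiHom (k : Type u) [Field k] : QuiverAlgebra k →ₐ[k] (QuiverAlgebra k)ᵐᵒᵖ :=
  RingQuot.liftAlgHom k ⟨FreeAlgebra.lift k fun g => MulOpposite.op (gen k g.swap), by
    intro a b h
    have path (g : Gen) := path_rel (k := k) g
    induction h with
    | idem i => simp [← MulOpposite.op_mul, Gen.swap, e_mul_e]
    | orth i j h => simp [← MulOpposite.op_mul, Gen.swap, e_mul_e, h.symm]
    | one => simp [← MulOpposite.op_add, Gen.swap, e_add]
    | α_path => simp [← MulOpposite.op_mul, Gen.swap, e_mul_gen, gen_mul_e]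
    | β_path => simp [← MulOpposite.op_mul, Gen.swap, e_mul_gen, gen_mul_e]
    | x_path => simp [← MulOpposite.op_mul, Gen.swap, e_mul_gen, gen_mul_e]
    | y_path => simp [← MulOpposite.op_mul, Gen.swap, e_mul_gen, gen_mul_e]
    | αβ => simp [← MulOpposite.op_mul, Gen.swap, α_mul_β]
    | xx => simp [← MulOpposite.op_mul, Gen.swap, x_mul_x]
    | yy => simp [← MulOpposite.op_mul, Gen.swap, y_mul_y]
    | xβ => simp [← MulOpposite.op_mul, Gen.swap, α_mul_x]
    | αx => simp [← MulOpposite.op_mul, Gen.swap, x_mul_β]⟩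

/-- The anti-involution of the algebra which exchanges `α` and `β`. -/
def anti (a : QuiverAlgebra k) : QuiverAlgebra k := (antiHom k a).unop

@[simp] lemma anti_gen (g : Gen) : anti (gen k g) = gen k g.swap := by
  simp [anti, antiHom, gen]

@[simp] lemma anti_mul (a b : QuiverAlgebra k) : anti (a * b) = anti b * anti a := by
  simp [anti]

@[simp] lemma anti_add (a b : QuiverAlgebra k) : anti (a + b) = anti a + anti b := by
  simp [anti]

@[simp] lemma anti_zero : anti (0 : QuiverAlgebra k) = 0 := by
  simp [anti]

@[simp] lemma anti_one : anti (1 : QuiverAlgebra k) = 1 := by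
  simp [anti]

@[simp] lemma anti_algebraMap (c : k) :
    anti (algebraMap k (QuiverAlgebra k) c) = algebraMap k _ c := by
  simp [anti, MulOpposite.algebraMap_apply]

@[simp] lemma anti_anti (a : QuiverAlgebra k) : anti (anti a) = a := by
  induction a using QuiverAlgebra.induction with
  | scalar c => simp
  | gen g => cases g <;> simp [Gen.swap]
  | mul a b ha hb => simp [ha, hb]
  | add a b ha hb => simp [ha, hb]

/-- The vector space dual of a module. -/
def DualSpace (M : ModuleCat.{u} (QuiverAlgebra k)) : Type u := Module.Dual k M

variable (M N : ModuleCat.{u} (QuiverAlgebra k))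

instance : AddCommGroup (DualSpace M) := inferInstanceAs (AddCommGroup (Module.Dual k M))

/-- The algebra acts on the dual space through its anti-involution. -/
instance : Module (QuiverAlgebra k) (DualSpace M) where
  smul a f := LinearMap.comp (show Module.Dual k M from f) (Algebra.lsmul k k M (anti a))
  one_smul f := by
    refine LinearMap.ext fun m => ?_
    change (show Module.Dual k M from f) (anti (1 : QuiverAlgebra k) • m) = _
    rw [anti_one, one_smul]
  mul_smul a b f := by
    refine LinearMap.ext fun m => ?_
    change (show Module.Dual k M from f) (anti (a * b) • m) =
      (show Module.Dual k M from f) (anti b • anti a • m)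
    simp [mul_smul]
  smul_zero a := rfl
  smul_add a f g := rfl
  add_smul a b f := by
    refine LinearMap.ext fun m => ?_
    change (show Module.Dual k M from f) (anti (a + b) • m) =
      (show Module.Dual k M from f) (anti a • m) + (show Module.Dual k M from f) (anti b • m)
    rw [anti_add, add_smul]
    exact LinearMap.map_add _ _ _
  zero_smul f := by
    refine LinearMap.ext fun m => ?_
    change (show Module.Dual k M from f) (anti (0 : QuiverAlgebra k) • m) = 0
    rw [anti_zero, zero_smul]
    exact LinearMap.map_zero _

/-- The dual module. -/
def dual : ModuleCat.{u} (QuiverAlgebra k) := ModuleCat.of _ (DualSpace M)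

/-- The elements of the dual module as linear forms. -/
def dualEquiv : dual M ≃ₗ[k] Module.Dual k M where
  toFun f := f
  invFun f := f
  map_add' _ _ := rfl
  map_smul' c f := by
    rw [← algebraMap_smul (QuiverAlgebra k) c f]
    refine LinearMap.ext fun m => ?_
    change (show Module.Dual k M from f) (anti (algebraMap k (QuiverAlgebra k) c) • m) =
      c • (show Module.Dual k M from f) m
    rw [anti_algebraMap, algebraMap_smul, map_smul]
  left_inv _ := rfl
  right_inv _ := rfl

variable {M N}

lemma dualEquiv_smul (a : QuiverAlgebra k) (f : dual M) (m : M) :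
    dualEquiv M (a • f) m = dualEquiv M f (anti a • m) := rfl

lemma dualEquiv_gen_smul (g : Gen) (f : dual M) (m : M) :
    dualEquiv M (gen k g • f) m = dualEquiv M f (gen k g.swap • m) := by
  rw [dualEquiv_smul, anti_gen]

lemma dual_ext {f g : dual M} (h : ∀ m, dualEquiv M f m = dualEquiv M g m) : f = g :=
  (dualEquiv M).injective (LinearMap.ext h)

lemma finite_restrictScalars [Module.Finite (QuiverAlgebra k) M] : Module.Finite k M :=
  Module.Finite.trans (QuiverAlgebra k) M

instance finite_dual [Module.Finite (QuiverAlgebra k) M] :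
    Module.Finite (QuiverAlgebra k) (dual M) := by
  have : Module.Finite k M := finite_restrictScalars
  have : Module.Finite k (dual M) := Module.Finite.equiv (dualEquiv M).symm
  exact Module.Finite.of_restrictScalars_finite k (QuiverAlgebra k) (dual M)

/-- A homomorphism as a `k`-linear map. -/
def toLinear (f : M →ₗ[QuiverAlgebra k] N) : M →ₗ[k] N := f.restrictScalars k

/-- The transpose of a homomorphism. -/
def dualMap (f : M →ₗ[QuiverAlgebra k] N) : dual N →ₗ[QuiverAlgebra k] dual M where
  toFun φ := (dualEquiv M).symm ((dualEquiv N φ).comp (toLinear f))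
  map_add' φ ψ := by simp [LinearMap.add_comp]
  map_smul' a φ := by
    refine dual_ext fun m => ?_
    rw [RingHom.id_apply, dualEquiv_smul, LinearEquiv.apply_symm_apply,
      LinearEquiv.apply_symm_apply, LinearMap.comp_apply, LinearMap.comp_apply, dualEquiv_smul]
    exact congrArg (dualEquiv N φ) (map_smul f _ _).symm

variable (M) in
/-- The canonical homomorphism into the bidual. -/
def evalDual : M →ₗ[QuiverAlgebra k] dual (dual M) where
  toFun m := (dualEquiv (dual M)).symm ((LinearMap.applyₗ m).comp (dualEquiv M).toLinearMap)
  map_add' m n := by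
    refine dual_ext fun f => ?_
    simp
  map_smul' a m := by
    refine dual_ext fun f => ?_
    rw [RingHom.id_apply, dualEquiv_smul]
    simp [dualEquiv_smul]

lemma evalDual_bijective [Module.Finite (QuiverAlgebra k) M] :
    Function.Bijective (evalDual M) := by
  have : Module.Finite k M := finite_restrictScalars
  have h : ⇑(evalDual M) = (((Module.evalEquiv k M).trans
      (dualEquiv M).dualMap).trans (dualEquiv (dual M)).symm) := by
    ext m
    rfl
  rw [h]
  exact LinearEquiv.bijective _

/-- The duality functor. -/
def dualFunctor (k : Type u) [Field k] :
    (FGModuleCat.{u} (QuiverAlgebra k))ᵒᵖ ⥤ FGModuleCat.{u} (QuiverAlgebra k) where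
  obj M := ⟨dual M.unop.obj, finite_dual (M := M.unop.obj)⟩
  map f := ObjectProperty.homMk (ModuleCat.ofHom (dualMap f.unop.hom.hom))
  map_id _ := rfl
  map_comp _ _ := rfl

/-- A finitely generated module is isomorphic to its bidual. -/
def bidualIso (M : FGModuleCat.{u} (QuiverAlgebra k)) :
    M ≅ (dualFunctor k).obj (Opposite.op ((dualFunctor k).obj (Opposite.op M))) :=
  (ModuleCat.isFG _).isoMk
    (LinearEquiv.toModuleIso (LinearEquiv.ofBijective (evalDual M.obj) evalDual_bijective))

lemma bidualIso_naturality {M N : FGModuleCat.{u} (QuiverAlgebra k)} (f : M ⟶ N) :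
    (bidualIso M).inv ≫ f = (dualFunctor k).map ((dualFunctor k).map f.op).op ≫
      (bidualIso N).inv := by
  rw [Iso.inv_comp_eq, ← Category.assoc, Iso.eq_comp_inv]
  rfl

/-- The duality as an equivalence of categories. -/
def duality (k : Type u) [Field k] :
    (FGModuleCat.{u} (QuiverAlgebra k))ᵒᵖ ≌ FGModuleCat.{u} (QuiverAlgebra k) :=
  CategoryTheory.Equivalence.mk (dualFunctor k) (dualFunctor k).rightOp
    (NatIso.ofComponents (fun M => (bidualIso M.unop).symm.op) fun f =>
      Quiver.Hom.unop_inj (bidualIso_naturality f.unop))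
    (NatIso.ofComponents (fun M => (bidualIso M).symm) fun f => (bidualIso_naturality f).symm)

lemma dualEquiv_apply_gen_smul (g : Gen) (f : dual M) (m : M) :
    dualEquiv M f (gen k g • m) = dualEquiv M (gen k g.swap • f) m := by
  rw [dualEquiv_gen_smul]
  cases g <;> rfl

/-- The dual of a simple module is isomorphic to it. -/
lemma nonempty_dual_equiv [IsSimpleModule (QuiverAlgebra k) M] :
    Nonempty (dual M ≃ₗ[QuiverAlgebra k] M) := by
  obtain ⟨i, m, hm, hs⟩ := exists_isSocleVector_of_isSimpleModule (k := k) (M := M)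
  have hspan (n : M) : ∃ c : k, n = c • m := by
    obtain ⟨a, rfl⟩ := Submodule.mem_span_singleton.1 (hs.ge (Submodule.mem_top (x := n)))
    exact ⟨_, (hm.smul_eq a).trans (algebraMap_smul _ _ _)⟩
  have hext {f g : dual M} (h : dualEquiv M f m = dualEquiv M g m) : f = g := dual_ext fun n => by
    obtain ⟨c, rfl⟩ := hspan n
    rw [map_smul, map_smul, h]
  have hne : ∃ f : dual M, dualEquiv M f m = 1 := by
    obtain ⟨f, hf⟩ := Module.Projective.exists_dual_eq_one k hm.ne_zero
    exact ⟨(dualEquiv M).symm f, hf⟩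
  obtain ⟨f, hf⟩ := hne
  have harrow (g : Gen) (hg : gen k g.swap • m = 0) : gen k g • f = 0 := hext (by
    rw [dualEquiv_gen_smul, hg, map_zero, map_zero]; rfl)
  have hfs : IsSocleVector k i f :=
    { ne_zero := fun h => by simp [h] at hf
      e_smul := hext (by rw [dualEquiv_gen_smul, Gen.swap, hm.e_smul])
      α_smul := harrow _ hm.β_smul
      β_smul := harrow _ hm.α_smul
      x_smul := harrow _ hm.x_smul
      y_smul := harrow _ hm.y_smul }
  obtain ⟨e⟩ := nonempty_span_equiv (A := QuiverAlgebra k) f hs fun a =>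
    (hfs.smul_eq_zero_iff a).trans (hm.smul_eq_zero_iff a).symm
  have htop : Submodule.span (QuiverAlgebra k) {f} = ⊤ := by
    refine eq_top_iff.2 fun g _ => Submodule.mem_span_singleton.2
      ⟨algebraMap k _ (dualEquiv M g m), hext ?_⟩
    rw [algebraMap_smul, map_smul, LinearMap.smul_apply, hf, smul_eq_mul, mul_one]
  exact ⟨(Submodule.topEquiv.symm.trans (LinearEquiv.ofEq _ _ htop.symm)).trans e⟩

theorem hasSimplePreservingDuality : HasSimplePreservingDuality (QuiverAlgebra k) := by
  refine ⟨duality k, fun S hS => ?_⟩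
  have : IsSimpleModule (QuiverAlgebra k) S.obj := hS
  obtain ⟨e⟩ := nonempty_dual_equiv (M := S.obj)
  exact ⟨(ModuleCat.isFG _).isoMk e.toModuleIso⟩

end Duality

/-! ### Injective modules -/

section Injectives

/-- The module `D (A e_i)`. -/
abbrev inj (k : Type u) [Field k] (i : Fin 2) : ModuleCat.{u} (QuiverAlgebra k) := dual (proj k i)

lemma inj_ext {i : Fin 2} {f g : inj k i}
    (h : ∀ a : QuiverAlgebra k, dualEquiv (proj k i) f (a • projGen k i) =
      dualEquiv (proj k i) g (a • projGen k i)) : f = g :=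
  dual_ext fun p => by rw [← projIncl_smul_projGen p]; exact h _

section Lift

variable {X : Type u} [AddCommGroup X] [Module k X] [Module (QuiverAlgebra k) X]
  [IsScalarTower k (QuiverAlgebra k) X]

/-- The homomorphism into `D (A e_i)` given by a linear form. -/
def injLift (i : Fin 2) (ψ : X →ₗ[k] k) : X →ₗ[QuiverAlgebra k] inj k i where
  toFun m := (dualEquiv (proj k i)).symm
    { toFun := fun p => ψ (anti (projIncl k i p) • m)
      map_add' := fun p q => by simp [add_smul]
      map_smul' := fun c p => by
        rw [← algebraMap_smul (QuiverAlgebra k) c p, map_smul (projIncl k i), smul_eq_mul,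
          anti_mul, anti_algebraMap, ← Algebra.commutes, mul_smul, algebraMap_smul, map_smul]
        rfl }
  map_add' m n := dual_ext fun p => by
    change ψ (_ • (m + n)) = ψ (_ • m) + ψ (_ • n)
    rw [smul_add, map_add]
  map_smul' a m := dual_ext fun p => by
    change ψ (_ • a • m) = ψ (anti (projIncl k i (anti a • p)) • m)
    rw [map_smul (projIncl k i), smul_eq_mul, anti_mul, anti_anti, mul_smul]

lemma injLift_apply (i : Fin 2) (ψ : X →ₗ[k] k) (m : X) (p : proj k i) :
    dualEquiv (proj k i) (injLift i ψ m) p = ψ (anti (projIncl k i p) • m) := rfl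

end Lift

/-- A homomorphism into `D (A e_i)` is determined by the linear form which evaluates at `e_i`. -/
lemma dualEquiv_apply_eq {M : Type u} [AddCommGroup M] [Module (QuiverAlgebra k) M] {i : Fin 2}
    (f : M →ₗ[QuiverAlgebra k] inj k i) (m : M) (p : proj k i) :
    dualEquiv (proj k i) (f m) p =
      dualEquiv (proj k i) (f (anti (projIncl k i p) • m)) (projGen k i) := by
  rw [map_smul]
  refine Eq.trans ?_ (dualEquiv_smul _ (f m) _).symm
  rw [anti_anti, projIncl_smul_projGen]

theorem injective_inj (i : Fin 2) : Module.Injective (QuiverAlgebra k) (inj k i) where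
  out X Y _ _ _ _ f hf g := by
    let _ : Module k X := Module.restrictScalars k (QuiverAlgebra k) X
    have : IsScalarTower k (QuiverAlgebra k) X := IsScalarTower.restrictScalars k _ X
    let _ : Module k Y := Module.restrictScalars k (QuiverAlgebra k) Y
    have : IsScalarTower k (QuiverAlgebra k) Y := IsScalarTower.restrictScalars k _ Y
    let f' : X →ₗ[k] Y := f.restrictScalars k
    let g' : X →ₗ[k] inj k i := g.restrictScalars k
    obtain ⟨r, hr⟩ := f'.exists_leftInverse_of_injective (LinearMap.ker_eq_bot.2 hf)
    refine ⟨injLift i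
      (((LinearMap.applyₗ (projGen k i)).comp ((dualEquiv (proj k i)).toLinearMap.comp g')).comp r),
      fun x => dual_ext fun p => ?_⟩
    rw [injLift_apply, dualEquiv_apply_eq g x p, ← map_smul f]
    have h (x : X) : r (f x) = x := LinearMap.congr_fun hr x
    simp only [LinearMap.comp_apply, h]
    rfl

/-- The reject of `D (A e_i)` in a module is the largest submodule without vectors at the
vertex `i`. -/
lemma forall_hom_inj_eq_zero_iff {M : Type u} [AddCommGroup M] [Module (QuiverAlgebra k) M]
    {i : Fin 2} {m : M} : (∀ f : M →ₗ[QuiverAlgebra k] inj k i, f m = 0) ↔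
      ∀ a : QuiverAlgebra k, gen k (.e i) • a • m = 0 := by
  constructor
  · intro h a
    by_contra hne
    let _ : Module k M := Module.restrictScalars k (QuiverAlgebra k) M
    have : IsScalarTower k (QuiverAlgebra k) M := IsScalarTower.restrictScalars k _ M
    obtain ⟨ψ, hψ⟩ := Module.Projective.exists_dual_ne_zero k hne
    apply hψ
    have := injLift_apply i ψ m (anti a • projGen k i)
    rw [h, map_smul (projIncl k i), projIncl_projGen, smul_eq_mul, anti_mul, anti_gen, anti_anti,
      mul_smul] at this
    exact this.symm.trans (by rw [map_zero]; rfl)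
  · intro h f
    refine dual_ext fun p => ?_
    have h' : projIncl k i p = projIncl k i p * gen k (.e i) := by
      conv_lhs => rw [← projIncl_smul_projGen p, map_smul, projIncl_projGen, smul_eq_mul]
    have h1 := h (anti (projIncl k i p))
    rw [dualEquiv_apply_eq, h', anti_mul, anti_gen, Gen.swap, mul_smul, h1, map_zero, map_zero]
    rfl

lemma mem_reject_inj {M : Type u} [AddCommGroup M] [Module (QuiverAlgebra k) M]
    {i : Fin 2} {m : M} : m ∈ reject (QuiverAlgebra k) (inj k i) M ↔
      ∀ a : QuiverAlgebra k, gen k (.e i) • a • m = 0 := by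
  rw [← forall_hom_inj_eq_zero_iff]
  simp [reject]

lemma mem_reject_directSum {M : Type u} [AddCommGroup M] [Module (QuiverAlgebra k) M]
    {l : Fin 2} {m : M} :
    m ∈ reject (QuiverAlgebra k) (⨁ j : {j : Fin 2 // l < j}, inj k j.1) M ↔
      ∀ j, l < j → ∀ a : QuiverAlgebra k, gen k (.e j) • a • m = 0 := by
  classical
  simp only [← forall_hom_inj_eq_zero_iff, reject, Submodule.mem_iInf, LinearMap.mem_ker]
  constructor
  · intro h j hj f
    have := congrArg (DirectSum.component (QuiverAlgebra k) {j : Fin 2 // l < j}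
      (fun j => inj k j.1) ⟨j, hj⟩) (h ((DirectSum.lof (QuiverAlgebra k) _
        (fun j : {j : Fin 2 // l < j} => inj k j.1) ⟨j, hj⟩).comp f))
    rwa [LinearMap.comp_apply, DirectSum.component.lof_self, map_zero] at this
  · intro h f
    refine DirectSum.ext_component (QuiverAlgebra k) fun j => ?_
    rw [map_zero]
    exact h j.1 j.2 ((DirectSum.component (QuiverAlgebra k) _ _ j).comp f)

end Injectives

/-! ### Proper costandard modules -/

section Costandard

section Socle

variable {M : Type u} [AddCommGroup M] [Module (QuiverAlgebra k) M]

lemma gen_smul_eq_zero_of_mem_socle {g : Gen} (hg : ∀ j, g ≠ .e j) {m : M}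
    (hm : m ∈ socle (QuiverAlgebra k) M) : gen k g • m = 0 := by
  rw [socle, sSup_eq_iSup'] at hm
  induction hm using Submodule.iSup_induction' with
  | mem S m hm =>
    have : IsSimpleModule (QuiverAlgebra k) (S.1 : Submodule (QuiverAlgebra k) M) := S.2
    exact congrArg Subtype.val (gen_smul_eq_zero_of_isSimpleModule (k := k) hg
      (⟨m, hm⟩ : (S.1 : Submodule (QuiverAlgebra k) M)))
  | zero => rw [smul_zero]
  | add m n _ _ hm hn => rw [smul_add, hm, hn, add_zero]

lemma IsSocleVector.smul_mem_socle {i : Fin 2} {m : M} (h : IsSocleVector k i m)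
    (a : QuiverAlgebra k) : a • m ∈ socle (QuiverAlgebra k) M := by
  have hle : Submodule.span (QuiverAlgebra k) {m} ≤ socle (QuiverAlgebra k) M :=
    le_sSup h.isSimpleModule
  exact Submodule.smul_mem _ _ (hle (Submodule.mem_span_singleton_self m))

end Socle

/-- The linear form on `A e_i` which reads off the coefficient of a path. -/
def coordForm (k : Type u) [Field k] (i : Fin 2) (j : Fin 10) : inj k i :=
  (dualEquiv (proj k i)).symm
    { toFun := fun p => coeff (projIncl k i p) j
      map_add' := fun p q => by rw [map_add, coeff, map_add]; rfl
      map_smul' := fun c p => by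
        rw [← algebraMap_smul (QuiverAlgebra k) c p, map_smul (projIncl k i), coeff, map_smul,
          algebraMap_smul]
        rfl }

lemma coordForm_apply (i : Fin 2) (j : Fin 10) (p : proj k i) :
    dualEquiv (proj k i) (coordForm k i j) p = coeff (projIncl k i p) j := rfl

lemma gen_smul_coordForm (i : Fin 2) (j : Fin 10) (g : Gen) :
    gen k g • coordForm k i j = (regular.pre g.swap j).elim 0 (coordForm k i) := by
  refine dual_ext fun p => ?_
  rw [dualEquiv_gen_smul, coordForm_apply, map_smul (projIncl k i), coeff, map_smul,
    gen_smul_apply]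
  rcases regular.pre g.swap j with _ | l <;> rfl

lemma coeff_projGen (i : Fin 2) (j : Fin 10) :
    coeff (projIncl k i (projGen k i)) j = if j = ![0, 6] i then 1 else 0 := by
  have : coeff (gen k (.e i)) = gen k (.e i) • unit k := rfl
  rw [projIncl_projGen, this, gen_smul_apply]
  fin_cases i <;> fin_cases j <;> simp [pre, unit]

lemma isSocleVector_coordForm (i : Fin 2) : IsSocleVector k i (coordForm k i (![0, 6] i)) where
  ne_zero h := by
    have := coordForm_apply (k := k) i (![0, 6] i) (projGen k i)
    rw [h, coeff_projGen, if_pos rfl, map_zero] at this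
    exact zero_ne_one this
  e_smul := by rw [gen_smul_coordForm]; fin_cases i <;> rfl
  α_smul := by rw [gen_smul_coordForm]; fin_cases i <;> rfl
  β_smul := by rw [gen_smul_coordForm]; fin_cases i <;> rfl
  x_smul := by rw [gen_smul_coordForm]; fin_cases i <;> rfl
  y_smul := by rw [gen_smul_coordForm]; fin_cases i <;> rfl

/-- A form on `A e_i` which is annihilated by all arrows is a multiple of the coefficient
of `e_i`. -/
lemma eq_smul_coordForm {i : Fin 2} {f : inj k i} (hf : ∀ g : Gen, (∀ j, g ≠ .e j) →
    gen k g • f = 0) :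
    f = dualEquiv (proj k i) f (projGen k i) • coordForm k i (![0, 6] i) := by
  refine dual_ext fun p => ?_
  have h (g : Gen) (hg : ∀ j, g.swap ≠ .e j) (q : proj k i) :
      dualEquiv (proj k i) f (gen k g • q) = 0 := by
    rw [dualEquiv_apply_gen_smul, hf _ hg, map_zero]
    rfl
  rw [map_smul, LinearMap.smul_apply, coordForm_apply]
  conv_lhs => rw [← projIncl_smul_projGen p]
  obtain rfl | rfl : i = 0 ∨ i = 1 := by omega
  · rw [smul_eq_coeff₀ (projIncl k _ p) (e_smul_projGen 0)]
    simp [h .x (by simp [Gen.swap]), h .α (by simp [Gen.swap]), h .β (by simp [Gen.swap]),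
      h .y (by simp [Gen.swap]), mul_comm]
  · rw [smul_eq_coeff₁ (projIncl k _ p) (e_smul_projGen 1)]
    simp only [map_add, map_smul, h .β (by simp [Gen.swap]), h .y (by simp [Gen.swap]), smul_zero,
      add_zero]
    exact mul_comm _ _

lemma mem_properCostandard {l : Fin 2} (m : costandard (inj k) l) :
    m ∈ (reject (QuiverAlgebra k) (inj k l) (costandard (inj k) l ⧸
      socle (QuiverAlgebra k) (costandard (inj k) l))).comap
        (socle (QuiverAlgebra k) (costandard (inj k) l)).mkQ ↔
      ∀ a : QuiverAlgebra k, gen k (.e l) • a • m ∈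
        socle (QuiverAlgebra k) (costandard (inj k) l) := by
  rw [Submodule.mem_comap, mem_reject_inj]
  refine forall_congr' fun a => ?_
  rw [← map_smul, ← map_smul, Submodule.mkQ_apply, Submodule.Quotient.mk_eq_zero]

/-- The inclusion of `∇(l)` into `I(l)`. -/
def costandardIncl (k : Type u) [Field k] (l : Fin 2) :
    costandard (inj k) l →ₗ[QuiverAlgebra k] inj k l :=
  Submodule.subtype (reject (QuiverAlgebra k) (⨁ m : {m : Fin 2 // l < m}, inj k m.1) (inj k l))

lemma costandardIncl_injective (l : Fin 2) : Function.Injective (costandardIncl k l) :=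
  Subtype.val_injective

/-- The inclusion of `∇̄(l)` into `∇(l)`. -/
def properCostandardIncl (k : Type u) [Field k] (l : Fin 2) :
    properCostandard (inj k) l →ₗ[QuiverAlgebra k] costandard (inj k) l :=
  Submodule.subtype (Submodule.comap _ _)

lemma properCostandardIncl_injective (l : Fin 2) : Function.Injective (properCostandardIncl k l) :=
  Subtype.val_injective

lemma gen_smul_e_smul_properCostandard {l : Fin 2} (m : properCostandard (inj k) l)
    (a : QuiverAlgebra k) {g : Gen} (hg : ∀ j, g ≠ .e j) : gen k g • gen k (.e l) • a • m = 0 := by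
  apply properCostandardIncl_injective l
  rw [map_smul, map_smul, map_smul, map_zero]
  exact gen_smul_eq_zero_of_mem_socle hg ((mem_properCostandard _).1 m.2 a)

/-- A vector of `I(l)` defines one of `∇̄(l)` if it has no composition factors above `l` and its
vectors at the vertex `l` lie in the socle. -/
lemma exists_properCostandard {l : Fin 2} (f : inj k l)
    (h : ∀ j, l < j → ∀ a : QuiverAlgebra k, gen k (.e j) • a • f = 0)
    {s : inj k l} (hs : IsSocleVector k l s)
    (h' : ∀ a : QuiverAlgebra k, ∃ b : QuiverAlgebra k, gen k (.e l) • a • f = b • s)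
    (hsf : ∃ b : QuiverAlgebra k, s = b • f) :
    ∃ m : properCostandard (inj k) l, costandardIncl k l (properCostandardIncl k l m) = f := by
  let f' : costandard (inj k) l := ⟨f, mem_reject_directSum.2 h⟩
  obtain ⟨b₀, rfl⟩ := hsf
  have hs' : IsSocleVector k l (b₀ • f') := by
    refine ⟨fun h => hs.ne_zero ?_, ?_, ?_, ?_, ?_, ?_⟩
    · exact congrArg (costandardIncl k l) h
    all_goals
      apply costandardIncl_injective l
      first
      | exact hs.e_smul
      | exact hs.α_smul
      | exact hs.β_smul
      | exact hs.x_smul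
      | exact hs.y_smul
  refine ⟨⟨f', (mem_properCostandard f').2 fun a => ?_⟩, rfl⟩
  obtain ⟨b, hb⟩ := h' a
  have : gen k (.e l) • a • f' = b • b₀ • f' := costandardIncl_injective l hb
  rw [this]
  exact hs'.smul_mem_socle b

lemma exists_properCostandard₀ : ∃ s : properCostandard (inj k) 0, IsSocleVector k 0 s ∧
    Submodule.span (QuiverAlgebra k) {s} = ⊤ := by
  have hs := isSocleVector_coordForm (k := k) 0
  obtain ⟨s, hs'⟩ := exists_properCostandard _ (fun j hj a => by
      rw [hs.smul_eq, smul_smul, ← Algebra.commutes, mul_smul,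
        gen_smul_eq_zero hs.e_smul (by simpa using hj.ne'), smul_zero])
    hs (fun a => ⟨gen k (.e 0) * a, (mul_smul _ _ _).symm⟩) ⟨1, (one_smul _ _).symm⟩
  have hinj : Function.Injective ((costandardIncl k 0).comp (properCostandardIncl k 0)) :=
    (costandardIncl_injective 0).comp (properCostandardIncl_injective 0)
  have hz (g : Gen) (hg : gen k g • coordForm k 0 0 = 0) : gen k g • s = 0 := hinj (by
    rw [map_smul, LinearMap.comp_apply, hs', map_zero]
    exact hg)
  refine ⟨s, ⟨fun h => hs.ne_zero ?_, hinj ?_, hz _ hs.α_smul, hz _ hs.β_smul, hz _ hs.x_smul,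
    hz _ hs.y_smul⟩, ?_⟩
  · rw [← hs', h, map_zero, map_zero]
  · rw [map_smul, LinearMap.comp_apply, hs']
    exact hs.e_smul
  refine eq_top_iff.2 fun m _ => ?_
  -- `e₁ m` vanishes by the definition of `∇(0)`, and `e₀ m` lies in the socle
  have h1 : gen k (.e 1) • m = 0 := hinj (by
    have := mem_reject_directSum.1 (properCostandardIncl k 0 m).2 1 (by decide) 1
    rw [one_smul] at this
    rw [map_smul, map_zero]
    exact this)
  have h0 : gen k (.e 0) • m = m := by simpa [h1] using e_smul_add k m
  have := eq_smul_coordForm (f := costandardIncl k 0 (properCostandardIncl k 0 m)) fun g hg => by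
    rw [← map_smul, ← map_smul]
    have := gen_smul_e_smul_properCostandard m 1 hg
    rw [one_smul, h0] at this
    rw [this, map_zero, map_zero]
  refine Submodule.mem_span_singleton.2 ⟨algebraMap k _ (dualEquiv (proj k 0)
    (costandardIncl k 0 (properCostandardIncl k 0 m)) (projGen k 0)), hinj ?_⟩
  rw [map_smul, LinearMap.comp_apply, hs', algebraMap_smul, LinearMap.comp_apply]
  exact this.symm

lemma exists_properCostandard₁ : ∃ s : properCostandard (inj k) 1, gen k (.e 0) • s = s ∧
    gen k .x • s = 0 ∧ gen k .α • s ≠ 0 ∧ gen k .y • gen k .α • s = 0 ∧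
      gen k .β • gen k .α • s = 0 ∧ Submodule.span (QuiverAlgebra k) {s} = ⊤ := by
  have hs := isSocleVector_coordForm (k := k) 1
  have hα : gen k .α • coordForm k 1 8 = coordForm k 1 6 := gen_smul_coordForm _ _ _
  have he : gen k (.e 0) • coordForm k 1 8 = coordForm k 1 8 := gen_smul_coordForm _ _ _
  have hx : gen k .x • coordForm k 1 8 = 0 := gen_smul_coordForm _ _ _
  obtain ⟨s, hs'⟩ := exists_properCostandard (coordForm k 1 8) (fun j hj => (not_one_lt hj).elim)
    hs (fun a => by
      refine ⟨algebraMap k _ (coeff a 2), ?_⟩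
      have h1 := hs.y_smul
      have h2 := hs.β_smul
      have h3 := hs.e_smul
      have h4 : gen k (.e 1) • coordForm k 1 8 = 0 := gen_smul_coordForm _ _ _
      simp only [Matrix.cons_val_one, Matrix.cons_val_fin_one] at h1 h2 h3 ⊢
      rw [smul_eq_coeff₀ a he, algebraMap_smul, hα, h1, h2, hx]
      simp [h3, h4])
    ⟨gen k .α, hα.symm⟩
  have hinj : Function.Injective ((costandardIncl k 1).comp (properCostandardIncl k 1)) :=
    (costandardIncl_injective 1).comp (properCostandardIncl_injective 1)
  have hz {a : QuiverAlgebra k} : a • s = 0 ↔ a • coordForm k 1 8 = 0 := by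
    rw [← hinj.eq_iff, map_smul, LinearMap.comp_apply, hs', map_zero]
  refine ⟨s, hinj ?_, hz.2 hx, fun h => hs.ne_zero ?_, ?_, ?_, ?_⟩
  · rw [map_smul, LinearMap.comp_apply, hs', he]
  · have := hz.1 h
    rwa [hα] at this
  · rw [smul_smul, hz, ← smul_smul, hα]
    exact hs.y_smul
  · rw [smul_smul, hz, ← smul_smul, hα]
    exact hs.β_smul
  refine eq_top_iff.2 fun m _ => ?_
  set f := costandardIncl k 1 (properCostandardIncl k 1 m) with hf
  have harrow (a : QuiverAlgebra k) (g : Gen) (hg : ∀ j, g ≠ .e j) :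
      gen k g • gen k (.e 1) • a • f = 0 := by
    rw [hf, ← map_smul, ← map_smul, ← map_smul, ← map_smul, ← map_smul, ← map_smul,
      gen_smul_e_smul_properCostandard m a hg, map_zero, map_zero]
  have h1 : gen k (.e 1) • f = dualEquiv (proj k 1) (gen k (.e 1) • f) (projGen k 1) •
      coordForm k 1 6 :=
    eq_smul_coordForm fun g hg => by simpa using harrow 1 g hg
  have h0 : gen k (.e 0) • f = dualEquiv (proj k 1) f (gen k .β • projGen k 1) •
      coordForm k 1 8 := by
    refine inj_ext fun a => ?_
    have hy : dualEquiv (proj k 1) f (gen k .β • gen k .y • projGen k 1) = 0 := by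
      rw [dualEquiv_apply_gen_smul, dualEquiv_apply_gen_smul]
      have := harrow (gen k .α) .y (by simp)
      simp only [e_smul_gen_smul, Gen.tgt, if_true] at this
      simp [Gen.swap, this]
    have hz : gen k (.e 0) • projGen k 1 = 0 := by
      rw [← e_smul_projGen, e_smul_gen_smul]
      simp
    rw [dualEquiv_gen_smul, Gen.swap, map_smul (dualEquiv (proj k 1)), LinearMap.smul_apply,
      coordForm_apply, map_smul (projIncl k 1), projIncl_projGen, smul_eq_coeff₁ a
      (e_smul_projGen 1)]
    have hc : coeff (a • gen k (.e 1)) 8 = coeff a 8 := by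
      have h : coeff (a • gen k (.e 1)) = a • gen k (.e 1) • unit k := mul_smul a _ (unit k)
      rw [h, smul_eq_coeff₁ a (by simp)]
      simp [MonomialRep.add_apply, MonomialRep.smul_apply, gen_smul_apply, pre, unit]
    rw [hc]
    simp [smul_add, hz, hy, mul_comm]
  refine Submodule.mem_span_singleton.2
    ⟨algebraMap k _ (dualEquiv (proj k 1) f (gen k .β • projGen k 1)) +
      algebraMap k _ (dualEquiv (proj k 1) (gen k (.e 1) • f) (projGen k 1)) * gen k .α, hinj ?_⟩
  rw [map_smul, LinearMap.comp_apply, hs', LinearMap.comp_apply, ← hf, add_smul, mul_smul, hα,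
    algebraMap_smul, algebraMap_smul, ← h0, ← h1, e_smul_add]

end Costandard

/-! ### Proper costandard filtrations -/

section Filtered

lemma isAlphaSurjective_properCostandard (l : Fin 2) :
    IsAlphaSurjective k (properCostandard (inj k) l) := by
  intro v hv
  fin_cases l
  · obtain ⟨s, hs, h⟩ := exists_properCostandard₀ (k := k)
    obtain ⟨a, rfl⟩ := Submodule.mem_span_singleton.1 (h.ge (Submodule.mem_top (x := v)))
    refine ⟨0, ?_⟩
    rw [smul_zero, ← hv, hs.smul_eq, smul_smul, ← Algebra.commutes, mul_smul,
      gen_smul_eq_zero hs.e_smul (by simp), smul_zero]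
  · obtain ⟨s, he, hx, -, hy, hβ, h⟩ := exists_properCostandard₁ (k := k)
    obtain ⟨a, rfl⟩ := Submodule.mem_span_singleton.1 (h.ge (Submodule.mem_top (x := v)))
    refine ⟨coeff a 2 • s, ?_⟩
    have h1 : gen k (.e 1) • s = 0 := gen_smul_eq_zero he (by simp)
    rw [← hv, smul_eq_coeff₀ a he]
    simp [hx, hy, hβ, h1]

lemma IsAlphaSurjective.congr {M N : Type*} [AddCommGroup M] [Module (QuiverAlgebra k) M]
    [AddCommGroup N] [Module (QuiverAlgebra k) N] (e : M ≃ₗ[QuiverAlgebra k] N)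
    (hM : IsAlphaSurjective k M) : IsAlphaSurjective k N :=
  hM.of_surjective (g := e.toLinearMap) e.surjective

theorem IsFiltered.isAlphaSurjective {M : ModuleCat.{u} (QuiverAlgebra k)}
    (h : IsFiltered (properCostandard (inj k)) M) : IsAlphaSurjective k M :=
  h.induction (C := fun M => IsAlphaSurjective k M) (fun _ _ e h => h.congr e)
    (fun _ _ _ _ => ⟨0, Subsingleton.elim _ _⟩)
    fun _ N l e h => IsAlphaSurjective.of_exact N.injective_subtype (LinearMap.exact_subtype_mkQ N)
      N.mkQ_surjective h ((isAlphaSurjective_properCostandard l).congr e.symm)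

theorem IsAlphaSurjective.isFiltered {M : ModuleCat.{u} (QuiverAlgebra k)}
    [Module.Finite (QuiverAlgebra k) M] (hM : IsAlphaSurjective k M) :
    IsFiltered (properCostandard (inj k)) M := by
  refine isFiltered_of_step (C := fun M => IsAlphaSurjective k M) (fun _ _ e h => h.congr e) ?_ hM
  intro M _ hM
  have hquot (N : Submodule (QuiverAlgebra k) M) :
      IsAlphaSurjective k (ModuleCat.of (QuiverAlgebra k) (M ⧸ N)) :=
    hM.of_surjective N.mkQ_surjective
  by_cases h0 : ∃ m : M, IsSocleVector k 0 m
  · obtain ⟨m, hm⟩ := h0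
    obtain ⟨s, hs, h⟩ := exists_properCostandard₀ (k := k)
    exact ⟨_, 0, span_singleton_ne_bot hm.ne_zero, nonempty_span_equiv m h fun a =>
      (hm.smul_eq_zero_iff a).trans (hs.smul_eq_zero_iff a).symm, hquot _⟩
  -- otherwise `α` is injective on `e₀ M`, so that `x` and `β` vanish
  have hα (m : M) (he : gen k (.e 0) • m = m) (h : gen k .α • m = 0) : m = 0 := by
    have key (m : M) (he : gen k (.e 0) • m = m) (h : gen k .α • m = 0) (hx : gen k .x • m = 0) :
        m = 0 := by
      by_contra hne
      exact h0 ⟨m, hne, he, h, gen_smul_eq_zero he (by simp), hx, gen_smul_eq_zero he (by simp)⟩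
    exact key m he h (key _ (by simp) (by simp) (by simp))
  obtain ⟨i, v, hv⟩ := exists_isSocleVector k M
  obtain rfl : i = 1 := by
    by_contra hi
    obtain rfl : i = 0 := by omega
    exact h0 ⟨v, hv⟩
  obtain ⟨u, rfl⟩ := hM v hv.e_smul
  have he : gen k (.e 0) • gen k (.e 0) • u = gen k (.e 0) • u := by simp
  have hαu : gen k .α • gen k (.e 0) • u = gen k .α • u := by simp
  have hx : gen k .x • gen k (.e 0) • u = 0 := hα _ (by simp) (by simp)
  obtain ⟨s, hs1, hs2, hs3, hs4, hs5, h⟩ := exists_properCostandard₁ (k := k)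
  refine ⟨Submodule.span (QuiverAlgebra k) {gen k (.e 0) • u}, 1,
    span_singleton_ne_bot fun h => hv.ne_zero ?_,
    nonempty_span_equiv _ h fun a => (smul_eq_zero_iff_properCostandard₁ he hx
      (by rw [hαu]; exact hv.ne_zero) (by rw [hαu]; exact hv.y_smul)
      (by rw [hαu]; exact hv.β_smul) a).trans
      (smul_eq_zero_iff_properCostandard₁ hs1 hs2 hs3 hs4 hs5 a).symm, hquot _⟩
  rw [← hαu, h, smul_zero]

end Filtered

/-! ### Simple modules, projective covers and injective envelopes -/

section Labelling

/-- The simple modules. -/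
def simpleModule (k : Type u) [Field k] (i : Fin 2) : ModuleCat.{u} (QuiverAlgebra k) :=
  ModuleCat.of _ ((simple i).Carrier k)

lemma eq_of_simple_equiv {l m : Fin 2}
    (e : (simple l).Carrier k ≃ₗ[QuiverAlgebra k] (simple m).Carrier k) : l = m := by
  by_contra hlm
  have hs := isSocleVector_simple (k := k) l
  have hs' := isSocleVector_simple (k := k) m
  obtain ⟨a, ha⟩ := Submodule.mem_span_singleton.1
    ((span_simple (k := k) m).ge (Submodule.mem_top (x := e ((simple l).ofFun fun _ => (1 : k)))))
  have h0 : gen k (.e l) • e ((simple l).ofFun fun _ => (1 : k)) = 0 := by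
    rw [← ha, hs'.smul_eq, smul_smul, ← Algebra.commutes, mul_smul,
      gen_smul_eq_zero hs'.e_smul (by simpa using hlm), smul_zero]
  rw [← map_smul, hs.e_smul] at h0
  exact hs.ne_zero (e.map_eq_zero_iff.1 h0)

lemma isProjectiveCover_proj (i : Fin 2) :
    IsProjectiveCover (proj k i) (simpleModule k i) := by
  have hs := isSocleVector_simple (k := k) i
  refine ⟨projective_proj i, projLift i ((simple i).ofFun fun _ => (1 : k)), ?_, ?_⟩
  · intro m
    obtain ⟨a, rfl⟩ := Submodule.mem_span_singleton.1
      ((span_simple i).ge (Submodule.mem_top (x := m)))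
    exact ⟨a • projGen k i, projLift_smul_projGen hs.e_smul a⟩
  intro N hN
  by_contra hne
  obtain ⟨C, hC, hNC⟩ := (eq_top_or_exists_le_coatom N).resolve_left hne
  refine hC.1 (eq_top_iff.2 (hN.ge.trans (sup_le hNC fun p hp => ?_)))
  have hp0 : idemCoeff i (projIncl k i p) = 0 := by
    rw [← hs.smul_eq_zero_iff, ← projLift_smul_projGen hs.e_smul, projIncl_smul_projGen]
    exact hp
  have hmem (g : Gen) (hg : ∀ j, g ≠ .e j) (q : proj k i) : gen k g • q ∈ C :=
    (sInf_le hC : Module.jacobson (QuiverAlgebra k) (proj k i) ≤ C) (gen_smul_mem_jacobson hg q)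
  have hmem' (c : k) {q : proj k i} (hq : q ∈ C) : c • q ∈ C :=
    Submodule.smul_of_tower_mem C c hq
  rw [← projIncl_smul_projGen p]
  obtain rfl | rfl : i = 0 ∨ i = 1 := by omega
  · rw [smul_eq_coeff₀ (projIncl k _ p) (e_smul_projGen 0)]
    rw [show coeff (projIncl k 0 p) 0 = 0 from hp0, zero_smul, zero_add]
    refine add_mem (add_mem (add_mem (add_mem ?_ ?_) ?_) ?_) ?_ <;>
      exact hmem' _ (hmem _ (by simp) _)
  · rw [smul_eq_coeff₁ (projIncl k _ p) (e_smul_projGen 1)]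
    rw [show coeff (projIncl k 1 p) 6 = 0 from hp0, zero_smul, zero_add]
    refine add_mem (add_mem ?_ ?_) ?_ <;> exact hmem' _ (hmem _ (by simp) _)

lemma isInjectiveEnvelope_inj (i : Fin 2) :
    IsInjectiveEnvelope (inj k i) (simpleModule k i) := by
  have hs := isSocleVector_coordForm (k := k) i
  obtain ⟨e⟩ := nonempty_span_equiv (coordForm k i (![0, 6] i)) (span_simple i) fun a =>
    (hs.smul_eq_zero_iff a).trans ((isSocleVector_simple i).smul_eq_zero_iff a).symm
  refine ⟨injective_inj i, (Submodule.subtype _).comp e.symm.toLinearMap,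
    (Submodule.injective_subtype _).comp e.symm.injective, fun N hN => ?_⟩
  by_contra hne
  have : Nontrivial N := Submodule.nontrivial_iff_ne_bot.2 hne
  obtain ⟨j, m, hm⟩ := exists_isSocleVector k N
  have hm' : m.1 = _ := eq_smul_coordForm fun g hg => congrArg Subtype.val (hm.gen_smul hg)
  have hmem : m.1 ∈ N ⊓ LinearMap.range ((Submodule.subtype _).comp e.symm.toLinearMap) := by
    refine ⟨m.2, ?_⟩
    rw [LinearMap.range_comp, LinearEquiv.range, Submodule.map_top, Submodule.range_subtype, hm']
    exact Submodule.smul_of_tower_mem _ _ (Submodule.mem_span_singleton_self _)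
  exact hm.ne_zero (Subtype.ext (hN.le hmem))

theorem isLabelling : IsLabelling (simpleModule k) (proj k) (inj k) where
  simple i := inferInstanceAs (IsSimpleModule (QuiverAlgebra k) ((simple i).Carrier k))
  distinct l m := by
    rintro ⟨e⟩
    exact eq_of_simple_equiv e
  exhaustive S hS := by
    obtain ⟨i, m, hm, hs⟩ := exists_isSocleVector_of_isSimpleModule (k := k) (M := S)
    obtain ⟨e⟩ := nonempty_span_equiv m (span_simple i) fun a =>
      (hm.smul_eq_zero_iff a).trans ((isSocleVector_simple i).smul_eq_zero_iff a).symm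
    rw [hs] at e
    exact ⟨i, ⟨Submodule.topEquiv.symm.trans e⟩⟩
  projectiveCover := isProjectiveCover_proj
  injectiveEnvelope := isInjectiveEnvelope_inj

end Labelling

/-! ### Short exact sequences of modules -/

section ShortExact

variable {A : Type u} [Ring A] {K X M : ModuleCat.{u} A} {f : K →ₗ[A] X} {g : X →ₗ[A] M}
  (hf : Function.Injective f) (hfg : Function.Exact f g) (hg : Function.Surjective g)

include hf hfg hg

lemma shortExact_of_exact :
    (ModuleCat.shortComplexOfCompEqZero f g hfg.linearMap_comp_eq_zero).ShortExact :=
  ModuleCat.shortComplex_shortExact _ hfg hf hg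

lemma hasProjectiveDimensionLT_middle {n : ℕ} (hK : HasProjectiveDimensionLT K n)
    (hM : HasProjectiveDimensionLT M n) : HasProjectiveDimensionLT X n :=
  (shortExact_of_exact hf hfg hg).hasProjectiveDimensionLT_X₂ n hK hM

lemma hasProjectiveDimensionLT_right {n : ℕ} (hK : HasProjectiveDimensionLT K n)
    (hX : HasProjectiveDimensionLT X (n + 1)) : HasProjectiveDimensionLT M (n + 1) :=
  (shortExact_of_exact hf hfg hg).hasProjectiveDimensionLT_X₃ n hK hX

lemma hasProjectiveDimensionLT_left {n : ℕ} (hX : HasProjectiveDimensionLT X n)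
    (hM : HasProjectiveDimensionLT M (n + 1)) : HasProjectiveDimensionLT K n :=
  (shortExact_of_exact hf hfg hg).hasProjectiveDimensionLT_X₁ n hX hM

lemma subsingleton_ext_one_middle {Y : ModuleCat.{u} A}
    (hK : Subsingleton (Abelian.Ext.{u} K Y 1)) (hM : Subsingleton (Abelian.Ext.{u} M Y 1)) :
    Subsingleton (Abelian.Ext.{u} X Y 1) := by
  refine subsingleton_of_forall_eq 0 fun x => ?_
  obtain ⟨y, rfl⟩ := Abelian.Ext.contravariant_sequence_exact₂ (shortExact_of_exact hf hfg hg) Y x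
    (hK.elim _ _)
  rw [hM.elim y 0, Abelian.Ext.comp_zero]

/-- `Ext¹` vanishes if the homomorphisms from the kernel of a projective presentation extend. -/
lemma subsingleton_ext_one_of_extend [Module.Projective A X] {Y : ModuleCat.{u} A}
    (h : ∀ φ : K →ₗ[A] Y, ∃ ψ : X →ₗ[A] Y, ψ ∘ₗ f = φ) :
    Subsingleton (Abelian.Ext.{u} M Y 1) := by
  have : CategoryTheory.Projective X := (IsProjective.iff_projective X).1 inferInstance
  refine subsingleton_of_forall_eq 0 fun x => ?_
  have hS := shortExact_of_exact hf hfg hg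
  obtain ⟨y, rfl⟩ := Abelian.Ext.contravariant_sequence_exact₃ hS Y x
    (Abelian.Ext.eq_zero_of_projective (P := X) _) (add_zero 1)
  obtain ⟨φ, rfl⟩ := (Abelian.Ext.mk₀_bijective _ _).2 y
  obtain ⟨ψ, hψ⟩ := h φ.hom
  have : φ = (ModuleCat.shortComplexOfCompEqZero f g hfg.linearMap_comp_eq_zero).f ≫
    ModuleCat.ofHom ψ := ModuleCat.hom_ext hψ.symm
  rw [this, ← Abelian.Ext.mk₀_comp_mk₀, hS.extClass_comp_assoc]

lemma exists_lift_of_subsingleton_ext_one {Y : ModuleCat.{u} A}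
    (hY : Subsingleton (Abelian.Ext.{u} Y K 1)) (φ : Y →ₗ[A] M) :
    ∃ ψ : Y →ₗ[A] X, g ∘ₗ ψ = φ := by
  obtain ⟨x, hx⟩ := Abelian.Ext.covariant_sequence_exact₃ Y (shortExact_of_exact hf hfg hg)
    (Abelian.Ext.mk₀ (ModuleCat.ofHom φ)) (zero_add 1) (hY.elim _ _)
  obtain ⟨ψ, rfl⟩ := (Abelian.Ext.mk₀_bijective _ _).2 x
  rw [Abelian.Ext.mk₀_comp_mk₀] at hx
  exact ⟨ψ.hom, congrArg ModuleCat.Hom.hom ((Abelian.Ext.mk₀_bijective _ _).1 hx)⟩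

end ShortExact

section Iso

variable {A : Type u} [Ring A] {M N : ModuleCat.{u} A}

lemma hasProjectiveDimensionLT_of_equiv (e : M ≃ₗ[A] N) {n : ℕ}
    (h : HasProjectiveDimensionLT M n) : HasProjectiveDimensionLT N n :=
  hasProjectiveDimensionLT_of_iso e.toModuleIso n

lemma hasProjectiveDimensionLT_of_subsingleton [Subsingleton M] (n : ℕ) :
    HasProjectiveDimensionLT M n := by
  have := (ModuleCat.isZero_of_subsingleton M).hasProjectiveDimensionLT_zero
  exact hasProjectiveDimensionLT_of_ge M 0 n n.zero_le

lemma hasProjectiveDimensionLT_of_projective [Module.Projective A M] (n : ℕ) :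
    HasProjectiveDimensionLT M (n + 1) := by
  have : CategoryTheory.Projective M := (IsProjective.iff_projective M).1 inferInstance
  exact hasProjectiveDimensionLT_of_ge M 1 (n + 1) (by omega)

lemma projective_of_hasProjectiveDimensionLT_one (h : HasProjectiveDimensionLT M 1) :
    Module.Projective A M :=
  (IsProjective.iff_projective M).2 (projective_iff_hasProjectiveDimensionLT_one.2 h)

lemma subsingleton_ext_of_equiv {Y : ModuleCat.{u} A} {n : ℕ} (e : M ≃ₗ[A] N)
    (h : Subsingleton (Abelian.Ext.{u} M Y n)) : Subsingleton (Abelian.Ext.{u} N Y n) := by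
  refine subsingleton_of_forall_eq 0 fun x => ?_
  have : x = (Abelian.Ext.mk₀ e.toModuleIso.inv).comp
      ((Abelian.Ext.mk₀ e.toModuleIso.hom).comp x (zero_add n)) (zero_add n) := by
    rw [Abelian.Ext.mk₀_comp_mk₀_assoc, Iso.inv_hom_id, Abelian.Ext.mk₀_id_comp]
  rw [this, h.elim (Abelian.Ext.comp _ x _) 0, Abelian.Ext.comp_zero]

lemma subsingleton_ext_of_projective [Module.Projective A M] (Y : ModuleCat.{u} A) (n : ℕ) :
    Subsingleton (Abelian.Ext.{u} M Y (n + 1)) := by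
  have : CategoryTheory.Projective M := (IsProjective.iff_projective M).1 inferInstance
  exact Abelian.Ext.subsingleton_of_projective M Y n

end Iso

/-! ### Projective dimensions -/

section ProjectiveDimension

/-- Right multiplication by `α`, an embedding `A e_1 → A e_0` with cokernel `Δ(0)`. -/
def αMap (k : Type u) [Field k] : proj k 1 →ₗ[QuiverAlgebra k] proj k 0 :=
  projLift 1 (gen k .α • projGen k 0)

/-- The projection of `A e_0` onto `Δ(0)`. -/
def tilt₁Map (k : Type u) [Field k] : proj k 0 →ₗ[QuiverAlgebra k] tilt₁.Carrier k :=
  projLift 0 (tilt₁Gen k)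

lemma αMap_smul_projGen (a : QuiverAlgebra k) :
    αMap k (a • projGen k 1) = a • gen k .α • projGen k 0 :=
  projLift_smul_projGen (by simp) a

lemma tilt₁Map_smul_projGen (a : QuiverAlgebra k) :
    tilt₁Map k (a • projGen k 0) = a • tilt₁Gen k :=
  projLift_smul_projGen e_smul_tilt₁Gen a

lemma y_smul_α_smul_projGen : gen k .y • gen k .α • projGen k 0 ≠ 0 := by
  intro h
  have h := congrArg (fun p => projIncl k 0 p • unit k) h
  simp only [map_smul, projIncl_projGen, map_zero, smul_assoc, zero_smul] at h
  have h' : gen k .y • gen k .α • unit k = 0 := by simpa using h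
  simpa [gen_smul_apply, pre, unit] using coord_eq_zero h' 3

lemma αMap_injective : Function.Injective (αMap k) := by
  refine (injective_iff_map_eq_zero _).2 fun p hp => ?_
  rw [← projIncl_smul_projGen p, αMap_smul_projGen, smul_eq_zero_iff_standard₁ (by simp)
    (isDeltaExact_proj 0).β_injective y_smul_α_smul_projGen] at hp
  rw [← projIncl_smul_projGen p]
  exact (smul_eq_zero_iff_standard₁ (e_smul_projGen 1) (isDeltaExact_proj 1).β_injective
    y_smul_projGen _).2 hp

lemma tilt₁Map_surjective : Function.Surjective (tilt₁Map k) := by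
  intro m
  obtain ⟨a, rfl⟩ := Submodule.mem_span_singleton.1
    (span_tilt₁Gen.ge (Submodule.mem_top (x := m)))
  exact ⟨a • projGen k 0, tilt₁Map_smul_projGen a⟩

lemma exact_αMap_tilt₁Map : Function.Exact (αMap k) (tilt₁Map k) := by
  intro p
  rw [← projIncl_smul_projGen p]
  constructor
  · intro h
    rw [tilt₁Map_smul_projGen, smul_eq_zero_iff_standard₀ e_smul_tilt₁Gen α_smul_tilt₁Gen
      x_smul_tilt₁Gen] at h
    set a := projIncl k 0 p
    refine ⟨(algebraMap k _ (coeff a 2) + algebraMap k _ (coeff a 3) * gen k .y +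
      algebraMap k _ (coeff a 4) * gen k .β + algebraMap k _ (coeff a 5) * (gen k .β * gen k .y)) •
        projGen k 1, ?_⟩
    rw [αMap_smul_projGen, smul_eq_coeff₀ a (e_smul_projGen 0), h.1, h.2]
    simp only [add_smul, mul_smul, algebraMap_smul, zero_smul, zero_add]
  · rintro ⟨q, hq⟩
    have h (a : QuiverAlgebra k) : tilt₁Map k (a • gen k .α • projGen k 0) = 0 := by
      rw [smul_smul, tilt₁Map_smul_projGen, mul_smul, α_smul_tilt₁Gen, smul_zero]
    rw [← hq, ← projIncl_smul_projGen q, αMap_smul_projGen, h]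

/-- The module `tilt₁` as an object of the category of modules. -/
abbrev tiltModule₁ (k : Type u) [Field k] : ModuleCat.{u} (QuiverAlgebra k) :=
  ModuleCat.of _ (tilt₁.Carrier k)

lemma hasProjectiveDimensionLT_tilt₁ : HasProjectiveDimensionLT (tiltModule₁ k) 2 :=
  hasProjectiveDimensionLT_right (M := tiltModule₁ k) αMap_injective exact_αMap_tilt₁Map
    tilt₁Map_surjective (hasProjectiveDimensionLT_of_projective 0)
    (hasProjectiveDimensionLT_of_projective 1)

lemma hasProjectiveDimensionLT_standard (l : Fin 2) :
    HasProjectiveDimensionLT (standard (proj k) l) 2 := by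
  fin_cases l
  · obtain ⟨e⟩ := nonempty_standard₀ (k := k)
    exact hasProjectiveDimensionLT_of_equiv (M := tiltModule₁ k) e hasProjectiveDimensionLT_tilt₁
  · obtain ⟨e⟩ := nonempty_standard₁ (k := k)
    exact hasProjectiveDimensionLT_of_equiv e (hasProjectiveDimensionLT_of_projective 1)

theorem IsFiltered.hasProjectiveDimensionLT {M : ModuleCat.{u} (QuiverAlgebra k)}
    (h : IsFiltered (standard (proj k)) M) : HasProjectiveDimensionLT M 2 :=
  h.induction (C := fun M : ModuleCat.{u} (QuiverAlgebra k) => HasProjectiveDimensionLT M 2)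
    (fun _ _ e h => hasProjectiveDimensionLT_of_equiv e h)
    (fun _ _ => hasProjectiveDimensionLT_of_subsingleton 2)
    fun _ N l e h => hasProjectiveDimensionLT_middle (K := ModuleCat.of _ N)
      (M := ModuleCat.of _ (_ ⧸ N)) N.injective_subtype
      (LinearMap.exact_subtype_mkQ N) N.mkQ_surjective h
      (hasProjectiveDimensionLT_of_equiv e.symm (hasProjectiveDimensionLT_standard l))

/-- A vector of a projective module which is annihilated by `α` is annihilated by `x`. -/
lemma x_smul_eq_zero_of_projective {M : Type*} [AddCommGroup M] [Module (QuiverAlgebra k) M]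
    [Module.Projective (QuiverAlgebra k) M] {m : M} (he : gen k (.e 0) • m = m)
    (hα : gen k .α • m = 0) : gen k .x • m = 0 := by
  have key (v : QuiverAlgebra k) (he : gen k (.e 0) • v = v) (hα : gen k .α • v = 0) :
      gen k .x • v = 0 := by
    apply (equivRegular k).injective
    rw [map_smul, map_zero]
    have hα := coord_eq_zero (show gen k .α • equivRegular k v = 0 by rw [← map_smul, hα, map_zero])
    have := hα 2
    funext i
    rw [gen_smul_apply]
    fin_cases i <;> simp_all [pre]
  obtain ⟨s, hs⟩ := (Module.projective_def' (R := QuiverAlgebra k) (P := M)).1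
    inferInstance
  have hs' (m : M) : Finsupp.linearCombination (QuiverAlgebra k) id (s m) = m :=
    LinearMap.congr_fun hs m
  rw [← hs' (gen k .x • m), map_smul]
  have : gen k .x • s m = 0 := by
    ext n
    exact key (s m n) (by rw [← Finsupp.smul_apply, ← map_smul, he])
      (by rw [← Finsupp.smul_apply, ← map_smul, hα, map_zero]; rfl)
  rw [this, map_zero]

lemma not_projective_tilt₁ : ¬ Module.Projective (QuiverAlgebra k) (tilt₁.Carrier k) := fun _ =>
  x_smul_tilt₁Gen (k := k) (x_smul_eq_zero_of_projective e_smul_tilt₁Gen α_smul_tilt₁Gen)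

lemma projectiveDimension_tilt₁ : projectiveDimension (tiltModule₁ k) = 1 := by
  refine le_antisymm ((projectiveDimension_le_iff _ 1).2 hasProjectiveDimensionLT_tilt₁)
    ((projectiveDimension_ge_iff (tiltModule₁ k) 1).2 fun h => ?_)
  exact not_projective_tilt₁ (projective_of_hasProjectiveDimensionLT_one h)

/-- Finitely generated modules of finite projective dimension are Δ-exact. -/
lemma isDeltaExact_of_hasProjectiveDimensionLT (n : ℕ) :
    ∀ (M : ModuleCat.{u} (QuiverAlgebra k)) [Module.Finite (QuiverAlgebra k) M],
      HasProjectiveDimensionLT M (n + 1) → IsDeltaExact k M := by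
  induction n with
  | zero =>
    intro M _ h
    have := projective_of_hasProjectiveDimensionLT_one h
    obtain ⟨m, π, hπ⟩ := Module.Finite.exists_fin' (QuiverAlgebra k) M
    obtain ⟨s, hs⟩ := Module.projective_lifting_property π LinearMap.id hπ
    exact (IsDeltaExact.pi fun _ => isDeltaExact_self).of_retract s π (LinearMap.congr_fun hs)
  | succ n ih =>
    intro M _ h
    obtain ⟨m, π, hπ⟩ := Module.Finite.exists_fin' (QuiverAlgebra k) M
    have hex : Function.Exact (LinearMap.ker π).subtype π := LinearMap.exact_subtype_ker_map π
    exact IsDeltaExact.of_cokernel (LinearMap.ker π).injective_subtype hex hπ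
      (ih (ModuleCat.of _ (LinearMap.ker π)) (hasProjectiveDimensionLT_left
        (K := ModuleCat.of _ (LinearMap.ker π)) (X := ModuleCat.of _ (Fin m → QuiverAlgebra k))
        (LinearMap.ker π).injective_subtype hex hπ (hasProjectiveDimensionLT_of_projective n) h))
      (.pi fun _ => isDeltaExact_self)

theorem finitisticDim_eq_one : finitisticDim (QuiverAlgebra k) = 1 := by
  refine le_antisymm (iSup_le fun ⟨M, hM, h⟩ => ?_) ?_
  · obtain ⟨n, hn⟩ := (projectiveDimension_ne_top_iff M).1 h.ne
    exact (projectiveDimension_le_iff M 1).2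
      (isDeltaExact_of_hasProjectiveDimensionLT n M hn).isFiltered.hasProjectiveDimensionLT
  · rw [← projectiveDimension_tilt₁ (k := k)]
    refine le_iSup (fun M : {M : ModuleCat.{u} (QuiverAlgebra k) //
      Module.Finite (QuiverAlgebra k) M ∧ projectiveDimension M < ⊤} => projectiveDimension M.1)
      ⟨tiltModule₁ k, ⟨⟨{tilt₁Gen k}, by simpa using span_tilt₁Gen⟩, ?_⟩⟩
    rw [projectiveDimension_tilt₁]
    exact WithBot.coe_lt_coe.2 (ENat.natCast_lt_top 1)

/-- Modules with a finite resolution by modules with a standard filtration have themselves such a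
filtration. -/
lemma HasResolution.isFiltered {n : ℕ} {M : ModuleCat.{u} (QuiverAlgebra k)}
    (h : HasResolution (IsFiltered (standard (proj k))) n M) :
    IsFiltered (standard (proj k)) M := by
  have key : Module.Finite (QuiverAlgebra k) M ∧ IsDeltaExact k M := by
    induction h with
    | zero M X hX e =>
      have := hX.finite finite_standard
      exact ⟨Module.Finite.equiv e, hX.isDeltaExact.congr e⟩
    | succ n K X M hX f g hf hfg hg _ ih =>
      have := hX.finite finite_standard
      exact ⟨Module.Finite.of_surjective g hg, .of_cokernel hf hfg hg ih.2 hX.isDeltaExact⟩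
  have := key.1
  exact key.2.isFiltered

theorem finitisticFiltrationDim_eq_zero :
    finitisticFiltrationDim (standard (proj k)) = 0 := by
  refine le_antisymm (iSup_le fun ⟨M, hM, h⟩ => ?_) bot_le
  obtain ⟨⟨n, hn⟩, -⟩ := iInf_lt_iff.1 h
  exact iInf_le (fun n : {n : ℕ // HasResolution (IsFiltered (standard (proj k))) n M} =>
    (n.1 : ℕ∞)) ⟨0, .zero M M hn.isFiltered (LinearEquiv.refl _ _)⟩

end ProjectiveDimension

/-! ### Vanishing of extensions -/

section Ext

variable {M N : ModuleCat.{u} (QuiverAlgebra k)}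

lemma subsingleton_ext_one_tilt₁ (hN : IsAlphaSurjective k N) :
    Subsingleton (Abelian.Ext.{u} (tiltModule₁ k) N 1) := by
  refine subsingleton_ext_one_of_extend (M := tiltModule₁ k) αMap_injective exact_αMap_tilt₁Map
    tilt₁Map_surjective fun φ => ?_
  obtain ⟨u, hu⟩ := hN (φ (projGen k 1)) (by rw [← map_smul, e_smul_projGen])
  refine ⟨projLift 0 (gen k (.e 0) • u), LinearMap.ext fun p => ?_⟩
  rw [← projIncl_smul_projGen p, LinearMap.comp_apply, αMap_smul_projGen, map_smul, map_smul,
    projLift_projGen (by simp), map_smul φ, hu]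
  simp

lemma subsingleton_ext_one_standard (hN : IsAlphaSurjective k N) (l : Fin 2) :
    Subsingleton (Abelian.Ext.{u} (standard (proj k) l) N 1) := by
  fin_cases l
  · obtain ⟨e⟩ := nonempty_standard₀ (k := k)
    exact subsingleton_ext_of_equiv (M := tiltModule₁ k) e (subsingleton_ext_one_tilt₁ hN)
  · obtain ⟨e⟩ := nonempty_standard₁ (k := k)
    exact subsingleton_ext_of_equiv e (subsingleton_ext_of_projective N 0)

/-- There are no extensions of modules with a standard filtration by modules with a proper
costandard filtration. -/
theorem IsFiltered.subsingleton_ext_one (h : IsFiltered (standard (proj k)) M)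
    (hN : IsAlphaSurjective k N) : Subsingleton (Abelian.Ext.{u} M N 1) :=
  h.induction (C := fun M => Subsingleton (Abelian.Ext.{u} M N 1))
    (fun _ _ e h => subsingleton_ext_of_equiv e h)
    (fun M _ => by
      have := hasProjectiveDimensionLT_of_subsingleton (M := M) 0
      exact HasProjectiveDimensionLT.subsingleton M 0 1 (by omega) N)
    fun _ N' l e h => subsingleton_ext_one_middle (K := ModuleCat.of _ N')
      (M := ModuleCat.of _ (_ ⧸ N')) N'.injective_subtype
      (LinearMap.exact_subtype_mkQ N') N'.mkQ_surjective h
      (subsingleton_ext_of_equiv e.symm (subsingleton_ext_one_standard hN l))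

theorem IsFiltered.subsingleton_ext (h : IsFiltered (standard (proj k)) M)
    (hN : IsAlphaSurjective k N) {i : ℕ} (hi : 0 < i) : Subsingleton (Abelian.Ext.{u} M N i) := by
  obtain rfl | hi : i = 1 ∨ 2 ≤ i := by omega
  · exact h.subsingleton_ext_one hN
  · have := h.hasProjectiveDimensionLT
    exact HasProjectiveDimensionLT.subsingleton M 2 i hi N

end Ext

/-! ### The characteristic tilting module -/

section Tilting

/-- The module `tilt₂` as an object of the category of modules. -/
abbrev tiltModule₂ (k : Type u) [Field k] : ModuleCat.{u} (QuiverAlgebra k) :=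
  ModuleCat.of _ (tilt₂.Carrier k)

/-- The indecomposable summands of the characteristic tilting module. -/
def tilting (k : Type u) [Field k] : Fin 2 → ModuleCat.{u} (QuiverAlgebra k) :=
  ![tiltModule₁ k, tiltModule₂ k]

lemma isDeltaExact_tilting (l : Fin 2) : IsDeltaExact k (tilting k l) := by
  fin_cases l
  · exact isDeltaExact_tilt₁
  · exact isDeltaExact_tilt₂

lemma isAlphaSurjective_tilting (l : Fin 2) : IsAlphaSurjective k (tilting k l) := by
  fin_cases l
  · exact isAlphaSurjective_tilt₁
  · exact isAlphaSurjective_tilt₂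

instance (V : MonomialRep) : Module.Finite (QuiverAlgebra k) (V.Carrier k) := by
  have : Module.Finite k (V.Carrier k) := inferInstanceAs (Module.Finite k (Fin V.n → k))
  exact Module.Finite.of_restrictScalars_finite k _ _

instance (l : Fin 2) : Module.Finite (QuiverAlgebra k) (tilting k l) := by
  fin_cases l
  · exact inferInstanceAs (Module.Finite (QuiverAlgebra k) (tilt₁.Carrier k))
  · exact inferInstanceAs (Module.Finite (QuiverAlgebra k) (tilt₂.Carrier k))

/-- The characteristic tilting module as a product. -/
def totalEquiv (k : Type u) [Field k] :
    total (tilting k) ≃ₗ[QuiverAlgebra k] ∀ l, tilting k l :=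
  DirectSum.linearEquivFunOnFintype (QuiverAlgebra k) (Fin 2) fun l => tilting k l

lemma isDeltaExact_total : IsDeltaExact k (total (tilting k)) :=
  (IsDeltaExact.pi isDeltaExact_tilting).congr (totalEquiv k).symm

lemma isAlphaSurjective_total : IsAlphaSurjective k (total (tilting k)) :=
  (IsAlphaSurjective.pi isAlphaSurjective_tilting).congr (totalEquiv k).symm

instance finite_total : Module.Finite (QuiverAlgebra k) (total (tilting k)) :=
  Module.Finite.equiv (totalEquiv k).symm

/-- A homomorphism from a summand extends by zero to the characteristic tilting module, where the
value at `t` is attained at a vector with the annihilator of `t`. -/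
lemma exists_total_hom {M : Type u} [AddCommGroup M] [Module (QuiverAlgebra k) M] (l : Fin 2)
    (φ : tilting k l →ₗ[QuiverAlgebra k] M) (t : tilting k l) :
    ∃ (ψ : total (tilting k) →ₗ[QuiverAlgebra k] M) (s : total (tilting k)), ψ s = φ t ∧
      ∀ a : QuiverAlgebra k, a • t = 0 → a • s = 0 := by
  refine ⟨φ.comp ((LinearMap.proj l).comp (totalEquiv k).toLinearMap),
    (totalEquiv k).symm (Pi.single l t), ?_, fun a ha => ?_⟩
  · simp
  · rw [← map_smul, ← Pi.single_smul, ha, Pi.single_zero, map_zero]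

end Tilting

section Homs

variable {M : Type u} [AddCommGroup M] [Module k M] [Module (QuiverAlgebra k) M]
  [IsScalarTower k (QuiverAlgebra k) M]

/-- The homomorphism from `tilt₁` which maps the generator to a given vector. -/
def tilt₁Lift (m : M) (he : gen k (.e 0) • m = m) (hα : gen k .α • m = 0) :
    tilt₁.Carrier k →ₗ[QuiverAlgebra k] M :=
  linearMapOfGen (k := k)
    { toFun := fun w => w 0 • m + w 1 • gen k .x • m
      map_add' := fun v w => by simp only [MonomialRep.add_apply, add_smul]; abel
      map_smul' := fun c v => by simp [MonomialRep.smul_apply, mul_smul] } (by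
    intro g v
    have h1 : gen k (.e 1) • m = 0 := gen_smul_eq_zero he (by simp)
    have h2 : gen k .β • m = 0 := gen_smul_eq_zero he (by simp)
    have h3 : gen k .y • m = 0 := gen_smul_eq_zero he (by simp)
    rcases g with i | _ | _ | _ | _
    · fin_cases i <;> simp [pre, gen_smul_apply, he, h1]
    all_goals simp [pre, gen_smul_apply, hα, h2, h3])

lemma tilt₁Lift_tilt₁Gen (m : M) (he : gen k (.e 0) • m = m) (hα : gen k .α • m = 0) :
    tilt₁Lift m he hα (tilt₁Gen k) = m := by
  have : tilt₁Lift m he hα (tilt₁Gen k) =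
    tilt₁Gen k 0 • m + tilt₁Gen k 1 • gen k .x • m := rfl
  rw [this]
  simp [tilt₁Gen]

/-- The homomorphism from `tilt₂` which maps `u` and `v` to given vectors. -/
def tilt₂Lift (u v : M) (hu : gen k (.e 0) • u = u) (hv : gen k (.e 0) • v = v)
    (h : gen k .α • u = gen k .y • gen k .α • v) : tilt₂.Carrier k →ₗ[QuiverAlgebra k] M :=
  linearMapOfGen (k := k)
    { toFun := fun w => w 0 • u + w 1 • gen k .x • u + w 2 • v + w 3 • gen k .x • v +
        w 4 • gen k .α • v + w 5 • gen k .y • gen k .α • v + w 6 • gen k .β • gen k .α • v +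
        w 7 • gen k .β • gen k .y • gen k .α • v
      map_add' := fun v w => by simp only [MonomialRep.add_apply, add_smul]; abel
      map_smul' := fun c v => by simp [MonomialRep.smul_apply, mul_smul] } (by
    intro g w
    have hu1 : gen k (.e 1) • u = 0 := gen_smul_eq_zero hu (by simp)
    have hu2 : gen k .β • u = 0 := gen_smul_eq_zero hu (by simp)
    have hu3 : gen k .y • u = 0 := gen_smul_eq_zero hu (by simp)
    have hv1 : gen k (.e 1) • v = 0 := gen_smul_eq_zero hv (by simp)
    have hv2 : gen k .β • v = 0 := gen_smul_eq_zero hv (by simp)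
    have hv3 : gen k .y • v = 0 := gen_smul_eq_zero hv (by simp)
    rcases g with i | _ | _ | _ | _
    · fin_cases i <;> simp [pre, gen_smul_apply, hu, hv, hu1, hv1]
    · simp only [LinearMap.coe_mk, AddHom.coe_mk, gen_smul_apply, pre]
      simp [h]
      exact add_comm _ _
    all_goals simp [pre, gen_smul_apply, hu2, hv2, hu3, hv3])

/-- The basis vector `v` of `tilt₂`. -/
def tilt₂Gen (k : Type u) [Field k] : tilt₂.Carrier k := tilt₂.ofFun ![0, 0, 1, 0, 0, 0, 0, 0]

lemma tilt₂Lift_tilt₂Gen (u v : M) (hu : gen k (.e 0) • u = u) (hv : gen k (.e 0) • v = v)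
    (h : gen k .α • u = gen k .y • gen k .α • v) : tilt₂Lift u v hu hv h (tilt₂Gen k) = v := by
  have (w : tilt₂.Carrier k) : tilt₂Lift u v hu hv h w = w 0 • u + w 1 • gen k .x • u + w 2 • v +
      w 3 • gen k .x • v + w 4 • gen k .α • v + w 5 • gen k .y • gen k .α • v +
      w 6 • gen k .β • gen k .α • v + w 7 • gen k .β • gen k .y • gen k .α • v := rfl
  rw [this]
  simp [tilt₂Gen]

end Homs

/-- A universal map from a power of `T` to `M`: a sum of homomorphisms which span the space of all
homomorphisms. -/
lemma exists_universal_hom {A : Type u} [Ring A] [Algebra k A] [Module.Finite k A]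
    (T M : Type u) [AddCommGroup T] [Module k T] [Module A T] [IsScalarTower k A T]
    [Module.Finite A T] [AddCommGroup M] [Module k M] [Module A M] [IsScalarTower k A M]
    [Module.Finite A M] : ∃ (n : ℕ) (π : (Fin n → T) →ₗ[A] M),
      ∀ φ : T →ₗ[A] M, ∃ l : T →ₗ[A] (Fin n → T), π ∘ₗ l = φ := by
  have : Module.Finite k T := Module.Finite.trans A T
  have : Module.Finite k M := Module.Finite.trans A M
  have : SMulCommClass A k M := IsScalarTower.to_smulCommClass'
  have : SMulCommClass A k T := IsScalarTower.to_smulCommClass'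
  have : Module.Finite k (T →ₗ[A] M) :=
    Module.Finite.of_injective (LinearMap.restrictScalarsₗ k A T M k)
      (LinearMap.restrictScalars_injective k)
  obtain ⟨n, b, hb⟩ := Module.Finite.exists_fin' k (T →ₗ[A] M)
  refine ⟨n, ∑ i, (b fun j => if i = j then 1 else 0).comp (LinearMap.proj i), fun φ => ?_⟩
  obtain ⟨c, rfl⟩ := hb φ
  refine ⟨LinearMap.pi fun i => c i • LinearMap.id, LinearMap.ext fun t => ?_⟩
  rw [LinearMap.pi_apply_eq_sum_univ b c]
  simp only [LinearMap.comp_apply, LinearMap.sum_apply, LinearMap.pi_apply, LinearMap.proj_apply,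
    LinearMap.smul_apply, LinearMap.id_apply]
  exact Finset.sum_congr rfl fun i _ => LinearMap.map_smul_of_tower _ _ _

section Add

variable {M : ModuleCat.{u} (QuiverAlgebra k)} [Module.Finite (QuiverAlgebra k) M]

/-- An approximation by the characteristic tilting module. It is surjective because every vector
at the first vertex is the image of the generator of `tilt₂`, and `α` is surjective on its kernel
because every vector killed by `α` is the image of a vector killed by `α`, namely of the generator
of `tilt₁`. -/
lemma exists_total_approximation (hM : IsAlphaSurjective k M) :
    ∃ (n : ℕ) (π : (Fin n → total (tilting k)) →ₗ[QuiverAlgebra k] M),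
      Function.Surjective π ∧ IsAlphaSurjective k (LinearMap.ker π) := by
  obtain ⟨n, π, hπ⟩ := exists_universal_hom (k := k) (A := QuiverAlgebra k) (total (tilting k)) M
  have hmem (v : M) (hv : gen k (.e 0) • v = v) : v ∈ LinearMap.range π := by
    obtain ⟨u, hu⟩ := hM (gen k .y • gen k .α • v) (by simp)
    obtain ⟨ψ, s, hs, -⟩ := exists_total_hom (k := k) 1
      (tilt₂Lift (gen k (.e 0) • u) v (by simp) hv (by rw [hu]; simp))
      (tilt₂Gen k)
    obtain ⟨l, rfl⟩ := hπ ψ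
    exact ⟨l s, hs.trans (tilt₂Lift_tilt₂Gen _ _ _ _ _)⟩
  refine ⟨n, π, fun m => ?_, ?_⟩
  · obtain ⟨u, hu⟩ := hM (gen k (.e 1) • m) (by simp)
    rw [← LinearMap.mem_range, ← e_smul_add k m, hu]
    refine add_mem (hmem _ (by simp)) ?_
    simpa using (LinearMap.range π).smul_mem (gen k .α) (hmem (gen k (.e 0) • u) (by simp))
  · rintro ⟨z, hz⟩ he
    obtain ⟨w, rfl⟩ := (IsAlphaSurjective.pi fun _ => isAlphaSurjective_total) z
      (congrArg Subtype.val he)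
    obtain ⟨ψ, s, hs, hs'⟩ := exists_total_hom (k := k) 0 (tilt₁Lift (π (gen k (.e 0) • w))
      (by rw [← map_smul]; simp) (by rw [← map_smul]; simpa using hz))
      (show tilting k 0 from tilt₁Gen k)
    obtain ⟨l, rfl⟩ := hπ ψ
    have hαs : gen k .α • s = 0 := hs' _ α_smul_tilt₁Gen
    refine ⟨⟨gen k (.e 0) • w - l s, ?_⟩, Subtype.ext ?_⟩
    · rw [LinearMap.mem_ker, map_sub, sub_eq_zero]
      exact (hs.trans (tilt₁Lift_tilt₁Gen _ _ _)).symm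
    · change _ = gen k .α • (gen k (.e 0) • w - l s)
      rw [smul_sub, ← map_smul, hαs, map_zero]
      simp

/-- The approximation of a module in `F(Δ) ∩ F(∇̄)` splits, since its kernel is in `F(∇̄)`. -/
lemma isInAdd_total_iff :
    IsInAdd (total (tilting k)) M ↔ IsDeltaExact k M ∧ IsAlphaSurjective k M := by
  constructor
  · rintro ⟨n, i, p, h⟩
    have h' := LinearMap.congr_fun h
    exact ⟨(IsDeltaExact.pi fun _ => isDeltaExact_total).of_retract i p h',
      (IsAlphaSurjective.pi fun _ => isAlphaSurjective_total).of_surjective (g := p)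
        fun m => ⟨_, h' m⟩⟩
  · rintro ⟨h, hα⟩
    obtain ⟨n, π, hπ, hker⟩ := exists_total_approximation hα
    obtain ⟨i, hi⟩ := exists_lift_of_subsingleton_ext_one (K := ModuleCat.of _ (LinearMap.ker π))
      (X := ModuleCat.of _ (Fin n → total (tilting k))) (LinearMap.ker π).injective_subtype
      (LinearMap.exact_subtype_ker_map π) hπ
      (h.isFiltered.subsingleton_ext_one (N := ModuleCat.of _ (LinearMap.ker π)) hker)
      LinearMap.id
    exact ⟨n, i, π, hi⟩

end Add

/-- The embedding of the algebra into two copies of `tilt₂`. -/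
def tiltEmbedding (k : Type u) [Field k] :
    QuiverAlgebra k →ₗ[QuiverAlgebra k] (Fin 2 → tilt₂.Carrier k) :=
  LinearMap.toSpanSingleton _ _
    ![tilt₂Gen k, tilt₂.ofFun ![0, 0, 0, 0, 1, 0, 0, 0]]

lemma tiltEmbedding_injective : Function.Injective (tiltEmbedding k) := by
  refine (injective_iff_map_eq_zero _).2 fun a ha => (equivRegular k).injective ?_
  rw [map_zero]
  have h0 := congrFun ha 0
  have h1 := congrFun ha 1
  change a • tilt₂Gen k = 0 at h0
  change a • (tilt₂.ofFun ![0, 0, 0, 0, 1, 0, 0, 0] : tilt₂.Carrier k) = 0 at h1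
  have hv : gen k (.e 0) • tilt₂Gen k = tilt₂Gen k := by
    funext i
    rw [gen_smul_apply]
    fin_cases i <;> simp [pre, tilt₂Gen]
  have hw : gen k (.e 1) • (tilt₂.ofFun ![0, 0, 0, 0, 1, 0, 0, 0] : tilt₂.Carrier k) =
      tilt₂.ofFun ![0, 0, 0, 0, 1, 0, 0, 0] := by
    funext i
    rw [gen_smul_apply]
    fin_cases i <;> simp [pre]
  rw [smul_eq_coeff₀ a hv] at h0
  rw [smul_eq_coeff₁ a hw] at h1
  replace h0 (j) := (congrFun h0 j).trans (show _ = (0 : k) from rfl)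
  replace h1 (j) := (congrFun h1 j).trans (show _ = (0 : k) from rfl)
  simp only [MonomialRep.add_apply, MonomialRep.smul_apply, gen_smul_apply] at h0 h1
  change coeff a = 0
  funext i
  fin_cases i
  · simpa [pre, tilt₂Gen] using h0 2
  · simpa [pre, tilt₂Gen] using h0 3
  · simpa [pre, tilt₂Gen] using h0 4
  · simpa [pre, tilt₂Gen] using h0 5
  · simpa [pre, tilt₂Gen] using h0 6
  · simpa [pre, tilt₂Gen] using h0 7
  · simpa [pre] using h1 4
  · simpa [pre] using h1 5
  · simpa [pre] using h1 6
  · simpa [pre] using h1 7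

lemma hasCoresolution_self :
    HasCoresolution (IsInAdd (total (tilting k))) 1 (ModuleCat.of _ (QuiverAlgebra k)) := by
  have hΔ : IsDeltaExact k (Fin 2 → tilt₂.Carrier k) := .pi fun _ => isDeltaExact_tilt₂
  have hα : IsAlphaSurjective k (Fin 2 → tilt₂.Carrier k) := .pi fun _ => isAlphaSurjective_tilt₂
  set R := LinearMap.range (tiltEmbedding k)
  have hex : Function.Exact (tiltEmbedding k) R.mkQ := LinearMap.exact_map_mkQ_range _
  have hK : IsInAdd (total (tilting k)) (ModuleCat.of _ ((Fin 2 → tilt₂.Carrier k) ⧸ R)) :=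
    isInAdd_total_iff.2 ⟨.of_cokernel tiltEmbedding_injective hex R.mkQ_surjective
      isDeltaExact_self hΔ, hα.of_surjective R.mkQ_surjective⟩
  exact .succ 0 (ModuleCat.of _ (QuiverAlgebra k)) (ModuleCat.of _ (Fin 2 → tilt₂.Carrier k))
    (ModuleCat.of _ (_ ⧸ R)) (isInAdd_total_iff.2 ⟨hΔ, hα⟩) (tiltEmbedding k) R.mkQ
    tiltEmbedding_injective hex R.mkQ_surjective (.zero _ _ hK (LinearEquiv.refl _ _))

theorem isGeneralizedTilting_total : IsGeneralizedTilting (total (tilting k)) where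
  finite := finite_total
  projectiveDimension_lt := by
    have := (isDeltaExact_total (k := k)).isFiltered.hasProjectiveDimensionLT
    exact (projectiveDimension_lt_iff.2 this).trans_le le_top
  ext_self _ hi := isDeltaExact_total.isFiltered.subsingleton_ext isAlphaSurjective_total hi
  coresolution := ⟨1, hasCoresolution_self⟩

/-! ### Indecomposability -/

section Indecomposable

lemma isIndecomposable_tilt₁ : IsIndecomposable (tiltModule₁ k) := by
  refine ⟨⟨tilt₁Gen k, 0, fun h => x_smul_tilt₁Gen (k := k) (by rw [h, smul_zero])⟩,
    fun N N' h => ?_⟩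
  have key (N : Submodule (QuiverAlgebra k) (tilt₁.Carrier k)) (hN : N ≠ ⊥) :
      gen k .x • tilt₁Gen k ∈ N := by
    have : Nontrivial N := Submodule.nontrivial_iff_ne_bot.2 hN
    obtain ⟨i, m, hm⟩ := exists_isSocleVector k N
    have h0 : m.1 0 = 0 := by
      have := coord_eq_zero (congrArg Subtype.val hm.x_smul) 1
      simpa [pre] using this
    have hm' : m.1 = m.1 1 • gen k .x • tilt₁Gen k := by
      funext i
      rw [MonomialRep.smul_apply, gen_smul_apply]
      fin_cases i <;> simp [pre, tilt₁Gen, h0]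
    have h1 : m.1 1 ≠ 0 := fun h1 => hm.ne_zero (Subtype.ext (by rw [hm', h1, zero_smul]; rfl))
    rw [← inv_smul_smul₀ h1 (gen k .x • tilt₁Gen k), ← hm']
    exact Submodule.smul_of_tower_mem _ _ m.2
  by_contra! hne
  exact x_smul_tilt₁Gen (h.disjoint.le_bot ⟨key N hne.1, key N' hne.2⟩)

/-- A direct summand of `tilt₂` without a vector at the second vertex vanishes. -/
lemma eq_bot_of_tilt₂ {N N' : Submodule (QuiverAlgebra k) (tilt₂.Carrier k)} (h : IsCompl N N')
    (hN : ∀ m ∈ N, gen k (.e 1) • m = 0) : N = ⊥ := by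
  have hΔ : IsDeltaExact k N := isDeltaExact_tilt₂.of_retract N.subtype
    (N.projectionOnto N' h) (Submodule.projectionOnto_apply_left h)
  have hx (m : N) : gen k .x • m = 0 := by
    have h1 : gen k .α • m.1 = 0 := by simpa using hN _ (N.smul_mem (gen k .α) m.2)
    have h1 := coord_eq_zero h1
    have := h1 4
    have := h1 5
    refine Subtype.ext (funext fun i => ?_)
    change (gen k .x • m.1) i = 0
    rw [gen_smul_apply]
    fin_cases i <;> simp_all [pre]
  have hβ (m : N) : gen k .β • m = 0 := Subtype.ext (by
    change gen k .β • m.1 = 0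
    have := congrArg (gen k .β • ·) (hN m.1 m.2)
    simpa using this)
  refine (Submodule.eq_bot_iff _).2 fun m hm => ?_
  have he : gen k (.e 0) • m = m := by simpa [hN m hm] using e_smul_add k m
  obtain ⟨w, t, hw⟩ := hΔ.x_exact ⟨m, hm⟩ 0 (Subtype.ext he) (by rw [hx, smul_zero])
  rw [hx, hβ, add_zero] at hw
  exact congrArg Subtype.val hw

lemma isIndecomposable_tilt₂ : IsIndecomposable (tiltModule₂ k) := by
  refine ⟨⟨tilt₂.ofFun ![1, 0, 0, 0, 0, 0, 0, 0], 0, fun h => one_ne_zero (congrFun h 0)⟩,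
    fun N N' h => ?_⟩
  -- one of the summands contains a vector at the second vertex outside the image of `y`,
  -- and hence all vectors at the second vertex
  have key (N N' : Submodule (QuiverAlgebra k) (tilt₂.Carrier k)) (h : IsCompl N N')
      (n : tilt₂.Carrier k) (hn : n ∈ N) (h4 : n 4 ≠ 0) : N' = ⊥ := by
    refine eq_bot_of_tilt₂ h.symm fun m hm => ?_
    have hmem : gen k (.e 1) • m ∈ N := by
      have : gen k (.e 1) • m = (m 4 / n 4) • gen k (.e 1) • n +
          ((m 5 - m 4 / n 4 * n 5) / n 4) • gen k .y • n := by
        funext i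
        rw [MonomialRep.add_apply, MonomialRep.smul_apply, MonomialRep.smul_apply, gen_smul_apply,
          gen_smul_apply, gen_smul_apply]
        fin_cases i <;> simp [pre, h4]
      rw [this]
      exact N.add_mem (Submodule.smul_of_tower_mem _ _ (N.smul_mem _ hn))
        (Submodule.smul_of_tower_mem _ _ (N.smul_mem _ hn))
    exact h.disjoint.le_bot ⟨hmem, N'.smul_mem _ hm⟩
  obtain ⟨n, hn, n', hn', hs⟩ := Submodule.mem_sup.1
    (h.sup_eq_top.ge (Submodule.mem_top (x := tilt₂.ofFun ![0, 0, 0, 0, (1 : k), 0, 0, 0])))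
  by_cases h4 : n 4 = 0
  · refine .inl (key N' N h.symm n' hn' fun h4' => one_ne_zero (α := k) ?_)
    have := congrFun hs 4
    change n 4 + n' 4 = 1 at this
    rw [← this, h4, h4', add_zero]
  · exact .inr (key N N' h n hn h4)

lemma isEmpty_tilt₁_equiv_tilt₂ :
    IsEmpty (tilt₁.Carrier k ≃ₗ[QuiverAlgebra k] tilt₂.Carrier k) := by
  refine ⟨fun e => ?_⟩
  set w : tilt₂.Carrier k := tilt₂.ofFun ![0, 0, 0, 0, 1, 0, 0, 0] with hw
  have h : gen k (.e 1) • w = w := by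
    funext i
    rw [gen_smul_apply]
    fin_cases i <;> simp [pre, hw]
  have h0 : e.symm w = 0 := eq_zero_of_tilt₁ _ (by rw [← map_smul, h])
  have : w = 0 := e.symm.map_eq_zero_iff.1 h0
  exact one_ne_zero (congrFun this 4)

end Indecomposable

/-! ### Characteristic tilting modules and their projective dimensions -/

theorem isCharacteristicTilting : IsCharacteristicTilting (proj k) (inj k) (tilting k) where
  indecomposable l := by
    fin_cases l
    · exact isIndecomposable_tilt₁
    · exact isIndecomposable_tilt₂
  distinct l m := by
    rintro ⟨e⟩
    fin_cases l <;> fin_cases m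
    · rfl
    · exact ((isEmpty_tilt₁_equiv_tilt₂ (k := k)).false e).elim
    · exact ((isEmpty_tilt₁_equiv_tilt₂ (k := k)).false e.symm).elim
    · rfl
  generalizedTilting := isGeneralizedTilting_total
  add_iff M _ := isInAdd_total_iff.trans
    ⟨fun h => ⟨h.1.isFiltered, h.2.isFiltered⟩, fun h => ⟨h.1.isDeltaExact, h.2.isAlphaSurjective⟩⟩

/-- A characteristic tilting module has a standard filtration, hence projective dimension at most
one, and `tilt₁`, which is not projective, is a summand of one of its powers. -/
theorem IsCharacteristicTilting.projectiveDimension_eq_one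
    {T : Fin 2 → ModuleCat.{u} (QuiverAlgebra k)}
    (hT : IsCharacteristicTilting (proj k) (inj k) T) : projectiveDimension (total T) = 1 := by
  have := hT.generalizedTilting.finite
  have h : IsInAdd (total T) (total T) :=
    ⟨1, LinearMap.pi fun _ => LinearMap.id, LinearMap.proj 0, rfl⟩
  refine le_antisymm ((projectiveDimension_le_iff (total T) 1).2
    ((hT.add_iff _ this).1 h).1.hasProjectiveDimensionLT)
    ((projectiveDimension_ge_iff (total T) 1).2 fun h => ?_)
  have := projective_of_hasProjectiveDimensionLT_one h
  obtain ⟨n, i, p, hip⟩ := (hT.add_iff (tiltModule₁ k)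
    (inferInstanceAs (Module.Finite (QuiverAlgebra k) (tilt₁.Carrier k)))).2
    ⟨IsDeltaExact.isFiltered (M := tiltModule₁ k) isDeltaExact_tilt₁,
      IsAlphaSurjective.isFiltered (M := tiltModule₁ k) isAlphaSurjective_tilt₁⟩
  refine x_smul_tilt₁Gen (k := k) ?_
  have hx : gen k .x • i (tilt₁Gen k) = 0 := funext fun j =>
    show gen k .x • i (tilt₁Gen k) j = 0 from x_smul_eq_zero_of_projective
    (congrFun (show gen k (.e 0) • i (tilt₁Gen k) = i (tilt₁Gen k) by
      rw [← map_smul, e_smul_tilt₁Gen]) j)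
    (congrFun (show gen k .α • i (tilt₁Gen k) = 0 by
      rw [← map_smul, α_smul_tilt₁Gen, map_zero]) j)
  have hp : p (i (tilt₁Gen k)) = tilt₁Gen k := LinearMap.congr_fun hip _
  rw [← hp, ← map_smul, hx, map_zero]

end Stratified

end

open Stratified in
theorem mainTheorem5 (k : Type u) [Field k] [IsAlgClosed k] :
    FiniteDimensional k (Stratified.QuiverAlgebra k) ∧
    (∃ L I : Fin 2 → ModuleCat.{u} (Stratified.QuiverAlgebra k),
      Stratified.IsLabelling L (Stratified.proj k) I ∧
      Stratified.IsProperlyStratified (Stratified.proj k) ∧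
      Stratified.HasSimplePreservingDuality (Stratified.QuiverAlgebra k) ∧
      (∃ T : Fin 2 → ModuleCat.{u} (Stratified.QuiverAlgebra k),
        Stratified.IsCharacteristicTilting (Stratified.proj k) I T) ∧
      (∀ T : Fin 2 → ModuleCat.{u} (Stratified.QuiverAlgebra k),
        Stratified.IsCharacteristicTilting (Stratified.proj k) I T →
          projectiveDimension (Stratified.total T) = 1 ∧
          2 * ((Stratified.finitisticFiltrationDim
            (Stratified.standard (Stratified.proj k)) : ℕ∞) : WithBot ℕ∞) <
              Stratified.finitisticDim (Stratified.QuiverAlgebra k) ∧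
          Stratified.finitisticDim (Stratified.QuiverAlgebra k) <
            2 * projectiveDimension (Stratified.total T))) ∧
    Stratified.finitisticFiltrationDim (Stratified.standard (Stratified.proj k)) = 0 ∧
    Stratified.finitisticDim (Stratified.QuiverAlgebra k) = 1 ∧
    ¬ Stratified.DoublingConjecture k := by
  have h2 : (1 : WithBot ℕ∞) < 2 * 1 := by rw [mul_one]; exact Nat.cast_lt.2 one_lt_two
  have hfin : FiniteDimensional k (QuiverAlgebra k) := inferInstance
  refine ⟨hfin, ⟨simpleModule k, inj k, isLabelling, isProperlyStratified_proj,
    hasSimplePreservingDuality, ⟨tilting k, isCharacteristicTilting⟩, fun T hT => ?_⟩,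
    finitisticFiltrationDim_eq_zero, finitisticDim_eq_one, fun h => ?_⟩
  · rw [hT.projectiveDimension_eq_one, finitisticDim_eq_one, finitisticFiltrationDim_eq_zero]
    exact ⟨rfl, by simp, h2⟩
  · have := h (QuiverAlgebra k) hfin 2 (simpleModule k) (proj k) (inj k) isLabelling
      isProperlyStratified_proj hasSimplePreservingDuality (tilting k) isCharacteristicTilting
    rw [isCharacteristicTilting.projectiveDimension_eq_one, finitisticDim_eq_one] at this
    exact h2.ne this
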